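/- **Setting.** Let $P$ be a path with nodes $v_0,\dots,v_m$, drawn from left to right, with edges $e_i=(v_i,v_{i+1})$, and attach terminals of degree one above and below the nodes, each the endpoint of exactly one line. A line $l$ of the finite set $L$ starts at a node of $P$ and ends at a node of $P$ further to the right, in each case above or below $P$; around each node the clockwise order of the terminals is given, and on each side of $P$, from left to right, first lines end and then lines start. For each edge $e$ let $L_e$ be the set of lines through $e$. A *feasible solution* consists, for every edge $e$, of orders $\pi^0(e),\dots,\pi^{t(e)}(e)$ of $L_e$ (from top to bottom), each obtained from the preceding one by a *block move* (exchange of two consecutive nonempty blocks), such that in each node the orders on the incident edges and the clockwise order of the terminals are consistent (lines with a common edge do not cross in a node). It has $\sum_e t(e)$ *block crossings*. MBCM asks for a feasible solution with the fewest block crossings among those in which no two lines cross twice; OPT is this minimum. For two lines with a common edge, they *must not cross* if the line that has to be above where the later of them starts also has to be above where the first of them ends. A block move is *monotone* if any two lines it exchanges are in the wrong order before, i.e. the upper one has to leave below the other. **Good pairs.** For each edge $e$ add virtual lines $t_e,b_e$ that exist on $e$ only and lie outermost above, respectively below, at both ends of $e$. Good pairs (upper line first) on $e=(u,v)$ are: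 (a) pairs of lines (virtual ones included) ending at $v$ that are consecutive there in clockwise order (at the last node $v_m$ the innermost line ending above is followed by the innermost line ending below; at other nodes the right edge separates them); (b) pairs $(a,b)$ both passing through $v$ that are good on the next edge; (c) $(a_2,b)$, where $b$ passes through $v$, $a_2$ is the last line ending at $v$ above $P$, $a_1$ is the first line starting at $v$ above $P$ (virtual lines included), $(a_1,b)$ is good on the next edge, and the inheritance is not prevented, i.e. no line $c$ passing through $v$ lies above $b$ and must not cross $b$; then $(a_2,b)$ is identified with $(a_1,b)$; (d) symmetrically below $P$. **Algorithm.** Process the edges from left to right. On $e=(u,v)$ first treat the lines ending at $v$ above $P$, the topmost first. If such a line $r$ is not already directly below its predecessor (the one treated before, or $t_e$), consider the maximal sequence of lines from $r$ downwards linked by good pairs of adjacent lines, and move it, in one block move, directly below the predecessor. Exception: suppose some line of the sequence must not be crossed by a line $l$ that the move would pass, $l$ having to leave above it. Let $b_0$ be the bottommost line in the sequence that ends at $v$ above $P$, let $b_0,b_1,\dots$ be the sequence from there on, and let $i$ be minimal such that $b_i$ is a line with such a forbidden crossing. If some of the pairs $(b_0,b_1),\dots,(b_{i-1},b_i)$ were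 created by a block crossing of the algorithm (up to identification by inheritance), break the sequence at any one of these. Otherwise break it at $(b_{j-1},b_j)$ with $j\le i$ minimal such that $b_j$ ends below $P$. Only the part above the break is moved. Then treat the lines ending at $v$ below $P$ symmetrically, the bottommost first. **Theorem.** However the free choices are made, the algorithm produces a feasible solution, all of whose block moves are monotone and in which no two lines cross twice, and the number $\mathrm{bc}_{\mathrm{alg}}$ of its block crossings satisfies $\mathrm{bc}_{\mathrm{alg}}\le 3\,\mathrm{OPT}$. That is, it yields a 3-approximation for MBCM on paths. -/

import Mathlib

/-- The two sides of a horizontally drawn path. -/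
inductive Side
  | above
  | below
  deriving DecidableEq

/-- An instance of (monotone) block crossing minimization on an embedded graph that consists of a
path with nodes `0, 1, ..., numEdges` (drawn from left to right; edge `e` joins the nodes `e` and
`e + 1`) and of attached terminals of degree one, every terminal belonging to exactly one line.

A line `l` enters the path at the node `first l` and leaves it at the node `last l`.
`starts s v` and `ends s v` list the lines that start, respectively end, at `v` on the side `s` of
the path, *the outermost line first*: for `s = above` from top to bottom, and for `s = below` from
bottom to top, as they lie on the incident edge of the path.  Thus the clockwise order around `v`
is: left edge, `ends above v`, reversed `starts above v`, right edge, `starts below v`,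
reversed `ends below v`. -/
structure PathInstance (L : Type*) where
  numEdges : ℕ
  first : L → ℕ
  last : L → ℕ
  starts : Side → ℕ → List L
  ends : Side → ℕ → List L
  first_lt_last : ∀ l, first l < last l
  last_le : ∀ l, last l ≤ numEdges
  starts_nodup : ∀ v, (starts .above v ++ starts .below v).Nodup
  ends_nodup : ∀ v, (ends .above v ++ ends .below v).Nodup
  mem_starts : ∀ v l, l ∈ starts .above v ++ starts .below v ↔ first l = v
  mem_ends : ∀ v l, l ∈ ends .above v ++ ends .below v ↔ last l = v

/-- `a` and `b` are consecutive elements of `w`, in this order. -/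
def Consecutive {α : Type*} (a b : α) (w : List α) : Prop := (a, b) ∈ w.zip w.tail

instance {α : Type*} [DecidableEq α] (a b : α) (w : List α) : Decidable (Consecutive a b w) :=
  inferInstanceAs (Decidable ((a, b) ∈ w.zip w.tail))

/-- `ρ` arises from `π` by one block move: two consecutive nonempty blocks are exchanged. -/
def BlockMove {α : Type*} (π ρ : List α) : Prop :=
  ∃ A B C D : List α, B ≠ [] ∧ C ≠ [] ∧ π = A ++ B ++ C ++ D ∧ ρ = A ++ C ++ B ++ D

/-- The step from the order `π` to the order `ρ` changes the relative order of `a` and `b`. -/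
def Crosses {α : Type*} (a b : α) (π ρ : List α) : Prop :=
  ([a, b].Sublist π ∧ [b, a].Sublist ρ) ∨ ([b, a].Sublist π ∧ [a, b].Sublist ρ)

instance {α : Type*} [DecidableEq α] (a b : α) (π ρ : List α) : Decidable (Crosses a b π ρ) :=
  inferInstanceAs (Decidable (_ ∨ _))

/-- A candidate solution: for every edge `e` the sequence `π⁰(e), ..., πᵗ(e)` of line orders, each
of them read from top to bottom, in the order in which they are met from left to right. -/
abbrev LineOrders (L : Type*) := ℕ → List (List L)

namespace PathInstance

section Problem

variable {L : Type*} (I : PathInstance L)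

/-- The line `l` passes through the edge `e`. -/
def OnEdge (e : ℕ) (l : L) : Prop := I.first l ≤ e ∧ e < I.last l

instance (e : ℕ) (l : L) : Decidable (I.OnEdge e l) := inferInstanceAs (Decidable (_ ∧ _))

/-- The order, just to the right of node `v`, of the lines starting at `v` and of lines passing
through `v` in the order `π`. -/
def startOrder (v : ℕ) (π : List L) : List L := I.starts .above v ++ π ++ (I.starts .below v).reverse

/-- The order, just to the left of node `v`, of the lines ending at `v` and of lines passing
through `v` in the order `π`. -/
def endOrder (v : ℕ) (π : List L) : List L := I.ends .above v ++ π ++ (I.ends .below v).reverse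

/-- Feasible solutions of BCM: on every edge a nonempty sequence of orders of the lines of that
edge, each obtained from the preceding one by a block move, such that the orders are consistent in
every node, i.e. lines sharing an edge do not cross in a node. -/
def Feasible (S : LineOrders L) : Prop :=
  (∀ e < I.numEdges, S e ≠ [] ∧ (∀ π ∈ S e, π.Nodup ∧ ∀ l, l ∈ π ↔ I.OnEdge e l) ∧
    (S e).IsChain BlockMove) ∧
  (∀ e < I.numEdges, ∀ π ∈ (S e).getLast?,
    π = I.endOrder (e + 1) (π.filter (fun l => I.OnEdge (e + 1) l))) ∧
  (∀ π ∈ (S 0).head?, 0 < I.numEdges → π = I.startOrder 0 []) ∧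
  (∀ e, e + 1 < I.numEdges → ∀ π ∈ (S e).getLast?, ∀ ρ ∈ (S (e + 1)).head?,
    ρ = I.startOrder (e + 1) (π.filter (fun l => I.OnEdge (e + 1) l)))

/-- The total number of block crossings. -/
def numBlockCrossings (S : LineOrders L) : ℕ :=
  ∑ e ∈ Finset.range I.numEdges, ((S e).length - 1)

/-- The number of times that the lines `a` and `b` cross. -/
def numCrossings [DecidableEq L] (S : LineOrders L) (a b : L) : ℕ :=
  ∑ e ∈ Finset.range I.numEdges, ((S e).zip (S e).tail).countP (fun p => Crosses a b p.1 p.2)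

/-- Feasible solutions of MBCM: feasible solutions of BCM in which no two lines cross twice. -/
def MonotoneFeasible [DecidableEq L] (S : LineOrders L) : Prop :=
  I.Feasible S ∧ ∀ a b : L, a ≠ b → I.numCrossings S a b ≤ 1

/-- For lines with a common edge: `a` is above `b` where the later of the two starts. -/
def EntersAbove (a b : L) : Prop :=
  (I.first b < I.first a ∧ a ∈ I.starts .above (I.first a)) ∨
  (I.first a < I.first b ∧ b ∈ I.starts .below (I.first b)) ∨
  (I.first a = I.first b ∧ [a, b].Sublist (I.startOrder (I.first a) []))

/-- For lines with a common edge: `a` is above `b` where the first of the two ends. -/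
def LeavesAbove (a b : L) : Prop :=
  (I.last a < I.last b ∧ a ∈ I.ends .above (I.last a)) ∨
  (I.last b < I.last a ∧ b ∈ I.ends .below (I.last b)) ∨
  (I.last a = I.last b ∧ [a, b].Sublist (I.endOrder (I.last a) []))

instance [DecidableEq L] (a b : L) : Decidable (I.EntersAbove a b) :=
  inferInstanceAs (Decidable (_ ∨ _))

instance [DecidableEq L] (a b : L) : Decidable (I.LeavesAbove a b) :=
  inferInstanceAs (Decidable (_ ∨ _))

/-- The step from `π` to `ρ` is monotone: two lines are exchanged only if they are in the wrong
order before, i.e. if the upper one has to leave below the other one. -/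
def MonotoneStep (π ρ : List L) : Prop :=
  ∀ a b : L, [a, b].Sublist π → [b, a].Sublist ρ → I.LeavesAbove b a

/-- All block moves of the solution are monotone. -/
def AllMovesMonotone (S : LineOrders L) : Prop :=
  ∀ e < I.numEdges, (S e).IsChain I.MonotoneStep

end Problem

end PathInstance

/-- What lies on an edge after the preprocessing: the lines of the instance that pass through the
edge `e`, and the two virtual lines `t_e` (`top`) and `b_e` (`bottom`), which exist on the edge `e`
only, `t_e` starting and ending outermost above the path and `b_e` outermost below. -/
inductive Strand (L : Type*)
  | top
  | line (l : L)
  | bottom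
  deriving DecidableEq

namespace Strand

variable {L : Type*}

/-- The order of an edge together with the two virtual lines. -/
def frame (π : List L) : List (Strand L) := top :: (π.map line ++ [bottom])

/-- The underlying line, unless the line is virtual. -/
def toLine : Strand L → Option L
  | top => none
  | line l => some l
  | bottom => none

/-- Removal of the virtual lines. -/
def unframe (w : List (Strand L)) : List L := w.filterMap toLine

/-- The virtual line on a given side. -/
def outer : Side → Strand L
  | .above => top
  | .below => bottom

instance [Fintype L] [DecidableEq L] : Fintype (Strand L) where
  elems := insert top (insert bottom (Finset.univ.image line))
  complete := by
    intro x
    cases x <;> simp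

end Strand

namespace PathInstance

open Strand

section GoodPairs

variable {L : Type*} (I : PathInstance L)

/-- The line `l` passes through the edges on both sides of the node `v`. -/
def PassesNode (v : ℕ) (l : L) : Prop := I.first l < v ∧ v < I.last l

instance (v : ℕ) (l : L) : Decidable (I.PassesNode v l) := inferInstanceAs (Decidable (_ ∧ _))

/-- The innermost line ending at `v` on side `s` (for `above`: the last line ending at `v` above
the path, from left to right), virtual lines included. -/
def innermostEnd (s : Side) (v : ℕ) : Strand L :=
  (outer s :: (I.ends s v).map line).getLast (List.cons_ne_nil _ _)

/-- The innermost line starting at `v` on side `s` (for `above`: the first line starting at `v`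
above the path, from left to right), virtual lines included. -/
def innermostStart (s : Side) (v : ℕ) : Strand L :=
  (outer s :: (I.starts s v).map line).getLast (List.cons_ne_nil _ _)

/-- At the node `v`, some line `c` is inheritance-preventing for pairs consisting of `b` and of a
line starting or ending at `v` on side `s`: it passes through `v`, it must not cross `b`, and it
is on side `s` of `b`, so that it separates `b` from all lines that end or start at `v` on that
side. -/
def InheritancePrevented (s : Side) (v : ℕ) (b : L) : Prop :=
  ∃ c, I.PassesNode v c ∧ match s with
    | .above => I.EntersAbove c b ∧ I.LeavesAbove c b
    | .below => I.EntersAbove b c ∧ I.LeavesAbove b c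

/-- The pair `(a, b)` on the edge left of `v` is continued by the pair `(a', b')` on the edge right
of `v`: either it is the same pair of lines, or `(a, b)` inherits from `(a', b')` above or below
the path, and this inheritance is not prevented. -/
def Continues (v : ℕ) (a b a' b' : Strand L) : Prop :=
  (∃ x y, I.PassesNode v x ∧ I.PassesNode v y ∧
    a = line x ∧ b = line y ∧ a' = line x ∧ b' = line y) ∨
  (∃ y, I.PassesNode v y ∧ ¬ I.InheritancePrevented .above v y ∧
    a = I.innermostEnd .above v ∧ b = line y ∧ a' = I.innermostStart .above v ∧ b' = line y) ∨
  (∃ x, I.PassesNode v x ∧ ¬ I.InheritancePrevented .below v x ∧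
    a = line x ∧ b = I.innermostEnd .below v ∧ a' = line x ∧ b' = I.innermostStart .below v)

/-- `a` and `b` both end at `v` and are consecutive there in clockwise order (virtual lines
included).  At the right end of the path no edge separates the lines ending above from the lines
ending below. -/
def ConsecutiveEnds (v : ℕ) (a b : Strand L) : Prop :=
  Consecutive a b (top :: (I.ends .above v).map line) ∨
  Consecutive a b ((I.ends .below v).reverse.map line ++ [bottom]) ∨
  (v = I.numEdges ∧ Consecutive a b (frame (I.endOrder v [])))

/-- `(a, b)` is a good pair on the edge `e`. -/
inductive GoodPair : ℕ → Strand L → Strand L → Prop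
  | ending {e : ℕ} {a b : Strand L} (he : e < I.numEdges) (h : I.ConsecutiveEnds (e + 1) a b) :
      GoodPair e a b
  | continuing {e : ℕ} {a b a' b' : Strand L} (he : e + 1 < I.numEdges)
      (h : I.Continues (e + 1) a b a' b') (hg : GoodPair (e + 1) a' b') : GoodPair e a b

theorem goodPair_iff (e : ℕ) (a b : Strand L) :
    I.GoodPair e a b ↔ (e < I.numEdges ∧ I.ConsecutiveEnds (e + 1) a b) ∨
      (e + 1 < I.numEdges ∧ ∃ a' b', I.Continues (e + 1) a b a' b' ∧ I.GoodPair (e + 1) a' b') := by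
  constructor
  · rintro (⟨he, h⟩ | ⟨he, h, hg⟩)
    · exact Or.inl ⟨he, h⟩
    · exact Or.inr ⟨he, _, _, h, hg⟩
  · rintro (⟨he, h⟩ | ⟨he, _, _, h, hg⟩)
    · exact .ending he h
    · exact .continuing he h hg

variable [Fintype L] [DecidableEq L]

instance (s : Side) (v : ℕ) (b : L) : Decidable (I.InheritancePrevented s v b) := by
  cases s <;> exact inferInstanceAs (Decidable (∃ c, _ ∧ (_ ∧ _)))

instance (v : ℕ) (a b a' b' : Strand L) : Decidable (I.Continues v a b a' b') :=
  inferInstanceAs (Decidable (_ ∨ _))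

instance (v : ℕ) (a b : Strand L) : Decidable (I.ConsecutiveEnds v a b) :=
  inferInstanceAs (Decidable (_ ∨ _))

/-- Good pairs can be computed from right to left. -/
def decidableGoodPair (k : ℕ) (e : ℕ) (h : I.numEdges ≤ e + k) (a b : Strand L) :
    Decidable (I.GoodPair e a b) :=
  match k with
  | 0 => isFalse (by rw [goodPair_iff]; omega)
  | k + 1 =>
    have : ∀ a' b', Decidable (I.GoodPair (e + 1) a' b') :=
      decidableGoodPair k (e + 1) (by omega)
    decidable_of_iff _ (I.goodPair_iff e a b).symm

instance (e : ℕ) (a b : Strand L) : Decidable (I.GoodPair e a b) :=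
  I.decidableGoodPair I.numEdges e (by omega) a b

end GoodPairs

section Algorithm

variable {L : Type*} (I : PathInstance L)

/-- `LeavesAbove`, extended to the virtual lines of an edge. -/
def StrandLeavesAbove : Strand L → Strand L → Prop
  | top, _ => True
  | _, bottom => True
  | line a, line b => I.LeavesAbove a b
  | _, _ => False

instance [DecidableEq L] (a b : Strand L) : Decidable (I.StrandLeavesAbove a b) := by
  cases a <;> cases b <;> unfold StrandLeavesAbove <;> infer_instance

/-- The order `w`, read from the side `s` to the other side. -/
def orient {α : Type*} (s : Side) (w : List α) : List α :=
  match s with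
  | .above => w
  | .below => w.reverse

/-- The pair consisting of `x` and of the next strand `y`, seen from the side `s`, as an ordered
pair from top to bottom. -/
def orientPair {α : Type*} (s : Side) (x y : α) : α × α :=
  match s with
  | .above => (x, y)
  | .below => (y, x)

/-- `l`, being on side `s` of `x`, must not be crossed by `x`. -/
def MustNotCross (s : Side) (l x : Strand L) : Prop :=
  I.StrandLeavesAbove (orientPair s l x).1 (orientPair s l x).2

instance [DecidableEq L] (s : Side) (l x : Strand L) : Decidable (I.MustNotCross s l x) :=
  inferInstanceAs (Decidable (I.StrandLeavesAbove _ _))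

/-- The strand ends on the side `s` of the path. -/
def EndsOn (s : Side) : Strand L → Prop
  | top => s = .above
  | line l => l ∈ I.ends s (I.last l)
  | bottom => s = .below

instance [DecidableEq L] (s : Side) (x : Strand L) : Decidable (I.EndsOn s x) := by
  cases x <;> unfold EndsOn <;> infer_instance

/-- The strand is a line that ends at the node `v` on the side `s`. -/
def EndsAt (s : Side) (v : ℕ) : Strand L → Prop
  | line l => l ∈ I.ends s v
  | _ => False

instance [DecidableEq L] (s : Side) (v : ℕ) (x : Strand L) : Decidable (I.EndsAt s v x) := by
  cases x <;> unfold EndsAt <;> infer_instance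

/-- The opposite side. -/
def otherSide : Side → Side
  | .above => .below
  | .below => .above

/-- The longest initial segment of a list in which any two consecutive elements are related. -/
def linkedPrefix {α : Type*} (R : α → α → Prop) [DecidableRel R] : List α → List α
  | [] => []
  | [x] => [x]
  | x :: y :: w => if R x y then x :: linkedPrefix R (y :: w) else [x]

/-- The state of the algorithm on an edge: the current order (virtual lines included), the good
pairs that have been created by block crossings (a good pair keeps being recorded when it passes
through a node, also if it does so by inheritance), and the orders on the edge so far. -/
structure State (L : Type*) where
  order : List (Strand L)
  created : Finset (Strand L × Strand L)
  history : List (List (Strand L))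

variable [Fintype L] [DecidableEq L]

/-- The number of strands of `chain` that are moved together.  Here `chain = [x₀, x₁, ...]` is the
sequence of strands linked by good pairs, starting with the line to be moved towards the side `s`
on the edge `e`, and `crossed` are the strands that the move passes.

If no strand in `crossed` is forbidden for a strand in `chain`, then all of `chain` is moved.
Otherwise let `xᵢ` be the first strand with a forbidden crossing, and consider the pairs
`(xⱼ₋₁, xⱼ)` with `xⱼ` behind the innermost line `x₍ₚ₋₁₎` in the chain that ends after `e` on side
`s`, and `j ≤ i`.  If some of them have been created by block crossings (are not initial), break
one of these, as chosen by `sel`; otherwise break the first one for which `xⱼ` ends on the other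
side of the path. -/
def moveLength (sel : ℕ → Side → List ℕ → ℕ) (s : Side) (e : ℕ)
    (created : Finset (Strand L × Strand L)) (crossed chain : List (Strand L)) : ℕ :=
  match chain.findIdx? (fun x => ∃ l ∈ crossed, I.MustNotCross s l x) with
  | none => chain.length
  | some i =>
    let p := (chain.takeWhile (fun x => I.EndsAt s (e + 1) x)).length
    let candidates := (List.range (i + 1)).filter (fun j => p ≤ j)
    let notInitial := candidates.filter (fun j =>
      ∃ x ∈ chain[j - 1]?, ∃ y ∈ chain[j]?, orientPair s x y ∈ created)
    if notInitial ≠ [] then sel e s notInitial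
    else (candidates.find? (fun j => ∃ y ∈ chain[j]?, I.EndsOn (otherSide s) y)).getD i

/-- Bring the line `r`, which ends after the edge `e` on side `s`, towards that side directly next
to `prev`, i.e. to the line ending there directly outside of `r`.  Nothing is done if `r` is
already there. -/
def placeLine (sel : ℕ → Side → List ℕ → ℕ) (s : Side) (e : ℕ) (prev r : Strand L)
    (st : State L) : State L :=
  let w := orient s st.order
  let placed := w.take (w.idxOf prev + 1)
  let rest := w.drop (w.idxOf prev + 1)
  let crossed := rest.take (rest.idxOf r)
  let tail := rest.drop (rest.idxOf r)
  if crossed = [] then st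
  else
    let chain := linkedPrefix
      (fun x y => I.GoodPair e (orientPair s x y).1 (orientPair s x y).2) tail
    let n := I.moveLength sel s e st.created crossed chain
    let order := orient s (placed ++ tail.take n ++ crossed ++ tail.drop n)
    { order := order
      created := st.created ∪ Finset.univ.filter (fun q =>
        I.GoodPair e q.1 q.2 ∧ Consecutive q.1 q.2 order ∧ ¬ Consecutive q.1 q.2 st.order)
      history := st.history ++ [order] }

/-- Bring the given lines one after the other to the side `s`. -/
def placeLines (sel : ℕ → Side → List ℕ → ℕ) (s : Side) (e : ℕ) :
    Strand L → List L → State L → State L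
  | _, [], st => st
  | prev, r :: rs, st => placeLines sel s e (line r) rs (I.placeLine sel s e prev (line r) st)

/-- The algorithm on the edge `e`: first the lines ending after `e` above the path are brought to
the top, topmost first, then those ending below to the bottom, bottommost first. -/
def processEdge (sel : ℕ → Side → List ℕ → ℕ) (e : ℕ) (st : State L) : State L :=
  I.placeLines sel .below e bottom (I.ends .below (e + 1))
    (I.placeLines sel .above e top (I.ends .above (e + 1)) st)

/-- The state at the left end of the edge `e`; edges are processed from left to right. -/
def startState (sel : ℕ → Side → List ℕ → ℕ) : ℕ → State L
  | 0 =>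
    let w := frame (I.startOrder 0 [])
    { order := w, created := ∅, history := [w] }
  | e + 1 =>
    let st := I.processEdge sel e (startState sel e)
    let w := frame (I.startOrder (e + 1)
      ((unframe st.order).filter (fun l => I.OnEdge (e + 1) l)))
    { order := w
      created := Finset.univ.filter (fun q => ∃ p ∈ st.created,
        I.Continues (e + 1) p.1 p.2 q.1 q.2)
      history := [w] }

/-- The output of the algorithm for monotone block crossings on a path.  The function `sel` makes
the choice that the algorithm leaves open: on edge `e`, when moving lines to side `s`, it selects
a position at which to break from the list of admissible positions. -/
def algorithm (sel : ℕ → Side → List ℕ → ℕ) : LineOrders L := fun e =>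
  (I.processEdge sel e (I.startState sel e)).history.map unframe

end Algorithm

end PathInstance

/-! A block crossing of any solution makes at most three pairs newly adjacent, one at each border of
the exchanged blocks (`card_new_adjacencies_le`). So it suffices to charge the block crossings of
the algorithm injectively to pairs, recorded with their edges, that become adjacent in an arbitrary
monotone solution S; this gives three times the cost of S as a bound, in particular for an optimal
S.

The algorithm makes a crossing only to bring a line next to its predecessor. These two form a good
pair d, which is adjacent in S at the node where it ends. If S creates d, or an earlier pair
identified with d by inheritance, then d is charged to that creation. Otherwise d has been adjacent
in S ever since it came into existence. Such an adjacency at birth is forced by the instance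
(`MonotoneFeasible.consecutive_of_initial`), so the algorithm had it as well and must have broken it
while it was initial, that is, not created by one of its own crossings.

A strand has at most one good partner on each side (`GoodPair.left_unique`,
`GoodPair.right_unique`), so a crossing of the algorithm breaks at most one good pair
(`Placed.move`). It breaks an initial one only in a chain of initial good pairs that starts with a
line ending at the next node and ends with a strand `f i` that may not pass some line l, although
its predecessor may. The invariant `InitialPairsKept` shows that l entered outside of `f i` whenever
`f i` is a genuine line. Hence l and `f i` do not cross in S, whereas the first line of the chain
has to leave outside of l. So l separates the chain in S at the end of the edge: some pair of the
chain is not adjacent there, and S creates its continuation later (`Feasible.exists_creation`). The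
crossing for d is charged to that creation.

Injectivity rests on the rule for the break. The strand `f i` ends on the opposite side
(`GoodPair.endsOn_below_of_between`, `GoodPair.endsOn_above_of_between`), so the break is at the
pair of the chain where the side of the ends changes. Every other pair contains a line that
inheritance never replaces. If such a pair reappears in a later chain of this kind, good partners
can be followed from it to the change, and thus the broken pair reappears too
(`Chain.exists_follows`). But a broken pair that becomes adjacent again counts as created, while the
later chain has initial pairs only. Hence two such chains never share a charge, nor does an indirect
charge meet a direct one (`Charged.unique`).

That the output is feasible and monotone holds because a moved block never passes a line that one of
its strands must not cross. An inversion is then only ever removed, so no two lines cross twice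
(`Feasible.numCrossings_le_one`). -/

section ListLemmas

/-! ### Precedence and adjacency in lists -/

variable {α β : Type*}

/-- The relation `[x, y].Sublist w` serves throughout as "x precedes y in w"; on duplicate-free
lists it is a strict linear order on the members. -/
theorem pair_sublist_append {x y : α} {A B : List α} :
    [x, y].Sublist (A ++ B) ↔ [x, y].Sublist A ∨ [x, y].Sublist B ∨ (x ∈ A ∧ y ∈ B) := by
  constructor
  · intro h
    obtain ⟨l₁, l₂, h, h₁, h₂⟩ := List.sublist_append_iff.1 h
    match l₁, h with
    | [], h => simp at h; subst h; exact Or.inr (Or.inl h₂)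
    | [a], h =>
      simp at h
      obtain ⟨rfl, rfl⟩ := h
      exact Or.inr (Or.inr ⟨by simpa using h₁, by simpa using h₂⟩)
    | [a, b], h =>
      simp at h
      obtain ⟨rfl, rfl, rfl⟩ := h
      exact Or.inl h₁
    | a :: b :: c :: l, h => simp at h
  · rintro (h | h | ⟨h, h'⟩)
    · exact h.trans (List.sublist_append_left _ _)
    · exact h.trans (List.sublist_append_right _ _)
    · exact (List.singleton_sublist.2 h).append (List.singleton_sublist.2 h')

theorem pair_sublist_cons {x y a : α} {B : List α} :
    [x, y].Sublist (a :: B) ↔ [x, y].Sublist B ∨ (x = a ∧ y ∈ B) := by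
  have := @pair_sublist_append _ x y [a] B
  rw [List.singleton_append] at this
  rw [this]
  simp only [List.mem_singleton]
  constructor
  · rintro (h | h | h)
    · have := h.length_le; simp at this
    · exact Or.inl h
    · exact Or.inr h
  · rintro (h | h)
    · exact Or.inr (Or.inl h)
    · exact Or.inr (Or.inr h)

theorem not_pair_sublist_nil {x y : α} : ¬ [x, y].Sublist ([] : List α) := by
  intro h; have := h.length_le; simp at this

theorem pair_sublist_mem_left {x y : α} {w : List α} (h : [x, y].Sublist w) : x ∈ w :=
  h.subset (by simp)

theorem pair_sublist_mem_right {x y : α} {w : List α} (h : [x, y].Sublist w) : y ∈ w :=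
  h.subset (by simp)

theorem pair_sublist_ne {x y : α} {w : List α} (hw : w.Nodup) (h : [x, y].Sublist w) : x ≠ y := by
  have := hw.sublist h
  simpa using this

theorem pair_sublist_antisymm {x y : α} {w : List α} (hw : w.Nodup) (h : [x, y].Sublist w)
    (h' : [y, x].Sublist w) : False := by
  induction w with
  | nil => exact not_pair_sublist_nil h
  | cons a w ih =>
    rw [List.nodup_cons] at hw
    rw [pair_sublist_cons] at h h'
    rcases h with h | ⟨rfl, h⟩ <;> rcases h' with h' | ⟨e, h'⟩
    · exact ih hw.2 h h'
    · exact hw.1 (e ▸ pair_sublist_mem_right h)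
    · exact hw.1 (pair_sublist_mem_right h')
    · exact hw.1 h'

theorem pair_sublist_total {x y : α} {w : List α} (hx : x ∈ w) (hy : y ∈ w) (hxy : x ≠ y) :
    [x, y].Sublist w ∨ [y, x].Sublist w := by
  induction w with
  | nil => simp at hx
  | cons a w ih =>
    simp only [pair_sublist_cons]
    rcases List.mem_cons.1 hx with rfl | hx' <;> rcases List.mem_cons.1 hy with rfl | hy'
    · exact absurd rfl hxy
    · exact Or.inl (Or.inr ⟨rfl, hy'⟩)
    · exact Or.inr (Or.inr ⟨rfl, hx'⟩)
    · rcases ih hx' hy' with h | h <;> tauto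

theorem pair_sublist_trans {x y z : α} {w : List α} (hw : w.Nodup) (h : [x, y].Sublist w)
    (h' : [y, z].Sublist w) : [x, z].Sublist w := by
  induction w with
  | nil => exact absurd h not_pair_sublist_nil
  | cons a w ih =>
    rw [List.nodup_cons] at hw
    rw [pair_sublist_cons] at h h' ⊢
    rcases h with h | ⟨rfl, h⟩ <;> rcases h' with h' | ⟨e, h'⟩
    · exact Or.inl (ih hw.2 h h')
    · exact absurd (e ▸ pair_sublist_mem_right h) hw.1
    · exact Or.inr ⟨rfl, pair_sublist_mem_right h'⟩
    · exact Or.inr ⟨rfl, h'⟩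

theorem pair_sublist_map {f : α → β} (hf : f.Injective) {x y : α} {w : List α} :
    [f x, f y].Sublist (w.map f) ↔ [x, y].Sublist w := by
  induction w with
  | nil => simp
  | cons a w ih =>
    rw [List.map_cons, pair_sublist_cons, pair_sublist_cons, ih, List.mem_map_of_injective hf,
      hf.eq_iff]

theorem pair_sublist_reverse {x y : α} {w : List α} :
    [x, y].Sublist w.reverse ↔ [y, x].Sublist w := by
  rw [← List.reverse_sublist]; simp

theorem consecutive_cons {a b x : α} {w : List α} :
    Consecutive a b (x :: w) ↔ (a = x ∧ w.head? = some b) ∨ Consecutive a b w := by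
  unfold Consecutive
  cases w with
  | nil => simp
  | cons y w => simp [eq_comm]

theorem not_consecutive_nil {a b : α} : ¬ Consecutive a b [] := by simp [Consecutive]

theorem consecutive_append {a b : α} {A B : List α} :
    Consecutive a b (A ++ B) ↔ Consecutive a b A ∨ Consecutive a b B ∨
      (A.getLast? = some a ∧ B.head? = some b) := by
  induction A with
  | nil => simp [not_consecutive_nil]
  | cons x A ih =>
    rw [List.cons_append, consecutive_cons, consecutive_cons, ih]
    cases A with
    | nil =>
      simp [not_consecutive_nil]
      constructor
      · rintro (⟨rfl, h⟩ | h) <;> tauto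
      · rintro (h | ⟨rfl, h⟩) <;> tauto
    | cons y A => simp [List.getLast?_cons]; tauto

theorem consecutive_iff {a b : α} {w : List α} :
    Consecutive a b w ↔ ∃ A B, w = A ++ a :: b :: B := by
  constructor
  · intro h
    induction w with
    | nil => exact absurd h not_consecutive_nil
    | cons x w ih =>
      rcases consecutive_cons.1 h with ⟨rfl, h'⟩ | h'
      · match w, h' with
        | y :: w, h' =>
          obtain rfl : y = b := by simpa using h'
          exact ⟨[], w, rfl⟩
      · obtain ⟨A, B, rfl⟩ := ih h'
        exact ⟨x :: A, B, rfl⟩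
  · rintro ⟨A, B, rfl⟩
    rw [consecutive_append]
    exact Or.inr (Or.inl (consecutive_cons.2 (Or.inl ⟨rfl, rfl⟩)))

theorem Consecutive.sublist {a b : α} {w : List α} (h : Consecutive a b w) :
    [a, b].Sublist w := by
  obtain ⟨A, B, rfl⟩ := consecutive_iff.1 h
  rw [pair_sublist_append, pair_sublist_cons]
  simp

theorem Consecutive.mem_left {a b : α} {w : List α} (h : Consecutive a b w) : a ∈ w :=
  pair_sublist_mem_left h.sublist

theorem Consecutive.mem_right {a b : α} {w : List α} (h : Consecutive a b w) : b ∈ w :=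
  pair_sublist_mem_right h.sublist

theorem consecutive_reverse {a b : α} {w : List α} :
    Consecutive a b w.reverse ↔ Consecutive b a w := by
  have key : ∀ {a b : α} {w : List α}, Consecutive b a w → Consecutive a b w.reverse := by
    intro a b w h
    obtain ⟨A, B, rfl⟩ := consecutive_iff.1 h
    exact consecutive_iff.2 ⟨B.reverse, A.reverse, by simp⟩
  exact ⟨fun h => by simpa using key h, key⟩

/-- What lies before the second element of a consecutive pair. -/
theorem Consecutive.before_right {a b c : α} {w : List α} (hw : w.Nodup)
    (h : Consecutive a b w) (hc : [c, b].Sublist w) : c = a ∨ [c, a].Sublist w := by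
  obtain ⟨A, B, rfl⟩ := consecutive_iff.1 h
  simp only [pair_sublist_append, pair_sublist_cons] at hc ⊢
  have hb : b ∉ A ∧ b ∉ B := by
    rw [List.nodup_append] at hw
    simp at hw
    exact ⟨fun h => (hw.2.2 _ h).2.1 rfl, hw.2.1.2.1⟩
  rcases hc with hc | ((hc | hc) | hc) | hc
  · exact absurd (pair_sublist_mem_right hc) hb.1
  · exact absurd (pair_sublist_mem_right hc) hb.2
  · exact absurd hc.2 hb.2
  · exact Or.inl hc.1
  · exact Or.inr (Or.inr (Or.inr ⟨hc.1, by simp⟩))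

/-- What lies behind the first element of a consecutive pair. -/
theorem Consecutive.behind_left {a b c : α} {w : List α} (hw : w.Nodup)
    (h : Consecutive a b w) (hc : [a, c].Sublist w) : c = b ∨ [b, c].Sublist w := by
  have := Consecutive.before_right (List.nodup_reverse.2 hw) (consecutive_reverse.2 h)
    (pair_sublist_reverse.2 hc)
  rwa [pair_sublist_reverse] at this

theorem Consecutive.left_unique {a a' b : α} {w : List α} (hw : w.Nodup)
    (h : Consecutive a b w) (h' : Consecutive a' b w) : a = a' := by
  rcases h'.before_right hw h.sublist with rfl | h₁
  · rfl
  · rcases h.before_right hw h'.sublist with rfl | h₂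
    · rfl
    · exact (pair_sublist_antisymm hw h₁ h₂).elim

theorem Consecutive.right_unique {a b b' : α} {w : List α} (hw : w.Nodup)
    (h : Consecutive a b w) (h' : Consecutive a b' w) : b = b' :=
  Consecutive.left_unique (List.nodup_reverse.2 hw) (consecutive_reverse.2 h)
    (consecutive_reverse.2 h')

/-- A block move destroys the adjacencies at the ends of the exchanged blocks only. -/
theorem consecutive_of_blocks {a b : α} {P C T D : List α}
    (h : Consecutive a b (P ++ C ++ T ++ D)) (hC : C ≠ []) (hT : T ≠ []) :
    Consecutive a b (P ++ T ++ C ++ D) ∨ (P.getLast? = some a ∧ C.head? = some b) ∨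
      (C.getLast? = some a ∧ T.head? = some b) ∨ (T.getLast? = some a ∧ D.head? = some b) := by
  simp only [consecutive_append, List.getLast?_append_of_ne_nil _ hC,
    List.getLast?_append_of_ne_nil _ hT] at h ⊢
  tauto

end ListLemmas

/-! ### Orders framed by the virtual lines -/

namespace Strand

variable {L : Type*}

theorem line_injective : Function.Injective (line : L → Strand L) := fun _ _ h => by
  cases h; rfl

theorem mem_frame {π : List L} {x : Strand L} :
    x ∈ frame π ↔ x = top ∨ (∃ l ∈ π, x = line l) ∨ x = bottom := by
  simp [frame, eq_comm]

theorem line_mem_frame {π : List L} {l : L} : line l ∈ frame π ↔ l ∈ π := by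
  simp [frame]

theorem nodup_frame {π : List L} : (frame π).Nodup ↔ π.Nodup := by
  simp [frame, List.nodup_append, List.nodup_map_iff line_injective]

theorem unframe_append (A B : List (Strand L)) : unframe (A ++ B) = unframe A ++ unframe B :=
  List.filterMap_append

theorem unframe_map_line (π : List L) : unframe (π.map line) = π := by
  induction π with
  | nil => rfl
  | cons a π ih => exact congrArg (a :: ·) ih

theorem unframe_frame (π : List L) : unframe (frame π) = π := by
  change unframe (π.map line ++ [bottom]) = π
  rw [unframe_append, unframe_map_line]
  exact List.append_nil π

theorem pair_sublist_frame {π : List L} {a b : L} :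
    [line a, line b].Sublist (frame π) ↔ [a, b].Sublist π := by
  rw [frame, pair_sublist_cons, pair_sublist_append, pair_sublist_map line_injective]
  simp

theorem top_sublist_frame {π : List L} {x : Strand L} (hx : x ∈ frame π) (h : x ≠ top) :
    [top, x].Sublist (frame π) := by
  rw [frame, pair_sublist_cons]
  rw [frame, List.mem_cons] at hx
  exact Or.inr ⟨rfl, hx.resolve_left h⟩

theorem sublist_frame_bottom {π : List L} {x : Strand L} (hx : x ∈ frame π) (h : x ≠ bottom) :
    [x, bottom].Sublist (frame π) := by
  rw [frame, ← List.cons_append, pair_sublist_append]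
  rw [frame, ← List.cons_append, List.mem_append] at hx
  simp only [List.mem_singleton] at hx ⊢
  exact Or.inr (Or.inr ⟨hx.resolve_right h, trivial⟩)

/-- Both outer lists are written outermost first, so the innermost strand of each side is a last
element. The lemma serves the left and the right end of an edge alike. -/
theorem frame_blocks (U m V : List L) :
    frame (U ++ m ++ V.reverse) =
      (top :: U.map line) ++ m.map line ++ (bottom :: V.map line).reverse := by
  simp [frame]

end Strand

namespace PathInstance

open Strand

/-! ### The orders in which lines enter and leave -/

section Basic

variable {L : Type*} (I : PathInstance L)

theorem last_of_mem_ends {s : Side} {v : ℕ} {l : L} (h : l ∈ I.ends s v) : I.last l = v := by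
  rw [← I.mem_ends, List.mem_append]
  cases s <;> tauto

theorem first_of_mem_starts {s : Side} {v : ℕ} {l : L} (h : l ∈ I.starts s v) :
    I.first l = v := by
  rw [← I.mem_starts, List.mem_append]
  cases s <;> tauto

theorem mem_ends_or (l : L) :
    l ∈ I.ends .above (I.last l) ∨ l ∈ I.ends .below (I.last l) := by
  rw [← List.mem_append, I.mem_ends]

theorem mem_starts_or (l : L) :
    l ∈ I.starts .above (I.first l) ∨ l ∈ I.starts .below (I.first l) := by
  rw [← List.mem_append, I.mem_starts]

theorem ends_disjoint {v v' : ℕ} {l : L} (h : l ∈ I.ends .above v) (h' : l ∈ I.ends .below v') :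
    False := by
  obtain rfl := I.last_of_mem_ends h
  obtain rfl := I.last_of_mem_ends h'
  exact (List.nodup_append.1 (I.ends_nodup _)).2.2 l h l h' rfl

theorem starts_disjoint {v v' : ℕ} {l : L} (h : l ∈ I.starts .above v)
    (h' : l ∈ I.starts .below v') : False := by
  obtain rfl := I.first_of_mem_starts h
  obtain rfl := I.first_of_mem_starts h'
  exact (List.nodup_append.1 (I.starts_nodup _)).2.2 l h l h' rfl

theorem nodup_ends (s : Side) (v : ℕ) : (I.ends s v).Nodup := by
  have := List.nodup_append.1 (I.ends_nodup v)
  cases s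
  · exact this.1
  · exact this.2.1

theorem mem_endOrder {v : ℕ} {m : List L} {l : L} :
    l ∈ I.endOrder v m ↔ l ∈ m ∨ I.last l = v := by
  rw [← I.mem_ends]; simp [endOrder]; tauto

theorem mem_startOrder {v : ℕ} {m : List L} {l : L} :
    l ∈ I.startOrder v m ↔ l ∈ m ∨ I.first l = v := by
  rw [← I.mem_starts]; simp [startOrder]; tauto

theorem nodup_endOrder {v : ℕ} {m : List L} (hm : m.Nodup) (h : ∀ l ∈ m, I.PassesNode v l) :
    (I.endOrder v m).Nodup := by
  have := List.nodup_append.1 (I.ends_nodup v)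
  rw [endOrder, List.nodup_append, List.nodup_append, List.nodup_reverse]
  refine ⟨⟨this.1, hm, ?_⟩, this.2.1, ?_⟩
  · rintro a ha b hb rfl
    exact (h a hb).2.ne' (I.last_of_mem_ends ha)
  · rintro a ha b hb rfl
    rw [List.mem_reverse] at hb
    rcases List.mem_append.1 ha with ha | ha
    · exact I.ends_disjoint ha hb
    · exact (h a ha).2.ne' (I.last_of_mem_ends hb)

theorem nodup_startOrder {v : ℕ} {m : List L} (hm : m.Nodup) (h : ∀ l ∈ m, I.PassesNode v l) :
    (I.startOrder v m).Nodup := by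
  have := List.nodup_append.1 (I.starts_nodup v)
  rw [startOrder, List.nodup_append, List.nodup_append, List.nodup_reverse]
  refine ⟨⟨this.1, hm, ?_⟩, this.2.1, ?_⟩
  · rintro a ha b hb rfl
    exact (h a hb).1.ne (I.first_of_mem_starts ha)
  · rintro a ha b hb rfl
    rw [List.mem_reverse] at hb
    rcases List.mem_append.1 ha with ha | ha
    · exact I.starts_disjoint ha hb
    · exact (h a ha).1.ne (I.first_of_mem_starts hb)

theorem endOrder_nil_sublist (v : ℕ) (m : List L) :
    (I.endOrder v []).Sublist (I.endOrder v m) := by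
  simp [endOrder]

theorem startOrder_nil_sublist (v : ℕ) (m : List L) :
    (I.startOrder v []).Sublist (I.startOrder v m) := by
  simp [startOrder]

/-- No common edge is required. Together with antisymmetry this permits replacing a negation by the
reversed relation for any two distinct lines. -/
theorem leavesAbove_total {a b : L} (h : a ≠ b) : I.LeavesAbove a b ∨ I.LeavesAbove b a := by
  rcases lt_trichotomy (I.last a) (I.last b) with hl | hl | hl
  · have := I.mem_ends_or a
    unfold LeavesAbove; tauto
  · have := pair_sublist_total (w := I.endOrder (I.last a) []) (x := a) (y := b)
      (by simp [mem_endOrder]) (by simp [mem_endOrder, hl]) h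
    unfold LeavesAbove
    rw [← hl]; tauto
  · have := I.mem_ends_or b
    unfold LeavesAbove; tauto

theorem leavesAbove_antisymm {a b : L} (h : I.LeavesAbove a b) (h' : I.LeavesAbove b a) :
    False := by
  unfold LeavesAbove at h h'
  rcases h with ⟨h, h₁⟩ | ⟨h, h₁⟩ | ⟨h, h₁⟩ <;> rcases h' with ⟨h', h₂⟩ | ⟨h', h₂⟩ | ⟨h', h₂⟩ <;>
    try omega
  · exact I.ends_disjoint h₁ h₂
  · exact I.ends_disjoint h₂ h₁
  · rw [← h] at h₂
    exact pair_sublist_antisymm (I.nodup_endOrder List.nodup_nil (by simp)) h₁ h₂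

theorem entersAbove_total {a b : L} (h : a ≠ b) : I.EntersAbove a b ∨ I.EntersAbove b a := by
  rcases lt_trichotomy (I.first a) (I.first b) with hl | hl | hl
  · have := I.mem_starts_or b
    unfold EntersAbove; tauto
  · have := pair_sublist_total (w := I.startOrder (I.first a) []) (x := a) (y := b)
      (by simp [mem_startOrder]) (by simp [mem_startOrder, hl]) h
    unfold EntersAbove
    rw [← hl]; tauto
  · have := I.mem_starts_or a
    unfold EntersAbove; tauto

theorem entersAbove_antisymm {a b : L} (h : I.EntersAbove a b) (h' : I.EntersAbove b a) :
    False := by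
  unfold EntersAbove at h h'
  rcases h with ⟨h, h₁⟩ | ⟨h, h₁⟩ | ⟨h, h₁⟩ <;> rcases h' with ⟨h', h₂⟩ | ⟨h', h₂⟩ | ⟨h', h₂⟩ <;>
    try omega
  · exact I.starts_disjoint h₁ h₂
  · exact I.starts_disjoint h₂ h₁
  · rw [← h] at h₂
    exact pair_sublist_antisymm (I.nodup_startOrder List.nodup_nil (by simp)) h₁ h₂

theorem strandLeavesAbove_total {x y : Strand L} (h : x ≠ y) :
    I.StrandLeavesAbove x y ∨ I.StrandLeavesAbove y x := by
  cases x <;> cases y <;> simp_all [StrandLeavesAbove]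
  exact I.leavesAbove_total h

theorem strandLeavesAbove_antisymm {x y : Strand L} (hxy : x ≠ y)
    (h : I.StrandLeavesAbove x y) (h' : I.StrandLeavesAbove y x) : False := by
  cases x <;> cases y <;> simp_all [StrandLeavesAbove]
  exact I.leavesAbove_antisymm h h'

/-- Lines of which one ends at `v` leave in the order in which they arrive at `v`. -/
theorem sublist_endOrder_of_leavesAbove {v : ℕ} {m : List L} (h : ∀ l ∈ m, I.PassesNode v l)
    {a b : L} (ha : a ∈ I.endOrder v m) (hb : b ∈ I.endOrder v m)
    (hv : I.last a = v ∨ I.last b = v) (hab : I.LeavesAbove a b) :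
    [a, b].Sublist (I.endOrder v m) := by
  rw [mem_endOrder] at ha hb
  have ha' : v ≤ I.last a := ha.elim (fun H => (h a H).2.le) (fun H => H.ge)
  have hb' : v ≤ I.last b := hb.elim (fun H => (h b H).2.le) (fun H => H.ge)
  rcases hab with ⟨hl, h₁⟩ | ⟨hl, h₁⟩ | ⟨hl, h₁⟩
  · obtain rfl : I.last a = v := by omega
    have hb : b ∈ m := hb.resolve_right (by omega)
    rw [endOrder, List.append_assoc, pair_sublist_append]
    simp [h₁, hb]
  · obtain rfl : I.last b = v := by omega
    have ha : a ∈ m := ha.resolve_right (by omega)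
    rw [endOrder, pair_sublist_append]
    simp [h₁, ha]
  · obtain rfl : I.last a = v := by omega
    exact h₁.trans (I.endOrder_nil_sublist _ _)

/-- Lines of which one starts at `v` leave `v` in the order in which they enter. -/
theorem sublist_startOrder_of_entersAbove {v : ℕ} {m : List L} (h : ∀ l ∈ m, I.PassesNode v l)
    {a b : L} (ha : a ∈ I.startOrder v m) (hb : b ∈ I.startOrder v m)
    (hv : I.first a = v ∨ I.first b = v) (hab : I.EntersAbove a b) :
    [a, b].Sublist (I.startOrder v m) := by
  rw [mem_startOrder] at ha hb
  have ha' : I.first a ≤ v := ha.elim (fun H => (h a H).1.le) (fun H => H.le)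
  have hb' : I.first b ≤ v := hb.elim (fun H => (h b H).1.le) (fun H => H.le)
  rcases hab with ⟨hl, h₁⟩ | ⟨hl, h₁⟩ | ⟨hl, h₁⟩
  · obtain rfl : I.first a = v := by omega
    have hb : b ∈ m := hb.resolve_right (by omega)
    rw [startOrder, List.append_assoc, pair_sublist_append]
    simp [h₁, hb]
  · obtain rfl : I.first b = v := by omega
    have ha : a ∈ m := ha.resolve_right (by omega)
    rw [startOrder, pair_sublist_append]
    simp [h₁, ha]
  · obtain rfl : I.first a = v := by omega
    exact h₁.trans (I.startOrder_nil_sublist _ _)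

theorem leavesAbove_of_sublist_endOrder {v : ℕ} {m : List L} (hm : m.Nodup)
    (h : ∀ l ∈ m, I.PassesNode v l) {a b : L} (hab : [a, b].Sublist (I.endOrder v m))
    (hv : I.last a = v ∨ I.last b = v) : I.LeavesAbove a b := by
  have hn := I.nodup_endOrder hm h
  refine (I.leavesAbove_total (pair_sublist_ne hn hab)).resolve_right fun h' => ?_
  exact pair_sublist_antisymm hn hab (I.sublist_endOrder_of_leavesAbove h
    (pair_sublist_mem_right hab) (pair_sublist_mem_left hab) hv.symm h')

theorem entersAbove_of_sublist_startOrder {v : ℕ} {m : List L} (hm : m.Nodup)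
    (h : ∀ l ∈ m, I.PassesNode v l) {a b : L} (hab : [a, b].Sublist (I.startOrder v m))
    (hv : I.first a = v ∨ I.first b = v) : I.EntersAbove a b := by
  have hn := I.nodup_startOrder hm h
  refine (I.entersAbove_total (pair_sublist_ne hn hab)).resolve_right fun h' => ?_
  exact pair_sublist_antisymm hn hab (I.sublist_startOrder_of_entersAbove h
    (pair_sublist_mem_right hab) (pair_sublist_mem_left hab) hv.symm h')

end Basic

/-! ### Good pairs at a node -/

section Pairs

variable {L : Type*} (I : PathInstance L)

theorem innermostEnd_getLast (s : Side) (v : ℕ) :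
    (outer s :: (I.ends s v).map line).getLast? = some (I.innermostEnd s v) :=
  List.getLast?_eq_some_getLast _

theorem innermostStart_getLast (s : Side) (v : ℕ) :
    (outer s :: (I.starts s v).map line).getLast? = some (I.innermostStart s v) :=
  List.getLast?_eq_some_getLast _

theorem innermostEnd_mem (s : Side) (v : ℕ) :
    I.innermostEnd s v ∈ outer s :: (I.ends s v).map line :=
  List.getLast_mem _

theorem innermostStart_mem (s : Side) (v : ℕ) :
    I.innermostStart s v ∈ outer s :: (I.starts s v).map line :=
  List.getLast_mem _

theorem line_mem_outer_cons {s : Side} {w : List L} {x : L} :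
    line x ∈ outer s :: w.map line ↔ x ∈ w := by
  cases s <;> simp [outer]

theorem mem_ends_of_innermostEnd {s : Side} {v : ℕ} {x : L} (h : I.innermostEnd s v = line x) :
    x ∈ I.ends s v := by
  have := I.innermostEnd_mem s v
  rwa [h, line_mem_outer_cons] at this

theorem mem_starts_of_innermostStart {s : Side} {v : ℕ} {x : L}
    (h : I.innermostStart s v = line x) : x ∈ I.starts s v := by
  have := I.innermostStart_mem s v
  rwa [h, line_mem_outer_cons] at this

theorem innermostEnd_ne_line {s : Side} {v : ℕ} {x : L} (h : I.PassesNode v x) :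
    I.innermostEnd s v ≠ line x := fun h' =>
  h.2.ne' (I.last_of_mem_ends (I.mem_ends_of_innermostEnd h'))

theorem innermostStart_ne_line {s : Side} {v : ℕ} {x : L} (h : I.PassesNode v x) :
    I.innermostStart s v ≠ line x := fun h' =>
  h.1.ne (I.first_of_mem_starts (I.mem_starts_of_innermostStart h'))

/-- The innermost ending strand on a side is never a passing line, so the three forms of
continuation exclude each other. With the innermost starting strands the same argument works from
right to left. -/
theorem continues_right_unique {v : ℕ} {a b a' b' a'' b'' : Strand L}
    (h : I.Continues v a b a' b') (h' : I.Continues v a b a'' b'') : a' = a'' ∧ b' = b'' := by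
  rcases h with ⟨x, y, hx, hy, rfl, rfl, rfl, rfl⟩ | ⟨y, hy, _, rfl, rfl, rfl, rfl⟩ |
      ⟨x, hx, _, rfl, rfl, rfl, rfl⟩ <;>
    rcases h' with ⟨x', y', hx', hy', e₁, e₂, rfl, rfl⟩ | ⟨y', hy', _, e₁, e₂, rfl, rfl⟩ |
      ⟨x', hx', _, e₁, e₂, rfl, rfl⟩
  · cases e₁; cases e₂; exact ⟨rfl, rfl⟩
  · exact absurd e₁.symm (I.innermostEnd_ne_line hx)
  · exact absurd e₂.symm (I.innermostEnd_ne_line hy)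
  · exact absurd e₁ (I.innermostEnd_ne_line hx')
  · cases e₂; exact ⟨rfl, rfl⟩
  · exact absurd e₂.symm (I.innermostEnd_ne_line hy)
  · exact absurd e₂ (I.innermostEnd_ne_line hy')
  · exact absurd e₂ (I.innermostEnd_ne_line hy')
  · cases e₁; exact ⟨rfl, rfl⟩

theorem continues_left_unique {v : ℕ} {a b a' b' a'' b'' : Strand L}
    (h : I.Continues v a b a'' b'') (h' : I.Continues v a' b' a'' b'') : a = a' ∧ b = b' := by
  rcases h with ⟨x, y, hx, hy, rfl, rfl, rfl, rfl⟩ | ⟨y, hy, _, rfl, rfl, rfl, rfl⟩ |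
      ⟨x, hx, _, rfl, rfl, rfl, rfl⟩ <;>
    rcases h' with ⟨x', y', hx', hy', rfl, rfl, e₁, e₂⟩ | ⟨y', hy', _, rfl, rfl, e₁, e₂⟩ |
      ⟨x', hx', _, rfl, rfl, e₁, e₂⟩
  · cases e₁; cases e₂; exact ⟨rfl, rfl⟩
  · exact absurd e₁.symm (I.innermostStart_ne_line hx)
  · exact absurd e₂.symm (I.innermostStart_ne_line hy)
  · exact absurd e₁ (I.innermostStart_ne_line hx')
  · cases e₂; exact ⟨rfl, rfl⟩
  · exact absurd e₂.symm (I.innermostStart_ne_line hy)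
  · exact absurd e₂ (I.innermostStart_ne_line hy')
  · exact absurd e₂ (I.innermostStart_ne_line hy')
  · cases e₁; exact ⟨rfl, rfl⟩

/-- At a node only the outer blocks change, while the order M of the passing lines stays. This lemma
and the next two express the adjacency of a pair inside M, or at a border of M, by M alone. -/
theorem consecutive_blocks_middle {α : Type*} {P M Q : List α} {x y : α}
    (hn : (P ++ M ++ Q).Nodup) (hx : x ∈ M) (hy : y ∈ M) :
    Consecutive x y (P ++ M ++ Q) ↔ Consecutive x y M := by
  obtain ⟨⟨-, -, h₁⟩, -, h₂⟩ : (P.Nodup ∧ M.Nodup ∧ ∀ a ∈ P, ∀ b ∈ M, a ≠ b) ∧ Q.Nodup ∧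
      ∀ a ∈ P ++ M, ∀ b ∈ Q, a ≠ b := by rwa [List.nodup_append, List.nodup_append] at hn
  rw [consecutive_append, consecutive_append]
  constructor
  · rintro ((h | h | ⟨h, -⟩) | h | ⟨-, h⟩)
    · exact absurd rfl (h₁ _ h.mem_left _ hx)
    · exact h
    · exact absurd rfl (h₁ _ (List.mem_of_getLast? h) _ hx)
    · exact absurd rfl (h₂ _ (List.mem_append_right _ hx) _ h.mem_left)
    · exact absurd rfl (h₂ _ (List.mem_append_right _ hy) _ (List.mem_of_head? h))
  · tauto

theorem consecutive_blocks_left {α : Type*} {P M Q : List α} {x y : α}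
    (hn : (P ++ M ++ Q).Nodup) (hx : P.getLast? = some x) (hy : y ∈ M) :
    Consecutive x y (P ++ M ++ Q) ↔ M.head? = some y := by
  obtain ⟨⟨-, -, h₁⟩, -, h₂⟩ : (P.Nodup ∧ M.Nodup ∧ ∀ a ∈ P, ∀ b ∈ M, a ≠ b) ∧ Q.Nodup ∧
      ∀ a ∈ P ++ M, ∀ b ∈ Q, a ≠ b := by rwa [List.nodup_append, List.nodup_append] at hn
  have hx' := List.mem_of_getLast? hx
  rw [consecutive_append, consecutive_append]
  constructor
  · rintro ((h | h | ⟨-, h⟩) | h | ⟨-, h⟩)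
    · exact absurd rfl (h₁ _ h.mem_right _ hy)
    · exact absurd rfl (h₁ _ hx' _ h.mem_left)
    · exact h
    · exact absurd rfl (h₂ _ (List.mem_append_left _ hx') _ h.mem_left)
    · exact absurd rfl (h₂ _ (List.mem_append_right _ hy) _ (List.mem_of_head? h))
  · tauto

theorem consecutive_blocks_right {α : Type*} {P M Q : List α} {x y : α}
    (hn : (P ++ M ++ Q).Nodup) (hx : x ∈ M) (hy : Q.head? = some y) :
    Consecutive x y (P ++ M ++ Q) ↔ M.getLast? = some x := by
  have h : (P ++ M ++ Q).reverse = Q.reverse ++ M.reverse ++ P.reverse := by simp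
  rw [← consecutive_reverse, h, consecutive_blocks_left (by rw [← h, List.nodup_reverse]; exact hn) (by simpa using hy)
    (by simpa using hx)]
  simp

/-- Good pairs stay adjacent when they pass a node. -/
theorem consecutive_iff_of_continues {v : ℕ} {m : List L} (hm : m.Nodup)
    (h : ∀ l, l ∈ m ↔ I.PassesNode v l) {a b a' b' : Strand L} (hc : I.Continues v a b a' b') :
    Consecutive a b (frame (I.endOrder v m)) ↔ Consecutive a' b' (frame (I.startOrder v m)) := by
  have h₁ := nodup_frame.2 (I.nodup_endOrder hm fun l hl => (h l).1 hl)
  have h₂ := nodup_frame.2 (I.nodup_startOrder hm fun l hl => (h l).1 hl)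
  unfold endOrder at h₁ ⊢
  unfold startOrder at h₂ ⊢
  rw [frame_blocks] at h₁ h₂ ⊢
  rw [frame_blocks]
  rcases hc with ⟨x, y, hx, hy, rfl, rfl, rfl, rfl⟩ | ⟨y, hy, _, rfl, rfl, rfl, rfl⟩ |
      ⟨x, hx, _, rfl, rfl, rfl, rfl⟩
  · have hx := List.mem_map_of_mem (f := line) ((h x).2 hx)
    have hy := List.mem_map_of_mem (f := line) ((h y).2 hy)
    rw [consecutive_blocks_middle h₁ hx hy, consecutive_blocks_middle h₂ hx hy]
  · have hy := List.mem_map_of_mem (f := line) ((h y).2 hy)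
    rw [consecutive_blocks_left h₁ (I.innermostEnd_getLast .above v) hy,
      consecutive_blocks_left h₂ (I.innermostStart_getLast .above v) hy]
  · have hx := List.mem_map_of_mem (f := line) ((h x).2 hx)
    rw [consecutive_blocks_right h₁ hx ((List.head?_reverse).trans (I.innermostEnd_getLast .below v)),
      consecutive_blocks_right h₂ hx ((List.head?_reverse).trans (I.innermostStart_getLast .below v))]

theorem not_passesNode_numEdges {l : L} : ¬ I.PassesNode I.numEdges l := fun h =>
  (I.last_le l).not_gt h.2

/-- Every feasible order at the right end of an edge has this form, so pairs ending together are
adjacent there in every solution. At the last node nothing passes and m is empty. -/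
theorem consecutive_of_consecutiveEnds {v : ℕ} {m : List L} (h : ∀ l ∈ m, I.PassesNode v l)
    {a b : Strand L} (hc : I.ConsecutiveEnds v a b) :
    Consecutive a b (frame (I.endOrder v m)) := by
  rcases hc with hc | hc | ⟨rfl, hc⟩
  · unfold endOrder
    rw [frame_blocks, consecutive_append, consecutive_append]
    exact Or.inl (Or.inl hc)
  · unfold endOrder
    rw [frame_blocks, consecutive_append]
    rw [List.reverse_cons, ← List.map_reverse]
    exact Or.inr (Or.inl hc)
  · obtain rfl : m = [] := List.eq_nil_iff_forall_not_mem.2 fun l hl =>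
      I.not_passesNode_numEdges (h l hl)
    exact hc

theorem last_of_consecutiveEnds {v : ℕ} {a b : Strand L} (hc : I.ConsecutiveEnds v a b) {x : L}
    (hx : a = line x ∨ b = line x) : I.last x = v := by
  have h := I.consecutive_of_consecutiveEnds (m := []) (by simp) hc
  have : line x ∈ frame (I.endOrder v []) := by
    rcases hx with rfl | rfl
    · exact h.mem_left
    · exact h.mem_right
  rw [line_mem_frame, mem_endOrder] at this
  simpa using this

theorem not_continues_of_consecutiveEnds {v : ℕ} {a b a' b' : Strand L}
    (hc : I.ConsecutiveEnds v a b) (h : I.Continues v a b a' b') : False := by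
  have key : ∃ x, I.PassesNode v x ∧ (a = line x ∨ b = line x) := by
    rcases h with ⟨x, y, hx, hy, rfl, rfl, rfl, rfl⟩ | ⟨y, hy, _, rfl, rfl, rfl, rfl⟩ |
      ⟨x, hx, _, rfl, rfl, rfl, rfl⟩
    exacts [⟨x, hx, Or.inl rfl⟩, ⟨y, hy, Or.inr rfl⟩, ⟨x, hx, Or.inl rfl⟩]
  obtain ⟨x, hx, h⟩ := key
  exact hx.2.ne' (I.last_of_consecutiveEnds hc h)

theorem GoodPair.lt {e : ℕ} {a b : Strand L} (h : I.GoodPair e a b) : e < I.numEdges := by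
  cases h <;> omega

/-- A good pair that is continued is good on the next edge. -/
theorem GoodPair.of_continues {e : ℕ} {a b a' b' : Strand L} (h : I.GoodPair e a b)
    (hc : I.Continues (e + 1) a b a' b') : I.GoodPair (e + 1) a' b' := by
  cases h with
  | ending he h => exact (I.not_continues_of_consecutiveEnds h hc).elim
  | continuing he h hg =>
    obtain ⟨rfl, rfl⟩ := I.continues_right_unique h hc
    exact hg

/-- Before the last node the right edge separates the two innermost ends. Their inner partners
therefore can only come from inheritance, never from a pair that ends together. -/
theorem not_consecutive_innermostEnd {v : ℕ} (hv : v < I.numEdges) {a b : Strand L}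
    (hc : I.ConsecutiveEnds v a b) :
    a ≠ I.innermostEnd .above v ∧ b ≠ I.innermostEnd .below v := by
  have hn := nodup_frame.2 (I.nodup_endOrder (v := v) List.nodup_nil (by simp))
  have hn' := hn
  unfold endOrder at hn'
  rw [frame_blocks] at hn'
  simp only [List.map_nil, List.append_nil] at hn'
  obtain ⟨hn₁, hn₂, hd⟩ := List.nodup_append.1 hn'
  have hA := I.innermostEnd_getLast .above v
  have hB : ((bottom :: (I.ends .below v).map line).reverse).head? =
      some (I.innermostEnd .below v) := by
    rw [List.head?_reverse]; exact I.innermostEnd_getLast .below v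
  rcases hc with hc | hc | ⟨rfl, hc⟩
  · refine ⟨?_, ?_⟩
    · rintro rfl
      change (top :: (I.ends .above v).map line).getLast? = _ at hA
      obtain ⟨A, B, h⟩ := consecutive_iff.1 hc
      rw [h] at hA hn₁
      rw [List.getLast?_append_of_ne_nil _ (by simp), List.getLast?_cons_cons] at hA
      have := List.mem_of_getLast? hA
      rw [List.nodup_append] at hn₁
      exact (List.nodup_cons.1 hn₁.2.1).1 this
    · rintro rfl
      exact hd _ hc.mem_right _ (List.mem_of_head? hB) rfl
  · have e : (bottom :: (I.ends .below v).map line).reverse =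
      (I.ends .below v).reverse.map line ++ [bottom] := by simp
    rw [← e] at hc
    refine ⟨?_, ?_⟩
    · rintro rfl
      exact hd _ (List.mem_of_getLast? hA) _ hc.mem_left rfl
    · rintro rfl
      obtain ⟨A, B, h⟩ := consecutive_iff.1 hc
      rw [h] at hB hn₂
      cases A with
      | nil =>
        simp at hB
        subst hB
        simp at hn₂
      | cons y A =>
        simp at hB
        subst hB
        simp at hn₂
  · omega

end Pairs

end PathInstance

namespace PathInstance

open Strand

/-! ### Uniqueness of good partners, and the sides on which they end -/

section GoodPairLemmas

variable {L : Type*} (I : PathInstance L)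

variable {I} in
-- Ending and continuing exclude each other for a given strand, and two continuations lead to good
-- pairs with the same lower strand on the next edge, so induction from right to left applies. This
-- is why one crossing of the algorithm breaks at most one good pair.
theorem GoodPair.left_unique {e : ℕ} {a a' b : Strand L} (h : I.GoodPair e a b)
    (h' : I.GoodPair e a' b) : a = a' := by
  induction h generalizing a' with
  | @ending e a b he hc =>
    have hn := nodup_frame.2 (I.nodup_endOrder (v := e + 1) List.nodup_nil (by simp))
    cases h' with
    | ending he' hc' =>
      exact (I.consecutive_of_consecutiveEnds (m := []) (by simp) hc).left_unique hn
        (I.consecutive_of_consecutiveEnds (by simp) hc')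
    | continuing he' hc' hg =>
      rcases hc' with ⟨x, y, hx, hy, rfl, rfl, rfl, rfl⟩ | ⟨y, hy, _, rfl, rfl, rfl, rfl⟩ |
        ⟨x, hx, _, rfl, rfl, rfl, rfl⟩
      · exact absurd (I.last_of_consecutiveEnds hc (Or.inr rfl)) hy.2.ne'
      · exact absurd (I.last_of_consecutiveEnds hc (Or.inr rfl)) hy.2.ne'
      · exact absurd rfl (I.not_consecutive_innermostEnd he' hc).2
  | @continuing e a b a₁ b₁ he hc hg ih =>
    cases h' with
    | ending he' hc' =>
      rcases hc with ⟨x, y, hx, hy, rfl, rfl, rfl, rfl⟩ | ⟨y, hy, _, rfl, rfl, rfl, rfl⟩ |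
        ⟨x, hx, _, rfl, rfl, rfl, rfl⟩
      · exact absurd (I.last_of_consecutiveEnds hc' (Or.inr rfl)) hy.2.ne'
      · exact absurd (I.last_of_consecutiveEnds hc' (Or.inr rfl)) hy.2.ne'
      · exact absurd rfl (I.not_consecutive_innermostEnd he hc').2
    | @continuing _ _ _ a₂ b₂ he' hc' hg' =>
      have hb : b₂ = b₁ := by
        rcases hc with ⟨x, y, hx, hy, rfl, rfl, rfl, rfl⟩ | ⟨y, hy, _, rfl, rfl, rfl, rfl⟩ |
            ⟨x, hx, _, rfl, rfl, rfl, rfl⟩ <;>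
          rcases hc' with ⟨x', y', hx', hy', rfl, e₂, rfl, rfl⟩ | ⟨y', hy', _, rfl, e₂, rfl, rfl⟩ |
            ⟨x', hx', _, rfl, e₂, rfl, rfl⟩
        · cases e₂; rfl
        · cases e₂; rfl
        · exact absurd e₂.symm (I.innermostEnd_ne_line hy)
        · cases e₂; rfl
        · cases e₂; rfl
        · exact absurd e₂.symm (I.innermostEnd_ne_line hy)
        · exact absurd e₂ (I.innermostEnd_ne_line hy')
        · exact absurd e₂ (I.innermostEnd_ne_line hy')
        · rfl
      subst hb
      obtain rfl := ih hg'
      exact (I.continues_left_unique hc hc').1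

variable {I} in
theorem GoodPair.right_unique {e : ℕ} {a b b' : Strand L} (h : I.GoodPair e a b)
    (h' : I.GoodPair e a b') : b = b' := by
  induction h generalizing b' with
  | @ending e a b he hc =>
    have hn := nodup_frame.2 (I.nodup_endOrder (v := e + 1) List.nodup_nil (by simp))
    cases h' with
    | ending he' hc' =>
      exact (I.consecutive_of_consecutiveEnds (m := []) (by simp) hc).right_unique hn
        (I.consecutive_of_consecutiveEnds (by simp) hc')
    | continuing he' hc' hg =>
      rcases hc' with ⟨x, y, hx, hy, rfl, rfl, rfl, rfl⟩ | ⟨y, hy, _, rfl, rfl, rfl, rfl⟩ |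
        ⟨x, hx, _, rfl, rfl, rfl, rfl⟩
      · exact absurd (I.last_of_consecutiveEnds hc (Or.inl rfl)) hx.2.ne'
      · exact absurd rfl (I.not_consecutive_innermostEnd he' hc).1
      · exact absurd (I.last_of_consecutiveEnds hc (Or.inl rfl)) hx.2.ne'
  | @continuing e a b a₁ b₁ he hc hg ih =>
    cases h' with
    | ending he' hc' =>
      rcases hc with ⟨x, y, hx, hy, rfl, rfl, rfl, rfl⟩ | ⟨y, hy, _, rfl, rfl, rfl, rfl⟩ |
        ⟨x, hx, _, rfl, rfl, rfl, rfl⟩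
      · exact absurd (I.last_of_consecutiveEnds hc' (Or.inl rfl)) hx.2.ne'
      · exact absurd rfl (I.not_consecutive_innermostEnd he hc').1
      · exact absurd (I.last_of_consecutiveEnds hc' (Or.inl rfl)) hx.2.ne'
    | @continuing _ _ _ a₂ b₂ he' hc' hg' =>
      have ha : a₂ = a₁ := by
        rcases hc with ⟨x, y, hx, hy, rfl, rfl, rfl, rfl⟩ | ⟨y, hy, _, rfl, rfl, rfl, rfl⟩ |
            ⟨x, hx, _, rfl, rfl, rfl, rfl⟩ <;>
          rcases hc' with ⟨x', y', hx', hy', e₁, rfl, rfl, rfl⟩ | ⟨y', hy', _, e₁, rfl, rfl, rfl⟩ |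
            ⟨x', hx', _, e₁, rfl, rfl, rfl⟩
        · cases e₁; rfl
        · exact absurd e₁.symm (I.innermostEnd_ne_line hx)
        · cases e₁; rfl
        · exact absurd e₁ (I.innermostEnd_ne_line hx')
        · rfl
        · exact absurd e₁ (I.innermostEnd_ne_line hx')
        · cases e₁; rfl
        · exact absurd e₁.symm (I.innermostEnd_ne_line hx)
        · cases e₁; rfl
      subst ha
      obtain rfl := ih hg'
      exact (I.continues_left_unique hc hc').2

variable {I}

theorem endsOn_below_of_innermostEnd (v : ℕ) : I.EndsOn .below (I.innermostEnd .below v) := by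
  have h := I.innermostEnd_mem .below v
  rcases List.mem_cons.1 h with h | h
  · rw [h]; rfl
  · obtain ⟨l, hl, h⟩ := List.mem_map.1 h
    rw [← h]
    have := I.last_of_mem_ends hl
    subst this
    exact hl

theorem endsOn_above_of_innermostEnd (v : ℕ) : I.EndsOn .above (I.innermostEnd .above v) := by
  have h := I.innermostEnd_mem .above v
  rcases List.mem_cons.1 h with h | h
  · rw [h]; rfl
  · obtain ⟨l, hl, h⟩ := List.mem_map.1 h
    rw [← h]
    have := I.last_of_mem_ends hl
    subst this
    exact hl

theorem endsOn_line_of_mem_ends {s : Side} {v : ℕ} {l : L} (h : l ∈ I.ends s v) :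
    I.EndsOn s (line l) := by
  obtain rfl := I.last_of_mem_ends h
  exact h

theorem endsOn_or (x : Strand L) : I.EndsOn .above x ∨ I.EndsOn .below x := by
  cases x with
  | top => exact Or.inl rfl
  | line l => exact I.mem_ends_or l
  | bottom => exact Or.inr rfl

theorem endsOn_disjoint {x : Strand L} (h : I.EndsOn .above x) (h' : I.EndsOn .below x) :
    False := by
  cases x with
  | top => cases h'
  | line l => exact I.ends_disjoint h h'
  | bottom => cases h

/-- If the upper line of a good pair ends below the path, then so does the lower one. -/
theorem GoodPair.endsOn_below {e : ℕ} {a b : Strand L} (h : I.GoodPair e a b)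
    (ha : I.EndsOn .below a) : I.EndsOn .below b := by
  induction h with
  | @ending e a b he hc =>
    have key : ∀ x ∈ (top :: (I.ends .above (e + 1)).map line), I.EndsOn .above x := by
      intro x hx
      rcases List.mem_cons.1 hx with rfl | hx
      · rfl
      · obtain ⟨l, hl, rfl⟩ := List.mem_map.1 hx
        exact endsOn_line_of_mem_ends hl
    have key' : ∀ x ∈ (bottom :: (I.ends .below (e + 1)).map line).reverse, I.EndsOn .below x := by
      intro x hx
      rcases List.mem_cons.1 (List.mem_reverse.1 hx) with rfl | hx
      · rfl
      · obtain ⟨l, hl, rfl⟩ := List.mem_map.1 hx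
        exact endsOn_line_of_mem_ends hl
    have h := I.consecutive_of_consecutiveEnds (m := []) (by simp) hc
    unfold endOrder at h
    rw [frame_blocks, List.map_nil, List.append_nil, consecutive_append] at h
    rcases h with h | h | h
    · exact (endsOn_disjoint (key _ h.mem_left) ha).elim
    · exact key' _ h.mem_right
    · exact (endsOn_disjoint (key _ (List.mem_of_getLast? h.1)) ha).elim
  | @continuing e a b a₁ b₁ he hc hg ih =>
    rcases hc with ⟨x, y, hx, hy, rfl, rfl, rfl, rfl⟩ | ⟨y, hy, _, rfl, rfl, rfl, rfl⟩ |
      ⟨x, hx, _, rfl, rfl, rfl, rfl⟩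
    · exact ih ha
    · exact (endsOn_disjoint (endsOn_above_of_innermostEnd _) ha).elim
    · exact endsOn_below_of_innermostEnd _

theorem GoodPair.endsOn_above {e : ℕ} {a b : Strand L} (h : I.GoodPair e a b)
    (hb : I.EndsOn .above b) : I.EndsOn .above a :=
  (endsOn_or a).resolve_right fun h' => endsOn_disjoint hb (h.endsOn_below h')

theorem line_mem_frame_endOrder_onEdge {e : ℕ} {x : L}
    (h : I.last x = e + 1) : I.OnEdge e x := by
  have := I.first_lt_last x
  exact ⟨by omega, by omega⟩

theorem onEdge_of_passesNode {e : ℕ} {x : L} (h : I.PassesNode (e + 1) x) :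
    I.OnEdge e x ∧ I.OnEdge (e + 1) x := by
  obtain ⟨h, h'⟩ := h
  exact ⟨⟨by omega, by omega⟩, ⟨by omega, by omega⟩⟩

theorem onEdge_of_innermostEnd {e : ℕ} {s : Side} {x : L}
    (h : I.innermostEnd s (e + 1) = line x) : I.OnEdge e x :=
  line_mem_frame_endOrder_onEdge (I.last_of_mem_ends (I.mem_ends_of_innermostEnd h))

theorem GoodPair.onEdge {e : ℕ} {a b : Strand L} (h : I.GoodPair e a b) {x : L}
    (hx : a = line x ∨ b = line x) : I.OnEdge e x := by
  cases h with
  | ending he hc => exact line_mem_frame_endOrder_onEdge (I.last_of_consecutiveEnds hc hx)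
  | continuing he hc hg =>
    rcases hc with ⟨y, z, hy, hz, rfl, rfl, rfl, rfl⟩ | ⟨y, hy, _, rfl, rfl, rfl, rfl⟩ |
      ⟨y, hy, _, rfl, rfl, rfl, rfl⟩
    · rcases hx with hx | hx <;> cases hx
      exacts [(onEdge_of_passesNode hy).1, (onEdge_of_passesNode hz).1]
    · rcases hx with hx | hx
      · exact onEdge_of_innermostEnd hx
      · cases hx; exact (onEdge_of_passesNode hy).1
    · rcases hx with hx | hx
      · cases hx; exact (onEdge_of_passesNode hy).1
      · exact onEdge_of_innermostEnd hx

theorem GoodPair.ne_top {e : ℕ} {a b : Strand L} (h : I.GoodPair e a b) : b ≠ top := by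
  have key : I.innermostEnd .below (e + 1) ≠ top := fun h => by
    have := endsOn_below_of_innermostEnd (I := I) (e + 1)
    rw [h] at this; cases this
  rintro rfl
  cases h with
  | ending he hc =>
    have h := I.consecutive_of_consecutiveEnds (m := []) (by simp) hc
    have hn := nodup_frame.2 (I.nodup_endOrder (v := e + 1) List.nodup_nil (by simp))
    exact pair_sublist_antisymm hn h.sublist
      (top_sublist_frame h.mem_left (pair_sublist_ne hn h.sublist))
  | continuing he hc hg =>
    rcases hc with ⟨y, z, hy, hz, rfl, h, rfl, rfl⟩ | ⟨y, hy, _, rfl, h, rfl, rfl⟩ |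
      ⟨y, hy, _, rfl, h, rfl, rfl⟩
    · cases h
    · cases h
    · exact key h.symm

theorem GoodPair.ne_bottom {e : ℕ} {a b : Strand L} (h : I.GoodPair e a b) : a ≠ bottom := by
  have key : I.innermostEnd .above (e + 1) ≠ bottom := fun h => by
    have := endsOn_above_of_innermostEnd (I := I) (e + 1)
    rw [h] at this; cases this
  rintro rfl
  cases h with
  | ending he hc =>
    have h := I.consecutive_of_consecutiveEnds (m := []) (by simp) hc
    have hn := nodup_frame.2 (I.nodup_endOrder (v := e + 1) List.nodup_nil (by simp))
    exact pair_sublist_antisymm hn h.sublist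
      (sublist_frame_bottom h.mem_right (pair_sublist_ne hn h.sublist).symm)
  | continuing he hc hg =>
    rcases hc with ⟨y, z, hy, hz, h, _, rfl, rfl⟩ | ⟨y, hy, _, h, _, rfl, rfl⟩ |
      ⟨y, hy, _, h, _, rfl, rfl⟩
    · cases h
    · exact key h.symm
    · cases h

theorem strandLeavesAbove_of_sublist_endOrder {v : ℕ} {x y : Strand L}
    (h : [x, y].Sublist (frame (I.endOrder v []))) : I.StrandLeavesAbove x y := by
  have hn := nodup_frame.2 (I.nodup_endOrder (v := v) List.nodup_nil (by simp))
  have hx := pair_sublist_mem_left h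
  have hy := pair_sublist_mem_right h
  have hne := pair_sublist_ne hn h
  cases x with
  | top => trivial
  | bottom => exact (pair_sublist_antisymm hn h (sublist_frame_bottom hy hne.symm)).elim
  | line a =>
    cases y with
    | top => exact (pair_sublist_antisymm hn h (top_sublist_frame hx hne)).elim
    | bottom => trivial
    | line b =>
      rw [line_mem_frame, mem_endOrder] at hx
      exact I.leavesAbove_of_sublist_endOrder List.nodup_nil (by simp)
        (pair_sublist_frame.1 h) (Or.inl (hx.resolve_left (by simp)))

theorem pair_sublist_getLast {α : Type*} {x a : α} {w : List α} (hx : x ∈ w)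
    (ha : w.getLast? = some a) (h : x ≠ a) : [x, a].Sublist w := by
  obtain ⟨A, rfl⟩ := List.getLast?_eq_some_iff.1 ha
  rw [pair_sublist_append]
  simp at hx ⊢
  tauto

/-- A line may get between the two lines of a good pair from above only if the lower one of
them ends below the path. -/
theorem GoodPair.endsOn_below_of_between {e : ℕ} {a b : Strand L} (h : I.GoodPair e a b)
    {l y : L} (hb : b = line y) (hl : I.OnEdge e l) (hal : I.StrandLeavesAbove a (line l))
    (hla : a ≠ line l)
    (hly : I.LeavesAbove l y) (henter : I.EntersAbove l y) : I.EndsOn .below b := by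
  by_contra hcon
  have hy : I.EndsOn .above b := (endsOn_or _).resolve_right hcon
  induction h with
  | @ending e a b he hc =>
    subst hb
    have h := I.consecutive_of_consecutiveEnds (m := []) (by simp) hc
    have hn := nodup_frame.2 (I.nodup_endOrder (v := e + 1) List.nodup_nil (by simp))
    have hye := I.last_of_consecutiveEnds hc (Or.inr rfl)
    -- Since y ends above and l leaves above y, l ends no later than y; being on the edge `e`, it
    -- ends at the same node.
    have hle : I.last l = e + 1 := by
      have := hl.2
      rcases hly with ⟨h, h'⟩ | ⟨h, h'⟩ | ⟨h, h'⟩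
      · omega
      · exact (I.ends_disjoint hy h').elim
      · omega
    have h₁ : [line l, line y].Sublist (frame (I.endOrder (e + 1) [])) :=
      pair_sublist_frame.2 (I.sublist_endOrder_of_leavesAbove (by simp)
        (I.mem_endOrder.2 (Or.inr hle)) (I.mem_endOrder.2 (Or.inr hye)) (Or.inl hle) hly)
    rcases h.before_right hn h₁ with h₂ | h₂
    · exact hla h₂.symm
    · exact I.strandLeavesAbove_antisymm hla hal (strandLeavesAbove_of_sublist_endOrder h₂)
  | @continuing e a b a₁ b₁ he hc hg ih =>
    have hl₁ := hl.1
    have hl₂ := hl.2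
    rcases hc with ⟨x, z, hx, hz, rfl, rfl, rfl, rfl⟩ | ⟨z, hz, hp, rfl, rfl, rfl, rfl⟩ |
      ⟨x, hx, _, rfl, rfl, rfl, rfl⟩
    · cases hb
      -- The line l does not end at this node: as both lines of the pair pass, `hly` would make it
      -- end above and `hal` below.
      refine ih rfl ⟨by omega, ?_⟩ hal hla hcon hy
      by_contra hlt
      have hle : I.last l = e + 1 := by omega
      have h₁ := hx.2
      have h₂ := hz.2
      rcases hly with ⟨h, h'⟩ | ⟨h, h'⟩ | ⟨h, h'⟩ <;> rcases hal with ⟨g, g'⟩ | ⟨g, g'⟩ | ⟨g, g'⟩ <;>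
        try omega
      exact I.ends_disjoint h' g'
    · cases hb
      -- If l passes the node, it prevents the inheritance. If it ends here, it ends above, hence
      -- outside of the innermost end or equal to it, contrary to `hal` and `hla`.
      refine hp ⟨l, ⟨by omega, ?_⟩, henter, hly⟩
      by_contra hlt
      have hle : I.last l = e + 1 := by omega
      have h₂ := hz.2
      rcases hly with ⟨h, h'⟩ | ⟨h, h'⟩ | ⟨h, h'⟩ <;> try omega
      rw [hle] at h'
      have h₃ := pair_sublist_getLast (line_mem_outer_cons.2 h')
        (I.innermostEnd_getLast .above (e + 1)) hla.symm
      refine I.strandLeavesAbove_antisymm hla hal (strandLeavesAbove_of_sublist_endOrder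
        (v := e + 1) (h₃.trans ?_))
      unfold endOrder
      rw [frame_blocks, List.append_assoc]
      exact List.sublist_append_left _ _
    · exact hcon (endsOn_below_of_innermostEnd _)

/-- A line may get between the two lines of a good pair from below only if the upper one of
them ends above the path. -/
theorem GoodPair.endsOn_above_of_between {e : ℕ} {a b : Strand L} (h : I.GoodPair e a b)
    {l x : L} (ha : a = line x) (hl : I.OnEdge e l) (hlb : I.StrandLeavesAbove (line l) b)
    (hlne : line l ≠ b)
    (hxl : I.LeavesAbove x l) (henter : I.EntersAbove x l) : I.EndsOn .above a := by
  by_contra hcon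
  have hx : I.EndsOn .below a := (endsOn_or _).resolve_left hcon
  induction h with
  | @ending e a b he hc =>
    subst ha
    have h := I.consecutive_of_consecutiveEnds (m := []) (by simp) hc
    have hn := nodup_frame.2 (I.nodup_endOrder (v := e + 1) List.nodup_nil (by simp))
    have hxe := I.last_of_consecutiveEnds hc (Or.inl rfl)
    have hle : I.last l = e + 1 := by
      have := hl.2
      rcases hxl with ⟨h, h'⟩ | ⟨h, h'⟩ | ⟨h, h'⟩
      · exact (I.ends_disjoint h' hx).elim
      · omega
      · omega
    have h₁ : [line x, line l].Sublist (frame (I.endOrder (e + 1) [])) :=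
      pair_sublist_frame.2 (I.sublist_endOrder_of_leavesAbove (by simp)
        (I.mem_endOrder.2 (Or.inr hxe)) (I.mem_endOrder.2 (Or.inr hle)) (Or.inl hxe) hxl)
    rcases h.behind_left hn h₁ with h₂ | h₂
    · exact hlne h₂
    · exact I.strandLeavesAbove_antisymm hlne hlb (strandLeavesAbove_of_sublist_endOrder h₂)
  | @continuing e a b a₁ b₁ he hc hg ih =>
    have hl₁ := hl.1
    have hl₂ := hl.2
    rcases hc with ⟨x, z, hpx, hz, rfl, rfl, rfl, rfl⟩ | ⟨z, hz, hp, rfl, rfl, rfl, rfl⟩ |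
      ⟨z, hz, hp, rfl, rfl, rfl, rfl⟩
    · cases ha
      refine ih rfl ⟨by omega, ?_⟩ hlb hlne hcon ‹_›
      by_contra hlt
      have hle : I.last l = e + 1 := by omega
      have h₁ := hpx.2
      have h₂ := hz.2
      rcases hxl with ⟨h, h'⟩ | ⟨h, h'⟩ | ⟨h, h'⟩ <;> rcases hlb with ⟨g, g'⟩ | ⟨g, g'⟩ | ⟨g, g'⟩ <;>
        try omega
      exact I.ends_disjoint g' h'
    · exact hcon (endsOn_above_of_innermostEnd _)
    · cases ha
      refine hp ⟨l, ⟨by omega, ?_⟩, henter, hxl⟩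
      by_contra hlt
      have hle : I.last l = e + 1 := by omega
      have h₂ := hz.2
      rcases hxl with ⟨h, h'⟩ | ⟨h, h'⟩ | ⟨h, h'⟩ <;> try omega
      rw [hle] at h'
      have h₃ := pair_sublist_getLast (line_mem_outer_cons.2 h')
        (I.innermostEnd_getLast .below (e + 1)) hlne
      refine I.strandLeavesAbove_antisymm hlne hlb (strandLeavesAbove_of_sublist_endOrder
        (v := e + 1) ((pair_sublist_reverse.2 h₃).trans ?_))
      unfold endOrder
      rw [frame_blocks]
      exact List.sublist_append_right _ _

end GoodPairLemmas

/-! ### Identification of pairs by inheritance, and chains -/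

section Inheritance

variable {L : Type*} (I : PathInstance L)

/-- A pair on an edge is followed by the pair that continues it on the next edge. -/
def Inherits (p q : ℕ × Strand L × Strand L) : Prop :=
  q.1 = p.1 + 1 ∧ I.Continues q.1 p.2.1 p.2.2 q.2.1 q.2.2

/-- The pairs that are identified by inheritance, in the order of the edges. -/
def Follows : ℕ × Strand L × Strand L → ℕ × Strand L × Strand L → Prop :=
  Relation.ReflTransGen I.Inherits

/-- A good pair on an edge, given by the edge and the pair. -/
def Good (p : ℕ × Strand L × Strand L) : Prop := I.GoodPair p.1 p.2.1 p.2.2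

variable {I}

theorem Inherits.right_unique {p q q' : ℕ × Strand L × Strand L} (h : I.Inherits p q)
    (h' : I.Inherits p q') : q = q' := by
  obtain ⟨e, a, b⟩ := p
  obtain ⟨e₁, a₁, b₁⟩ := q
  obtain ⟨e₂, a₂, b₂⟩ := q'
  obtain ⟨h₁, h₂⟩ := h
  obtain ⟨h₁', h₂'⟩ := h'
  dsimp only at *
  subst h₁ h₁'
  obtain ⟨rfl, rfl⟩ := I.continues_right_unique h₂ h₂'
  rfl

theorem Inherits.left_unique {p p' q : ℕ × Strand L × Strand L} (h : I.Inherits p q)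
    (h' : I.Inherits p' q) : p = p' := by
  obtain ⟨e₁, a₁, b₁⟩ := p
  obtain ⟨e₂, a₂, b₂⟩ := p'
  obtain ⟨e, a, b⟩ := q
  obtain ⟨h₁, h₂⟩ := h
  obtain ⟨h₁', h₂'⟩ := h'
  dsimp only at *
  obtain rfl : e₁ = e₂ := by omega
  obtain ⟨rfl, rfl⟩ := I.continues_left_unique h₂ h₂'
  rfl

theorem Follows.le {p q : ℕ × Strand L × Strand L} (h : I.Follows p q) : p.1 ≤ q.1 := by
  induction h with
  | refl => exact le_rfl
  | tail _ h ih => have := h.1; omega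

theorem Follows.eq {p q : ℕ × Strand L × Strand L} (h : I.Follows p q) (he : q.1 ≤ p.1) :
    p = q := by
  rcases Relation.ReflTransGen.cases_tail h with h | ⟨r, h, h'⟩
  · exact h.symm
  · have := Follows.le h
    have := h'.1
    omega

/-- Inheritance is a partial injection from each edge to the next, so the pairs identified with a
given one form a single path ordered by their edges. -/
theorem Follows.total_right {p q r : ℕ × Strand L × Strand L} (h : I.Follows p q)
    (h' : I.Follows p r) (hqr : q.1 ≤ r.1) : I.Follows q r := by
  rcases Relation.ReflTransGen.total_of_right_unique
    (r := I.Inherits) (fun _ _ _ => Inherits.right_unique) h h' with h | h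
  · exact h
  · rw [Follows.eq h hqr]; exact .refl

theorem Follows.total_left {p q r : ℕ × Strand L × Strand L} (h : I.Follows p r)
    (h' : I.Follows q r) (hpq : p.1 ≤ q.1) : I.Follows p q := by
  rcases Relation.ReflTransGen.total_of_right_unique
    (r := Function.swap I.Inherits) (fun _ _ _ => Inherits.left_unique)
    (Relation.reflTransGen_swap.2 h) (Relation.reflTransGen_swap.2 h') with h | h
  · rw [← Follows.eq (Relation.reflTransGen_swap.1 h) hpq]; exact .refl
  · exact Relation.reflTransGen_swap.1 h

theorem Inherits.good_right {p q : ℕ × Strand L × Strand L} (h : I.Inherits p q)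
    (hp : I.Good p) : I.Good q := by
  obtain ⟨e, a, b⟩ := p
  obtain ⟨e₁, a₁, b₁⟩ := q
  obtain ⟨h₁, h₂⟩ := h
  dsimp only at *
  subst h₁
  exact GoodPair.of_continues I hp h₂

theorem Inherits.good_left {p q : ℕ × Strand L × Strand L} (h : I.Inherits p q)
    (hq : I.Good q) : I.Good p := by
  obtain ⟨e, a, b⟩ := p
  obtain ⟨e₁, a₁, b₁⟩ := q
  obtain ⟨h₁, h₂⟩ := h
  dsimp only at *
  subst h₁
  exact .continuing (GoodPair.lt I hq) h₂ hq

theorem Follows.good_right {p q : ℕ × Strand L × Strand L} (h : I.Follows p q)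
    (hp : I.Good p) : I.Good q := by
  induction h with
  | refl => exact hp
  | tail _ h ih => exact h.good_right ih

/-- Only inheritance below the path replaces the lower strand, and the strand replaced then ends
below. -/
theorem Inherits.lower_eq {p q : ℕ × Strand L × Strand L} (h : I.Inherits p q)
    (hy : I.EndsOn .above p.2.2) : q.2.2 = p.2.2 := by
  rcases h.2 with ⟨x, z, hx, hz, h₁, h₂, h₃, h₄⟩ | ⟨z, hz, _, h₁, h₂, h₃, h₄⟩ |
    ⟨z, hz, _, h₁, h₂, h₃, h₄⟩
  · rw [h₂, h₄]
  · rw [h₂, h₄]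
  · rw [h₂] at hy
    exact (endsOn_disjoint hy (endsOn_below_of_innermostEnd _)).elim

theorem Inherits.upper_eq {p q : ℕ × Strand L × Strand L} (h : I.Inherits p q)
    (hy : I.EndsOn .below p.2.1) : q.2.1 = p.2.1 := by
  rcases h.2 with ⟨x, z, hx, hz, h₁, h₂, h₃, h₄⟩ | ⟨z, hz, _, h₁, h₂, h₃, h₄⟩ |
    ⟨z, hz, _, h₁, h₂, h₃, h₄⟩
  · rw [h₁, h₃]
  · rw [h₁] at hy
    exact (endsOn_disjoint (endsOn_above_of_innermostEnd _) hy).elim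
  · rw [h₁, h₃]

/-- The lower line of a pair does not change once it is a line ending above. -/
theorem Follows.lower_eq {p q : ℕ × Strand L × Strand L} (h : I.Follows p q)
    (hy : I.EndsOn .above p.2.2) : q.2.2 = p.2.2 := by
  induction h with
  | refl => rfl
  | tail _ h ih => rw [← ih]; exact h.lower_eq (ih ▸ hy)

/-- The upper line of a pair does not change once it is a line ending below. -/
theorem Follows.upper_eq {p q : ℕ × Strand L × Strand L} (h : I.Follows p q)
    (hy : I.EndsOn .below p.2.1) : q.2.1 = p.2.1 := by
  induction h with
  | refl => rfl
  | tail _ h ih => rw [← ih]; exact h.upper_eq (ih ▸ hy)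

/-- A good pair is continued as long as its upper line goes on. -/
theorem exists_follows_of_upper {e e' : ℕ} {a : L} {y : Strand L} (h : I.GoodPair e (line a) y)
    (hee : e ≤ e') (ha : I.OnEdge e' a) :
    ∃ y', I.Follows (e, line a, y) (e', line a, y') := by
  induction e', hee using Nat.le_induction with
  | base => exact ⟨y, .refl⟩
  | succ e' hee ih =>
    have hae := h.onEdge (Or.inl rfl)
    have hp : I.PassesNode (e' + 1) a := ⟨by have := hae.1; omega, ha.2⟩
    obtain ⟨y', hf⟩ := ih (onEdge_of_passesNode hp).1
    cases hf.good_right h with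
    | ending he hc => exact absurd (I.last_of_consecutiveEnds hc (Or.inl rfl)) hp.2.ne'
    | @continuing _ _ _ a₁ b₁ he hc hg =>
      have h₁ : a₁ = line a := by
        rcases hc with ⟨x, z, hx, hz, h₁, h₂, h₃, h₄⟩ | ⟨z, hz, _, h₁, h₂, h₃, h₄⟩ |
          ⟨z, hz, _, h₁, h₂, h₃, h₄⟩
        · exact h₃.trans h₁.symm
        · exact absurd h₁.symm (I.innermostEnd_ne_line hp)
        · exact h₃.trans h₁.symm
      subst h₁
      exact ⟨b₁, hf.tail ⟨rfl, hc⟩⟩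

/-- A good pair is continued as long as its lower line goes on. -/
theorem exists_follows_of_lower {e e' : ℕ} {a : L} {x : Strand L} (h : I.GoodPair e x (line a))
    (hee : e ≤ e') (ha : I.OnEdge e' a) :
    ∃ x', I.Follows (e, x, line a) (e', x', line a) := by
  induction e', hee using Nat.le_induction with
  | base => exact ⟨x, .refl⟩
  | succ e' hee ih =>
    have hae := h.onEdge (Or.inr rfl)
    have hp : I.PassesNode (e' + 1) a := ⟨by have := hae.1; omega, ha.2⟩
    obtain ⟨x', hf⟩ := ih (onEdge_of_passesNode hp).1
    cases hf.good_right h with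
    | ending he hc => exact absurd (I.last_of_consecutiveEnds hc (Or.inr rfl)) hp.2.ne'
    | @continuing _ _ _ a₁ b₁ he hc hg =>
      have h₁ : b₁ = line a := by
        rcases hc with ⟨x, z, hx, hz, h₁, h₂, h₃, h₄⟩ | ⟨z, hz, _, h₁, h₂, h₃, h₄⟩ |
          ⟨z, hz, _, h₁, h₂, h₃, h₄⟩
        · exact h₄.trans h₂.symm
        · exact h₄.trans h₂.symm
        · exact absurd h₂.symm (I.innermostEnd_ne_line hp)
      subst h₁
      exact ⟨a₁, hf.tail ⟨rfl, hc⟩⟩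

/-- A sequence of strands `g 0, ..., g i`, from top to bottom, linked by good pairs on the edge
`e`, of which those before position `j` end above the path and those from `j` on below. -/
structure Chain (I : PathInstance L) (e : ℕ) (g : ℕ → Strand L) (i j : ℕ) : Prop where
  good : ∀ k < i, I.GoodPair e (g k) (g (k + 1))
  pos : 0 < j
  le : j ≤ i
  above : ∀ k < j, I.EndsOn .above (g k)
  below : ∀ k, j ≤ k → k ≤ i → I.EndsOn .below (g k)

/-- If a pair of a chain of good pairs, other than the one at which the side changes, occurs in a
later chain, then so does the pair at which the side changes. -/
theorem Chain.exists_follows {e e' : ℕ} {g g' : ℕ → Strand L} {i i' j j' : ℕ}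
    (h : I.Chain e g i j) (h' : I.Chain e' g' i' j') (hee : e ≤ e') {k k' : ℕ} (hk : k < i)
    (hkj : k + 1 ≠ j) (hk' : k' < i')
    (hf : I.Follows (e, g k, g (k + 1)) (e', g' k', g' (k' + 1))) :
    ∃ m < i', I.Follows (e, g (j - 1), g j) (e', g' m, g' (m + 1)) := by
  have ends_on : ∀ m, m ≤ i' → (m < j' ∧ I.EndsOn .above (g' m)) ∨
      (j' ≤ m ∧ I.EndsOn .below (g' m)) := by
    intro m hm
    rcases Nat.lt_or_ge m j' with h₁ | h₁
    · exact Or.inl ⟨h₁, h'.above m h₁⟩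
    · exact Or.inr ⟨h₁, h'.below m h₁ hm⟩
  have hi' := h'.le
  have hi := h.le
  have hpos := h'.pos
  have hpos' := h.pos
  -- Before the change of side the lower line of each pair is never replaced, so the later chain
  -- contains it, and good partners are followed downwards. Behind the change the upper line plays
  -- this role, and the walk goes upwards.
  rcases Nat.lt_or_ge (k + 1) j with hlt | hge
  -- A strand with good partners on both sides is not virtual. Occurring on `e'`, it carries its
  -- good pair along to that edge, where uniqueness identifies it with the pair of the later chain.
  · have next : ∀ u u', 0 < u → u < j → u' < i' → g' u' = g u →
        I.Follows (e, g u, g (u + 1)) (e', g' u', g' (u' + 1)) := by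
      intro u u' h₀ h₁ h₂ heq
      have hg := h.good u (by omega)
      have hg' := h'.good u' h₂
      obtain ⟨a, ha⟩ : ∃ a, g u = line a := by
        have h₃ := (h.good (u - 1) (by omega)).ne_top
        rw [Nat.sub_add_cancel h₀] at h₃
        have h₄ := hg.ne_bottom
        cases hgu : g u with
        | top => exact absurd hgu h₃
        | line a => exact ⟨a, rfl⟩
        | bottom => exact absurd hgu h₄
      rw [heq] at hg' ⊢
      rw [ha] at hg hg' ⊢
      obtain ⟨y', hy'⟩ := exists_follows_of_upper hg hee (hg'.onEdge (Or.inl rfl))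
      rwa [← GoodPair.right_unique (hy'.good_right hg) hg']
    have key : ∀ t, k + 1 + t < j → g' (k' + 1 + t) = g (k + 1 + t) ∧ k' + 1 + t < j' := by
      intro t
      induction t with
      | zero =>
        intro ht
        have h₁ := hf.lower_eq (h.above _ ht)
        refine ⟨h₁, ?_⟩
        rcases ends_on (k' + 1) hk' with h₂ | h₂
        · exact h₂.1
        · refine (endsOn_disjoint (h.above _ ht) ?_).elim
          rw [← show g' (k' + 1) = g (k + 1) from h₁]
          exact h₂.2
      | succ t ih =>
        intro ht
        obtain ⟨h₁, h₂⟩ := ih (by omega)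
        have h₃ := (next _ _ (by omega) (by omega) (by omega) h₁).lower_eq (h.above _ ht)
        refine ⟨h₃, ?_⟩
        rcases ends_on (k' + 1 + t + 1) (by omega) with h₂ | h₂
        · exact h₂.1
        · refine (endsOn_disjoint (h.above _ ht) ?_).elim
          rw [← show g' (k' + 1 + t + 1) = g (k + 1 + (t + 1)) from h₃]
          exact h₂.2
    -- The walk starts at position `k + 1` and has to reach `j - 1`, the last strand ending above.
    obtain ⟨h₁, h₂⟩ := key (j - 2 - k) (by omega)
    refine ⟨k' + 1 + (j - 2 - k), by omega, ?_⟩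
    have := next _ _ (by omega) (by omega) (by omega) h₁
    rwa [show k + 1 + (j - 2 - k) = j - 1 by omega, show j - 1 + 1 = j by omega] at this
  · have next : ∀ u u', j ≤ u → u < i → 0 < u' → u' ≤ i' → g' u' = g u →
        I.Follows (e, g (u - 1), g u) (e', g' (u' - 1), g' u') := by
      intro u u' h₀ h₁ h₂ h₃ heq
      have hg := h.good (u - 1) (by omega)
      rw [show u - 1 + 1 = u by omega] at hg
      have hg' := h'.good (u' - 1) (by omega)
      rw [show u' - 1 + 1 = u' by omega] at hg'
      obtain ⟨a, ha⟩ : ∃ a, g u = line a := by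
        have h₃ := hg.ne_top
        have h₄ := (h.good u h₁).ne_bottom
        cases hgu : g u with
        | top => exact absurd hgu h₃
        | line a => exact ⟨a, rfl⟩
        | bottom => exact absurd hgu h₄
      rw [heq] at hg' ⊢
      rw [ha] at hg hg' ⊢
      obtain ⟨y', hy'⟩ := exists_follows_of_lower hg hee (hg'.onEdge (Or.inr rfl))
      rwa [← GoodPair.left_unique (hy'.good_right hg) hg']
    have key : ∀ t, t + j ≤ k → t + j' ≤ k' ∧ g' (k' - t) = g (k - t) := by
      intro t
      induction t with
      | zero =>
        intro ht
        have hb := h.below k (by omega) (by omega)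
        have h₁ := hf.upper_eq hb
        refine ⟨?_, h₁⟩
        rcases ends_on k' (by omega) with h₂ | h₂
        · refine (endsOn_disjoint h₂.2 ?_).elim
          rw [show g' k' = g k from h₁]
          exact hb
        · omega
      | succ t ih =>
        intro ht
        obtain ⟨h₁, h₂⟩ := ih (by omega)
        have hb := h.below (k - t - 1) (by omega) (by omega)
        have h₃ := (next _ _ (by omega) (by omega) (by omega) (by omega) h₂).upper_eq hb
        refine ⟨?_, h₃⟩
        rcases ends_on (k' - t - 1) (by omega) with h₂ | h₂
        · refine (endsOn_disjoint h₂.2 ?_).elim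
          rw [show g' (k' - t - 1) = g (k - t - 1) from h₃]
          exact hb
        · omega
    obtain ⟨h₁, h₂⟩ := key (k - j) (by omega)
    refine ⟨k' - (k - j) - 1, by omega, ?_⟩
    have := next _ _ (by omega) (by omega) (by omega) (by omega) h₂
    rwa [show k - (k - j) = j by omega, ← show k' - (k - j) - 1 + 1 = k' - (k - j) by omega,
      Nat.add_sub_cancel] at this

end Inheritance

end PathInstance

namespace PathInstance

open Strand

/-! ### Counting the adjacencies created by a solution -/

section Adjacencies

variable {α : Type*} [DecidableEq α]

/-- The adjacent pairs of an order. -/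
def adjacencies (w : List α) : Finset (α × α) := (w.zip w.tail).toFinset

theorem mem_adjacencies {a b : α} {w : List α} : (a, b) ∈ adjacencies w ↔ Consecutive a b w := by
  simp [adjacencies, Consecutive]

theorem exists_card_le_three (x y z : Option α) (x' y' z' : Option α) :
    ∃ s : Finset (α × α), s.card ≤ 3 ∧ ∀ a b, (x = some a ∧ x' = some b) ∨
      (y = some a ∧ y' = some b) ∨ (z = some a ∧ z' = some b) → (a, b) ∈ s := by
  have key : ∀ u u' : Option α, ∃ s : Finset (α × α), s.card ≤ 1 ∧
      ∀ a b, u = some a ∧ u' = some b → (a, b) ∈ s := by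
    intro u u'
    rcases u with _ | a
    · exact ⟨∅, by simp, by simp⟩
    · rcases u' with _ | b
      · exact ⟨∅, by simp, by simp⟩
      · exact ⟨{(a, b)}, by simp, by simp⟩
  obtain ⟨s, hs, hs'⟩ := key x x'
  obtain ⟨t, ht, ht'⟩ := key y y'
  obtain ⟨u, hu, hu'⟩ := key z z'
  refine ⟨s ∪ (t ∪ u), ?_, ?_⟩
  · have h₁ := Finset.card_union_le s (t ∪ u)
    have h₂ := Finset.card_union_le t u
    omega
  · intro a b h
    simp only [Finset.mem_union]
    rcases h with h | h | h
    · exact Or.inl (hs' _ _ h)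
    · exact Or.inr (Or.inl (ht' _ _ h))
    · exact Or.inr (Or.inr (hu' _ _ h))

end Adjacencies

section Creations

variable {L : Type*} [DecidableEq L]

/-- The source of the factor 3: new adjacencies arise only at the borders between A and C, C and B,
B and D. The virtual lines extend A and D, so that adjacencies at the extreme positions count as
well. -/
theorem card_new_adjacencies_le {π ρ : List L} (h : BlockMove π ρ) :
    (adjacencies (frame ρ) \ adjacencies (frame π)).card ≤ 3 := by
  obtain ⟨A, B, C, D, hB, hC, rfl, rfl⟩ := h
  obtain ⟨s, hs, hs'⟩ := exists_card_le_three (top :: A.map line).getLast? (C.map line).getLast?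
    (B.map line).getLast? (C.map line).head? (B.map line).head? (D.map line ++ [bottom]).head?
  refine (Finset.card_le_card ?_).trans hs
  rintro ⟨a, b⟩ hab
  rw [Finset.mem_sdiff, mem_adjacencies, mem_adjacencies] at hab
  have e₁ : ∀ X Y : List L, frame (A ++ X ++ Y ++ D) =
      (top :: A.map line) ++ X.map line ++ Y.map line ++ (D.map line ++ [bottom]) := by
    intro X Y; simp [frame]
  rw [e₁, e₁] at hab
  exact hs' a b ((consecutive_of_blocks hab.1 (by simpa using hC) (by simpa using hB)).resolve_left
    hab.2)

/-- The pairs that become adjacent in some step of a sequence of orders. -/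
def newPairs : List (List L) → Finset (Strand L × Strand L)
  | [] => ∅
  | [_] => ∅
  | π :: ρ :: h => (adjacencies (frame ρ) \ adjacencies (frame π)) ∪ newPairs (ρ :: h)

theorem card_newPairs_le : ∀ {h : List (List L)}, h.IsChain BlockMove →
    (newPairs h).card ≤ 3 * (h.length - 1)
  | [], _ => by simp [newPairs]
  | [_], _ => by simp [newPairs]
  | π :: ρ :: h, hc => by
    rw [List.isChain_cons_cons] at hc
    have h₁ := card_newPairs_le hc.2
    have h₂ := card_new_adjacencies_le hc.1
    have h₃ := Finset.card_union_le (adjacencies (frame ρ) \ adjacencies (frame π))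
      (newPairs (ρ :: h))
    simp only [newPairs, List.length_cons] at *
    omega

theorem mem_newPairs : ∀ {h : List (List L)} {π ρ : List L} {a b : Strand L},
    h.head? = some π → h.getLast? = some ρ → ¬ Consecutive a b (frame π) →
    Consecutive a b (frame ρ) → (a, b) ∈ newPairs h
  | [], _, _, _, _, hπ, _, _, _ => by simp at hπ
  | [x], _, _, _, _, hπ, hρ, h₁, h₂ => by
    simp at hπ hρ
    subst hπ hρ
    exact absurd h₂ h₁
  | x :: y :: h, π, ρ, a, b, hπ, hρ, h₁, h₂ => by
    simp at hπ
    subst hπ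
    rw [newPairs, Finset.mem_union]
    by_cases hy : Consecutive a b (frame y)
    · left
      rw [Finset.mem_sdiff, mem_adjacencies, mem_adjacencies]
      exact ⟨hy, h₁⟩
    · right
      exact mem_newPairs rfl (by rwa [List.getLast?_cons_cons] at hρ) hy h₂

variable (I : PathInstance L)

/-- The pairs, with their edges, that become adjacent in some step of a solution. -/
def creations (S : LineOrders L) : Finset (ℕ × Strand L × Strand L) :=
  (Finset.range I.numEdges).biUnion fun e => (newPairs (S e)).image fun q => (e, q)

variable {I}

theorem mem_creations {S : LineOrders L} {p : ℕ × Strand L × Strand L} :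
    p ∈ I.creations S ↔ p.1 < I.numEdges ∧ p.2 ∈ newPairs (S p.1) := by
  obtain ⟨e, q⟩ := p
  simp [creations]

theorem card_creations_le {S : LineOrders L} (hS : I.Feasible S) :
    (I.creations S).card ≤ 3 * I.numBlockCrossings S := by
  unfold creations numBlockCrossings
  rw [Finset.mul_sum]
  refine Finset.card_biUnion_le.trans (Finset.sum_le_sum fun e he => ?_)
  exact Finset.card_image_le.trans (card_newPairs_le (hS.1 e (Finset.mem_range.1 he)).2.2)

end Creations

/-! ### Good pairs in an arbitrary monotone solution -/

section Solutions

variable {L : Type*} {I : PathInstance L}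

/-- Normal form of a solution at a node: one order m of the passing lines governs both incident
edges. -/
theorem Feasible.exists_getLast {S : LineOrders L} (hS : I.Feasible S) {e : ℕ}
    (he : e < I.numEdges) : ∃ m : List L, (S e).getLast? = some (I.endOrder (e + 1) m) ∧
      m.Nodup ∧ (∀ l, l ∈ m ↔ I.PassesNode (e + 1) l) ∧
      (e + 1 < I.numEdges → (S (e + 1)).head? = some (I.startOrder (e + 1) m)) := by
  obtain ⟨h₁, h₂, h₃⟩ := hS.1 e he
  have hlast := List.getLast?_eq_some_getLast h₁
  obtain ⟨h₄, h₅⟩ := h₂ _ (List.getLast_mem h₁)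
  refine ⟨((S e).getLast h₁).filter (fun l => I.OnEdge (e + 1) l), ?_, h₄.filter _, ?_, ?_⟩
  · rw [← hS.2.1 e he _ hlast]; exact hlast
  · intro l
    rw [List.mem_filter, h₅, decide_eq_true_iff]
    unfold OnEdge PassesNode
    omega
  · intro he'
    have hh := List.head?_eq_some_head (hS.1 _ he').1
    rw [← hS.2.2.2 e he' _ hlast _ hh]
    exact hh

theorem Feasible.exists_head {S : LineOrders L} (hS : I.Feasible S) {e : ℕ}
    (he : e < I.numEdges) : ∃ m : List L, (S e).head? = some (I.startOrder e m) ∧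
      m.Nodup ∧ (∀ l, l ∈ m ↔ I.PassesNode e l) := by
  cases e with
  | zero =>
    have hh := List.head?_eq_some_head (hS.1 _ he).1
    refine ⟨[], ?_, List.nodup_nil, fun l => ?_⟩
    · rw [← hS.2.2.1 _ hh he]; exact hh
    · simp [PassesNode]
  | succ e =>
    obtain ⟨m, -, h₁, h₂, h₃⟩ := hS.exists_getLast (Nat.lt_of_succ_lt he)
    exact ⟨m, h₃ he, h₁, h₂⟩

/-- The pair is adjacent at the right end of its edge. -/
def AdjacentAtEnd (S : LineOrders L) (p : ℕ × Strand L × Strand L) : Prop :=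
  ∀ ρ ∈ (S p.1).getLast?, Consecutive p.2.1 p.2.2 (frame ρ)

/-- The pair is adjacent at the left end of its edge. -/
def AdjacentAtStart (S : LineOrders L) (p : ℕ × Strand L × Strand L) : Prop :=
  ∀ ρ ∈ (S p.1).head?, Consecutive p.2.1 p.2.2 (frame ρ)

theorem Feasible.adjacentAtEnd_iff {S : LineOrders L} (hS : I.Feasible S)
    {p q : ℕ × Strand L × Strand L} (h : I.Inherits p q) (hq : q.1 < I.numEdges) :
    AdjacentAtEnd S p ↔ AdjacentAtStart S q := by
  obtain ⟨e, a, b⟩ := p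
  obtain ⟨e₁, a₁, b₁⟩ := q
  obtain ⟨h₁, h₂⟩ := h
  dsimp only at *
  subst h₁
  obtain ⟨m, hl, hm, hm', hh⟩ := hS.exists_getLast (Nat.lt_of_succ_lt hq)
  have hh := hh hq
  simp only [AdjacentAtEnd, AdjacentAtStart, hl, hh, Option.mem_some_iff, forall_eq']
  exact I.consecutive_iff_of_continues hm hm' h₂

variable [DecidableEq L]

/-- If two lines are ever in the wrong order, then they cross; if they are in the right order
again afterwards, then they cross twice. -/
theorem crossing_count {a b : L} {h : List (List L)}
    (hh : ∀ π ∈ h, π.Nodup ∧ a ∈ π ∧ b ∈ π) (hab : a ≠ b) {π ρ : List L} (hπ : h.head? = some π)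
    (hρ : h.getLast? = some ρ) {c : ℕ} {E : Prop} (h₁ : [b, a].Sublist π → 1 ≤ c)
    (h₂ : E → [a, b].Sublist π → 2 ≤ c) :
    ([b, a].Sublist ρ → 1 ≤ c + (h.zip h.tail).countP (fun p => Crosses a b p.1 p.2)) ∧
    ((E ∨ ∃ π ∈ h, [b, a].Sublist π) → [a, b].Sublist ρ →
      2 ≤ c + (h.zip h.tail).countP (fun p => Crosses a b p.1 p.2)) := by
  -- Here c counts the crossings before the sequence and E records an earlier wrong order; both are
  -- generalized so that counts can be chained along steps and edges.
  induction h generalizing c E π with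
  | nil => simp at hπ
  | cons x h ih =>
    obtain rfl : x = π := by simpa using hπ
    obtain ⟨hx, hax, hbx⟩ := hh x (by simp)
    cases h with
    | nil =>
      obtain rfl : x = ρ := by simpa using hρ
      refine ⟨fun h => by simpa using h₁ h, ?_⟩
      rintro (h | ⟨π, h, h'⟩) h''
      · simpa using h₂ h h''
      · obtain rfl : π = x := by simpa using h
        exact (pair_sublist_antisymm hx h' h'').elim
    | cons y h =>
      obtain ⟨hy, hay, hby⟩ := hh y (by simp)
      have hx' := pair_sublist_total hax hbx hab
      have hy' := pair_sublist_total hay hby hab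
      have ih := ih (fun π hπ => hh π (List.mem_cons_of_mem _ hπ)) rfl
        (by rwa [List.getLast?_cons_cons] at hρ)
        (c := c + if Crosses a b x y then 1 else 0) (E := E ∨ [b, a].Sublist x) ?_ ?_
      · simp only [List.tail_cons, List.zip_cons_cons, List.countP_cons, decide_eq_true_eq]
          at ih ⊢
        refine ⟨fun h => ?_, fun h h' => ?_⟩
        · have := ih.1 h; omega
        · have := ih.2 ?_ h'
          · omega
          · rcases h with h | ⟨π, h, h'⟩
            · exact Or.inl (Or.inl h)
            · rcases List.mem_cons.1 h with rfl | h
              · exact Or.inl (Or.inr h')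
              · exact Or.inr ⟨π, h, h'⟩
      · intro h
        rcases hx' with h' | h'
        · rw [if_pos (show Crosses a b x y from Or.inl ⟨h', h⟩)]; omega
        · have := h₁ h'; omega
      · rintro (h | h) h'
        · rcases hx' with h'' | h''
          · have := h₂ h h''; omega
          · rw [if_pos (show Crosses a b x y from Or.inr ⟨h'', h'⟩)]
            have := h₁ h''; omega
        · rw [if_pos (show Crosses a b x y from Or.inr ⟨h, h'⟩)]
          have := h₁ h; omega

/-- Lines that enter and leave in the same order never cross if no two lines cross twice. -/
theorem MonotoneFeasible.never_cross {S : LineOrders L} (hS : I.MonotoneFeasible S) {a b : L}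
    (h : I.EntersAbove a b) (h' : I.LeavesAbove a b) {e : ℕ} (ha : I.OnEdge e a)
    (hb : I.OnEdge e b) {π : List L} (hπ : π ∈ S e) : [a, b].Sublist π := by
  have hne : a ≠ b := by
    rintro rfl; exact I.entersAbove_antisymm h h
  have hedge : ∀ {e}, I.OnEdge e a → e < I.numEdges := fun h => h.2.trans_le (I.last_le a)
  have mem : ∀ {e}, I.OnEdge e a → I.OnEdge e b → ∀ π ∈ S e, π.Nodup ∧ a ∈ π ∧ b ∈ π := by
    intro e ha hb π hπ
    have := (hS.1.1 e (hedge ha)).2.1 π hπ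
    exact ⟨this.1, (this.2 a).2 ha, (this.2 b).2 hb⟩
  by_contra hcon
  have hba : [b, a].Sublist π :=
    (pair_sublist_total (mem ha hb π hπ).2.1 (mem ha hb π hπ).2.2 hne).resolve_left hcon
  set c : ℕ → ℕ := fun e => ((S e).zip (S e).tail).countP (fun p => Crosses a b p.1 p.2)
  -- Starting from the correct order on the first common edge, a wrong order costs one crossing, and
  -- a return from it to the correct order costs a second one.
  have key : ∀ e, max (I.first a) (I.first b) ≤ e → I.OnEdge e a → I.OnEdge e b →
      ∀ ρ, (S e).getLast? = some ρ →
        ([b, a].Sublist ρ → 1 ≤ ∑ e' ∈ Finset.range (e + 1), c e') ∧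
        ((∃ e', e' ≤ e ∧ I.OnEdge e' a ∧ I.OnEdge e' b ∧ ∃ π ∈ S e', [b, a].Sublist π) →
          [a, b].Sublist ρ → 2 ≤ ∑ e' ∈ Finset.range (e + 1), c e') := by
    intro e hle
    induction e, hle using Nat.le_induction with
    | base =>
      intro ha hb ρ hρ
      obtain ⟨m, hh, hm, hm'⟩ := hS.1.exists_head (hedge ha)
      have hstart : [a, b].Sublist (I.startOrder (max (I.first a) (I.first b)) m) := by
        obtain ⟨-, ha', hb'⟩ := mem ha hb _ (List.mem_of_head? hh)
        refine I.sublist_startOrder_of_entersAbove (fun l => (hm' l).1) ha' hb' ?_ h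
        omega
      have hn := (mem ha hb _ (List.mem_of_head? hh)).1
      have := crossing_count (mem ha hb) hne hh hρ (c := 0) (E := False)
        (fun h' => (pair_sublist_antisymm hn hstart h').elim) False.elim
      rw [Finset.sum_range_succ]
      refine ⟨fun h => ?_, ?_⟩
      · have := this.1 h; simp only [c]; omega
      · rintro ⟨e', he', h₁, h₂, π, hπ, hπ'⟩ h
        obtain rfl : e' = max (I.first a) (I.first b) := by
          have := h₁.1; have := h₂.1; omega
        have := this.2 (Or.inr ⟨π, hπ, hπ'⟩) h
        simp only [c]; omega
    | succ e hle ih =>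
      intro ha hb ρ hρ
      have pa : I.PassesNode (e + 1) a := ⟨by omega, ha.2⟩
      have pb : I.PassesNode (e + 1) b := ⟨by omega, hb.2⟩
      obtain ⟨m, hl, hm, hm', hh⟩ := hS.1.exists_getLast (e := e) (by have := hedge ha; omega)
      have hh := hh (hedge ha)
      have ih := ih (onEdge_of_passesNode pa).1 (onEdge_of_passesNode pb).1 _ hl
      have hend : ∀ {x y}, I.PassesNode (e + 1) x → I.PassesNode (e + 1) y →
          [x, y].Sublist (I.startOrder (e + 1) m) → [x, y].Sublist (I.endOrder (e + 1) m) := by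
        intro x y hx hy h
        have hx₁ : ∀ s, x ∉ I.starts s (e + 1) := fun s h =>
          hx.1.ne (I.first_of_mem_starts h)
        have hy₁ : ∀ s, y ∉ I.starts s (e + 1) := fun s h =>
          hy.1.ne (I.first_of_mem_starts h)
        rw [startOrder, List.append_assoc, pair_sublist_append, pair_sublist_append] at h
        rw [endOrder, List.append_assoc, pair_sublist_append, pair_sublist_append]
        rcases h with h | (h | h | h) | h
        · exact absurd (pair_sublist_mem_left h) (hx₁ _)
        · exact Or.inr (Or.inl (Or.inl h))
        · exact absurd (List.mem_reverse.1 (pair_sublist_mem_left h)) (hx₁ _)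
        · exact absurd (List.mem_reverse.1 h.2) (hy₁ _)
        · exact absurd h.1 (hx₁ _)
      have := crossing_count (mem ha hb) hne hh hρ (c := ∑ e' ∈ Finset.range (e + 1), c e')
        (E := ∃ e', e' ≤ e ∧ I.OnEdge e' a ∧ I.OnEdge e' b ∧ ∃ π ∈ S e', [b, a].Sublist π)
        (fun h => ih.1 (hend pb pa h)) (fun h' h => ih.2 h' (hend pa pb h))
      rw [Finset.sum_range_succ]
      refine ⟨this.1, ?_⟩
      rintro ⟨e', he', h₁, h₂, π, hπ, hπ'⟩ h
      refine this.2 ?_ h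
      rcases Nat.lt_or_ge e e' with hlt | hge
      · obtain rfl : e' = e + 1 := by omega
        exact Or.inr ⟨π, hπ, hπ'⟩
      · exact Or.inl ⟨e', hge, h₁, h₂, π, hπ, hπ'⟩
  -- On the last common edge g the leaving order forces the correct order at the end, so a wrong
  -- order before would mean two crossings.
  obtain ⟨g, hg⟩ : ∃ g, g + 1 = min (I.last a) (I.last b) :=
    ⟨min (I.last a) (I.last b) - 1, by have := ha.2; have := hb.2; omega⟩
  have h₁ := ha.1
  have h₂ := hb.1
  have h₃ := ha.2
  have h₄ := hb.2
  have hga : I.OnEdge g a := ⟨by omega, by omega⟩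
  have hgb : I.OnEdge g b := ⟨by omega, by omega⟩
  obtain ⟨m, hl, hm, hm', -⟩ := hS.1.exists_getLast (hedge hga)
  have hend : [a, b].Sublist (I.endOrder (g + 1) m) := by
    obtain ⟨-, ha', hb'⟩ := mem hga hgb _ (List.mem_of_getLast? hl)
    refine I.sublist_endOrder_of_leavesAbove (fun l => (hm' l).1) ha' hb' ?_ h'
    omega
  have h₅ := (key g (by omega) hga hgb _ hl).2
    ⟨e, by omega, ha, hb, π, hπ, hba⟩ hend
  have h₆ := hS.2 a b hne
  have h₇ : ∑ e' ∈ Finset.range (g + 1), c e' ≤ I.numCrossings S a b :=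
    Finset.sum_le_sum_of_subset (Finset.range_subset_range.2 (hedge hga))
  omega

/-- A pair that is adjacent at the right end of an edge but not at its left end is created
there. -/
theorem Feasible.mem_creations {S : LineOrders L} (hS : I.Feasible S)
    {p : ℕ × Strand L × Strand L} (hp : p.1 < I.numEdges) (h : AdjacentAtEnd S p)
    (h' : ¬ AdjacentAtStart S p) : p ∈ I.creations S := by
  obtain ⟨m, hl, -⟩ := hS.exists_getLast hp
  unfold AdjacentAtStart at h'
  push Not at h'
  obtain ⟨π, hπ, hπ'⟩ := h'
  exact PathInstance.mem_creations.2 ⟨hp, mem_newPairs hπ hl hπ' (h _ hl)⟩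

/-- A good pair that is not adjacent at the end of an edge is created later. -/
theorem Feasible.exists_creation {S : LineOrders L} (hS : I.Feasible S) {e : ℕ} {a b : Strand L}
    (h : I.GoodPair e a b) (h' : ¬ AdjacentAtEnd S (e, a, b)) :
    ∃ t ∈ I.creations S, I.Follows (e, a, b) t := by
  induction h with
  | @ending e a b he hc =>
    refine absurd ?_ h'
    obtain ⟨m, hl, hm, hm', -⟩ := hS.exists_getLast he
    simp only [AdjacentAtEnd, hl, Option.mem_some_iff, forall_eq']
    exact I.consecutive_of_consecutiveEnds (fun l => (hm' l).1) hc
  | @continuing e a b a₁ b₁ he hc hg ih =>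
    have hi : I.Inherits (e, a, b) (e + 1, a₁, b₁) := ⟨rfl, hc⟩
    by_cases h : AdjacentAtEnd S (e + 1, a₁, b₁)
    · rw [hS.adjacentAtEnd_iff hi he] at h'
      exact ⟨_, hS.mem_creations he h h', .single hi⟩
    · obtain ⟨t, ht, hf⟩ := ih h
      exact ⟨t, ht, .head hi hf⟩

/-- A good pair that is never created is adjacent all the time. -/
theorem Feasible.adjacent_of_not_created {S : LineOrders L} (hS : I.Feasible S)
    {d p : ℕ × Strand L × Strand L} (hd : d.1 < I.numEdges)
    (hc : I.ConsecutiveEnds (d.1 + 1) d.2.1 d.2.2)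
    (hcr : ∀ t ∈ I.creations S, ¬ I.Follows t d) (hf : I.Follows p d) :
    AdjacentAtEnd S p ∧ AdjacentAtStart S p := by
  have key : ∀ p, I.Follows p d → AdjacentAtEnd S p → AdjacentAtEnd S p ∧ AdjacentAtStart S p := by
    intro p hf h
    refine ⟨h, ?_⟩
    by_contra h'
    exact hcr p (hS.mem_creations (hf.le.trans_lt hd) h h') hf
  induction hf using Relation.ReflTransGen.head_induction_on with
  | refl =>
    refine key _ .refl ?_
    obtain ⟨m, hl, hm, hm', -⟩ := hS.exists_getLast hd
    simp only [AdjacentAtEnd, hl, Option.mem_some_iff, forall_eq']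
    exact I.consecutive_of_consecutiveEnds (fun l => (hm' l).1) hc
  | @head p q hpq hf ih =>
    exact key p (.head hpq hf)
      ((hS.adjacentAtEnd_iff hpq ((Follows.le hf).trans_lt hd)).2 ih.2)

/-- Where a good pair that is adjacent in some solution comes into existence, it is adjacent in
every solution. -/
theorem MonotoneFeasible.consecutive_of_initial {S : LineOrders L} (hS : I.MonotoneFeasible S)
    {e : ℕ} {a b : Strand L} (he : e < I.numEdges)
    (hinit : ∀ p, ¬ I.Inherits p (e, a, b)) (h : AdjacentAtStart S (e, a, b))
    {m' : List L} (hm' : ∀ l, l ∈ m' ↔ I.PassesNode e l) :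
    Consecutive a b (frame (I.startOrder e m')) := by
  obtain ⟨m, hh, hm, hmem⟩ := hS.1.exists_head he
  simp only [AdjacentAtStart, hh, Option.mem_some_iff, forall_eq'] at h
  have h₀ := h
  have hn := nodup_frame.2 (I.nodup_startOrder hm (fun l => (hmem l).1))
  have hnil : m.map line = [] → m'.map line = ([] : List (Strand L)) := by
    intro h₁
    rw [List.map_eq_nil_iff] at h₁ ⊢
    rw [List.eq_nil_iff_forall_not_mem] at h₁ ⊢
    intro l hl
    exact h₁ l ((hmem l).2 ((hm' l).1 hl))
  have inherits : ∀ {x}, I.PassesNode e x → ∀ {c d}, ¬ I.Continues e c d a b := by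
    intro x hx c d hc
    cases e with
    | zero => exact absurd hx.1 (by omega)
    | succ e => exact hinit (e, c, d) ⟨rfl, hc⟩
  have mem_starts : ∀ {x}, I.PassesNode e x → ∀ π ∈ S e, x ∈ π := fun {x} hx π hπ =>
    (((hS.1.1 e he).2.1 π hπ).2 x).2 ⟨hx.1.le, hx.2⟩
  have hπ := List.mem_of_head? hh
  have onEdge : ∀ {x}, I.PassesNode e x → I.OnEdge e x := fun hx => ⟨hx.1.le, hx.2⟩
  unfold startOrder at h h₀ hn ⊢
  rw [frame_blocks] at h h₀ hn ⊢
  rw [consecutive_append, consecutive_append] at h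
  rcases h with (h | h | ⟨h, h'⟩) | h | ⟨h, h'⟩
  · rw [consecutive_append, consecutive_append]; exact Or.inl (Or.inl h)
  · obtain ⟨x, hx, rfl⟩ := List.mem_map.1 h.mem_left
    obtain ⟨y, hy, rfl⟩ := List.mem_map.1 h.mem_right
    rw [hmem] at hx hy
    -- Two passing lines would already form the pair on the preceding edge.
    exact absurd (Or.inl ⟨x, y, hx, hy, rfl, rfl, rfl, rfl⟩) (inherits hx)
  · obtain ⟨y, hy, rfl⟩ := List.mem_map.1 (List.mem_of_head? h')
    rw [hmem] at hy
    have ha : a = I.innermostStart .above e := by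
      have := I.innermostStart_getLast .above e
      change (top :: (I.starts .above e).map line).getLast? = _ at this
      rw [h] at this
      exact Option.some_injective _ this
    -- An inheritance-preventing line c never crosses y in S and would thus lie between the two
    -- strands. Without such a line the pair would be inherited from the left.
    by_cases hp : I.InheritancePrevented .above e y
    · obtain ⟨c, hc, h₁, h₂⟩ := hp
      have h₃ := pair_sublist_frame.2 (hS.never_cross h₁ h₂ (onEdge hc) (onEdge hy) hπ)
      have h₄ : line c ∈ m.map line := List.mem_map_of_mem ((hmem c).2 hc)
      unfold startOrder at h₃
      rw [frame_blocks] at h₃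
      rcases h₀.before_right hn h₃ with h₅ | h₅
      · exact absurd (ha.symm.trans h₅.symm) (I.innermostStart_ne_line hc)
      · refine (pair_sublist_antisymm hn h₅ ?_).elim
        rw [List.append_assoc, pair_sublist_append]
        exact Or.inr (Or.inr ⟨List.mem_of_getLast? h, List.mem_append_left _ h₄⟩)
    · exact absurd (Or.inr (Or.inl ⟨y, hy, hp, rfl, rfl, ha, rfl⟩)) (inherits hy)
  · rw [consecutive_append]; exact Or.inr (Or.inl h)
  -- If no line passes the node, the strands starting above meet those starting below in every
  -- solution; otherwise the argument is the mirror image of the border above.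
  · rcases List.eq_nil_or_concat (m.map line) with hM | ⟨M, z, hM⟩
    · rw [hM, List.append_nil] at h
      rw [hnil hM, List.append_nil, consecutive_append]
      exact Or.inr (Or.inr ⟨h, h'⟩)
    · have hz : (m.map line).getLast? = some a := by
        rwa [List.getLast?_append_of_ne_nil _ (by simp [hM])] at h
      obtain ⟨x, hx, rfl⟩ := List.mem_map.1 (List.mem_of_getLast? hz)
      rw [hmem] at hx
      have hb : b = I.innermostStart .below e := by
        have := I.innermostStart_getLast .below e
        change (bottom :: (I.starts .below e).map line).getLast? = _ at this
        rw [List.head?_reverse, this] at h'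
        exact (Option.some_injective _ h').symm
      by_cases hp : I.InheritancePrevented .below e x
      · obtain ⟨c, hc, h₁, h₂⟩ := hp
        have h₃ := pair_sublist_frame.2 (hS.never_cross h₁ h₂ (onEdge hx) (onEdge hc) hπ)
        have h₄ : line c ∈ m.map line := List.mem_map_of_mem ((hmem c).2 hc)
        unfold startOrder at h₃
        rw [frame_blocks] at h₃
        rcases h₀.behind_left hn h₃ with h₅ | h₅
        · exact absurd (hb.symm.trans h₅.symm) (I.innermostStart_ne_line hc)
        · refine (pair_sublist_antisymm hn h₅ ?_).elim
          rw [pair_sublist_append]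
          exact Or.inr (Or.inr ⟨List.mem_append_right _ h₄, List.mem_of_head? h'⟩)
      · exact absurd (Or.inr (Or.inr ⟨x, hx, hp, rfl, rfl, rfl, hb⟩)) (inherits hx)

end Solutions

end PathInstance

/-! ### Maximal linked sequences -/

section LinkedPrefix

open PathInstance

variable {α : Type*} (R : α → α → Prop) [DecidableRel R]

theorem linkedPrefix_length_le : ∀ w : List α, (linkedPrefix R w).length ≤ w.length
  | [] => le_rfl
  | [_] => le_rfl
  | x :: y :: w => by
    have := linkedPrefix_length_le (y :: w)
    rw [linkedPrefix]
    split_ifs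
    · simpa using this
    · simp

theorem linkedPrefix_length_pos : ∀ {w : List α}, w ≠ [] → 0 < (linkedPrefix R w).length
  | [_], _ => Nat.one_pos
  | x :: y :: w, _ => by
    rw [linkedPrefix]
    split_ifs <;> simp

theorem linkedPrefix_getElem? : ∀ (w : List α) (k : ℕ), k < (linkedPrefix R w).length →
    (linkedPrefix R w)[k]? = w[k]?
  | [], _, h => by simp [linkedPrefix] at h
  | [_], _, _ => rfl
  | x :: y :: w, k, h => by
    have ih := linkedPrefix_getElem? (y :: w)
    rw [linkedPrefix] at h ⊢
    split_ifs with hR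
    · rw [if_pos hR] at h
      cases k with
      | zero => rfl
      | succ k => simpa using ih k (by simpa using h)
    · rw [if_neg hR] at h
      obtain rfl : k = 0 := by simpa using h
      rfl

theorem linkedPrefix_rel : ∀ (w : List α) (k : ℕ), k + 1 < (linkedPrefix R w).length →
    ∀ x ∈ w[k]?, ∀ y ∈ w[k + 1]?, R x y
  | [], _, h => by simp [linkedPrefix] at h
  | [_], _, h => by simp [linkedPrefix] at h
  | x :: y :: w, k, h => by
    have ih := linkedPrefix_rel (y :: w)
    rw [linkedPrefix] at h
    split_ifs at h with hR
    · cases k with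
      | zero => simpa using hR
      | succ k => simpa using ih k (by simpa using h)
    · simp at h

/-- Maximality of the sequence: when all of it is moved, the pair separated behind it is not good.
-/
theorem not_rel_linkedPrefix : ∀ (w : List α) (k : ℕ), k + 1 = (linkedPrefix R w).length →
    ∀ x ∈ w[k]?, ∀ y ∈ w[k + 1]?, ¬ R x y
  | [], _, h => by simp [linkedPrefix] at h
  | [_], k, h => by simp
  | x :: y :: w, k, h => by
    have ih := not_rel_linkedPrefix (y :: w)
    rw [linkedPrefix] at h
    split_ifs at h with hR
    · cases k with
      | zero =>
        have := linkedPrefix_length_pos R (List.cons_ne_nil y w)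
        rw [List.length_cons] at h
        omega
      | succ k => simpa using ih k (by simpa using h)
    · obtain rfl : k = 0 := by simpa using h
      simpa using hR

theorem exists_consecutive_cons {x y : α} {w : List α} (hy : y ∈ w) :
    ∃ z, Consecutive z y (x :: w) := by
  induction w generalizing x with
  | nil => simp at hy
  | cons a w ih =>
    rcases List.mem_cons.1 hy with rfl | hy
    · exact ⟨x, consecutive_cons.2 (Or.inl ⟨rfl, rfl⟩)⟩
    · obtain ⟨z, hz⟩ := ih (x := a) hy
      exact ⟨z, consecutive_cons.2 (Or.inr hz)⟩

end LinkedPrefix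

namespace PathInstance

open Strand

/-! ### Uniform treatment of the two sides -/

section Sided

variable {L : Type*} {I : PathInstance L}

theorem consecutive_orient {α : Type*} {s : Side} {x y : α} {w : List α} :
    Consecutive x y (orient s w) ↔ Consecutive (orientPair s x y).1 (orientPair s x y).2 w := by
  cases s
  · rfl
  · exact consecutive_reverse

theorem orient_orient {α : Type*} (s : Side) (w : List α) : orient s (orient s w) = w := by
  cases s
  · rfl
  · exact List.reverse_reverse w

theorem mem_orient {α : Type*} {s : Side} {x : α} {w : List α} : x ∈ orient s w ↔ x ∈ w := by
  cases s
  · rfl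
  · exact List.mem_reverse

theorem nodup_orient {α : Type*} {s : Side} {w : List α} : (orient s w).Nodup ↔ w.Nodup := by
  cases s
  · rfl
  · exact List.nodup_reverse

variable (I) in
/-- A good pair, seen from the side `s`. -/
def SidedGood (s : Side) (e : ℕ) (x y : Strand L) : Prop :=
  I.GoodPair e (orientPair s x y).1 (orientPair s x y).2

theorem SidedGood.left_unique {s : Side} {e : ℕ} {x x' y : Strand L} (h : I.SidedGood s e x y)
    (h' : I.SidedGood s e x' y) : x = x' := by
  cases s
  · exact GoodPair.left_unique h h'
  · exact GoodPair.right_unique h h'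

theorem SidedGood.right_unique {s : Side} {e : ℕ} {x y y' : Strand L} (h : I.SidedGood s e x y)
    (h' : I.SidedGood s e x y') : y = y' := by
  cases s
  · exact GoodPair.right_unique h h'
  · exact GoodPair.left_unique h h'

theorem sidedGood_of_consecutive {s : Side} {e : ℕ} (he : e < I.numEdges) {x y : Strand L}
    (h : Consecutive x y (outer s :: (I.ends s (e + 1)).map line)) : I.SidedGood s e x y := by
  cases s
  · exact .ending he (Or.inl h)
  · refine .ending he (Or.inr (Or.inl ?_))
    rw [← consecutive_reverse, List.reverse_cons, ← List.map_reverse] at h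
    exact h

theorem consecutiveEnds_of_consecutive {s : Side} {v : ℕ} {x y : Strand L}
    (h : Consecutive x y (outer s :: (I.ends s v).map line)) :
    I.ConsecutiveEnds v (orientPair s x y).1 (orientPair s x y).2 := by
  cases s
  · exact Or.inl h
  · refine Or.inr (Or.inl ?_)
    rw [← consecutive_reverse, List.reverse_cons, ← List.map_reverse] at h
    exact h

theorem mustNotCross_total {s : Side} {x y : Strand L} (h : x ≠ y) :
    I.MustNotCross s x y ∨ I.MustNotCross s y x := by
  cases s
  · exact I.strandLeavesAbove_total h
  · exact I.strandLeavesAbove_total h.symm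

/-- A line that leaves outside of y cannot end after y; since it lies on `e` and y ends at `e + 1`,
it ends there too, on the same side. -/
theorem sublist_ends_of_mustNotCross {s : Side} {e : ℕ} {l y : L} (hl : I.OnEdge e l)
    (hy : y ∈ I.ends s (e + 1)) (h : I.MustNotCross s (line l) (line y)) :
    [l, y].Sublist (I.ends s (e + 1)) := by
  have h₁ := I.last_of_mem_ends hy
  have h₂ := hl.2
  cases s
  · rcases h with ⟨h, h'⟩ | ⟨h, h'⟩ | ⟨h, h'⟩
    · omega
    · exact (I.ends_disjoint hy h').elim
    · rw [h, h₁, endOrder, List.append_nil, pair_sublist_append] at h'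
      rcases h' with h' | h' | h'
      · exact h'
      · exact (I.ends_disjoint hy (List.mem_reverse.1 (pair_sublist_mem_right h'))).elim
      · exact (I.ends_disjoint hy (List.mem_reverse.1 h'.2)).elim
  · rcases h with ⟨h, h'⟩ | ⟨h, h'⟩ | ⟨h, h'⟩
    · exact (I.ends_disjoint h' hy).elim
    · omega
    · rw [h₁, endOrder, List.append_nil, pair_sublist_append] at h'
      rcases h' with h' | h' | h'
      · exact (I.ends_disjoint (pair_sublist_mem_left h') hy).elim
      · exact pair_sublist_reverse.1 h'
      · exact (I.ends_disjoint h'.1 hy).elim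

theorem mustNotCross_of_sublist_ends {s : Side} {v : ℕ} {l y : L}
    (h : [l, y].Sublist (I.ends s v)) : I.MustNotCross s (line l) (line y) := by
  have h₁ := I.last_of_mem_ends (pair_sublist_mem_left h)
  have h₂ := I.last_of_mem_ends (pair_sublist_mem_right h)
  cases s
  · refine Or.inr (Or.inr ⟨h₁.trans h₂.symm, ?_⟩)
    rw [h₁]
    exact h.trans (by simp [endOrder])
  · refine Or.inr (Or.inr ⟨h₂.trans h₁.symm, ?_⟩)
    rw [h₂]
    exact (pair_sublist_reverse.2 h).trans (by simp [endOrder])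

theorem mustNotCross_outer_other (s : Side) (x : Strand L) :
    I.MustNotCross s x (outer (otherSide s)) := by
  cases s
  · cases x <;> trivial
  · trivial

/-- A line that ends on the other side must not be crossed by a line going on. -/
theorem mustNotCross_of_mem_other {s : Side} {e : ℕ} {l y : L} (hl : I.OnEdge e l)
    (hl' : l ∉ I.ends (otherSide s) (e + 1)) (hy : y ∈ I.ends (otherSide s) (e + 1)) :
    I.MustNotCross s (line l) (line y) := by
  refine (mustNotCross_total ?_).resolve_right fun h => ?_
  · intro h
    cases h
    exact hl' hy
  · refine hl' (pair_sublist_mem_left (sublist_ends_of_mustNotCross hl hy ?_))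
    cases s <;> exact h

theorem endsOn_of_endsAt {s : Side} {v : ℕ} {x : Strand L} (h : I.EndsAt s v x) :
    I.EndsOn s x := by
  cases x with
  | line l => exact endsOn_line_of_mem_ends h
  | _ => cases h

theorem endsOn_of_not_endsOn_other {s : Side} {x : Strand L} (h : ¬ I.EndsOn (otherSide s) x) :
    I.EndsOn s x := by
  cases s
  · exact (endsOn_or x).resolve_right h
  · exact (endsOn_or x).resolve_left h

theorem SidedGood.endsOn_other {s : Side} {e : ℕ} {x y : Strand L} (h : I.SidedGood s e x y)
    (hx : I.EndsOn (otherSide s) x) : I.EndsOn (otherSide s) y := by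
  cases s
  · exact GoodPair.endsOn_below h hx
  · exact GoodPair.endsOn_above h hx

end Sided

/-! ### The position of the break -/

section MoveLength

variable {L : Type*} {I : PathInstance L} [DecidableEq L]

/-- A break at n separates positions `n - 1` and `n`. By `hpi` the first p strands are unobstructed,
whence `p ≤ i` and there are candidates. The alternative `n = i` covers the default value;
`BreaksInitial.exists_before` later shows that `f i` ends on the other side in that case too. -/
theorem moveLength_spec {sel : ℕ → Side → List ℕ → ℕ}
    (hsel : ∀ (e : ℕ) (s : Side) (J : List ℕ), J ≠ [] → sel e s J ∈ J) (s : Side) (e : ℕ)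
    (created : Finset (Strand L × Strand L)) (crossed chain : List (Strand L)) (p : ℕ)
    (hp : p = (chain.takeWhile (fun x => I.EndsAt s (e + 1) x)).length)
    (hpi : ∀ k < p, ∀ x ∈ chain[k]?, ¬ ∃ l ∈ crossed, I.MustNotCross s l x) (n : ℕ)
    (hn : n = I.moveLength sel s e created crossed chain) :
    (n = chain.length ∧ ∀ x ∈ chain, ¬ ∃ l ∈ crossed, I.MustNotCross s l x) ∨
    ∃ i, i < chain.length ∧ (∃ x ∈ chain[i]?, ∃ l ∈ crossed, I.MustNotCross s l x) ∧
      (∀ k < i, ∀ x ∈ chain[k]?, ¬ ∃ l ∈ crossed, I.MustNotCross s l x) ∧ p ≤ n ∧ n ≤ i ∧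
      ((∃ x ∈ chain[n - 1]?, ∃ y ∈ chain[n]?, orientPair s x y ∈ created) ∨
        ((∀ j, p ≤ j → j ≤ i →
            ¬ ∃ x ∈ chain[j - 1]?, ∃ y ∈ chain[j]?, orientPair s x y ∈ created) ∧
          (∀ j, p ≤ j → j < n → ¬ ∃ y ∈ chain[j]?, I.EndsOn (otherSide s) y) ∧
          ((∃ y ∈ chain[n]?, I.EndsOn (otherSide s) y) ∨ n = i))) := by
  rw [moveLength] at hn
  rcases hfind : chain.findIdx? (fun x => ∃ l ∈ crossed, I.MustNotCross s l x) with _ | i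
  · left
    rw [hfind] at hn
    refine ⟨hn, fun x hx => ?_⟩
    have := List.findIdx?_eq_none_iff.1 hfind x hx
    simpa using this
  · right
    rw [hfind] at hn
    obtain ⟨hi, h₁, h₂⟩ := List.findIdx?_eq_some_iff_getElem.1 hfind
    have h₁ := of_decide_eq_true h₁
    have hlt : ∀ k < i, ∀ x ∈ chain[k]?, ¬ ∃ l ∈ crossed, I.MustNotCross s l x := by
      intro k hk x hx
      have := h₂ k hk
      rw [List.getElem?_eq_getElem (hk.trans hi), Option.mem_some_iff] at hx
      rw [← hx]
      simpa using this
    have hpi : p ≤ i := by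
      by_contra hcon
      exact hpi i (by omega) _ (List.getElem?_eq_getElem hi) h₁
    dsimp only at hn
    rw [← hp] at hn
    have hcand : ∀ j, j ∈ (List.range (i + 1)).filter (fun j => p ≤ j) ↔ p ≤ j ∧ j ≤ i := by
      intro j
      rw [List.mem_filter, List.mem_range, decide_eq_true_iff]
      omega
    -- Sortedness turns the first hit of `find?` into the least one.
    have hsort : ((List.range (i + 1)).filter (fun j => p ≤ j)).Pairwise (· < ·) :=
      List.Pairwise.filter _ List.pairwise_lt_range
    generalize hC : (List.range (i + 1)).filter (fun j => p ≤ j) = C at hn hcand hsort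
    refine ⟨i, hi, ⟨_, List.getElem?_eq_getElem hi, h₁⟩, hlt, ?_⟩
    split_ifs at hn with hne
    · have := hsel e s _ hne
      rw [← hn, List.mem_filter, hcand, decide_eq_true_iff] at this
      exact ⟨this.1.1, this.1.2, Or.inl this.2⟩
    · rw [not_not, List.filter_eq_nil_iff] at hne
      have hne' : ∀ j, p ≤ j → j ≤ i →
          ¬ ∃ x ∈ chain[j - 1]?, ∃ y ∈ chain[j]?, orientPair s x y ∈ created := by
        intro j h₁ h₂ h
        exact hne j ((hcand j).2 ⟨h₁, h₂⟩) (decide_eq_true h)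
      rcases hf : C.find? (fun j => ∃ y ∈ chain[j]?, I.EndsOn (otherSide s) y) with _ | j
      · rw [hf, Option.getD_none] at hn
        subst hn
        refine ⟨hpi, le_rfl, Or.inr ⟨hne', ?_, Or.inr rfl⟩⟩
        intro j h₁ h₂ h
        exact List.find?_eq_none.1 hf j ((hcand j).2 ⟨h₁, h₂.le⟩) (decide_eq_true h)
      · rw [hf, Option.getD_some] at hn
        subst hn
        obtain ⟨hj, as, bs, has, hall⟩ := List.find?_eq_some_iff_append.1 hf
        have hjC := (hcand n).1 (by rw [has]; simp)
        refine ⟨hjC.1, hjC.2, Or.inr ⟨hne', ?_, Or.inl (of_decide_eq_true hj)⟩⟩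
        intro j h₁ h₂ h
        have hjm := (hcand j).2 ⟨h₁, by omega⟩
        rw [has] at hjm hsort
        rw [List.pairwise_append, List.pairwise_cons] at hsort
        rcases List.mem_append.1 hjm with hjm | hjm
        · have := hall j hjm
          rw [decide_eq_true h] at this
          cases this
        · rcases List.mem_cons.1 hjm with rfl | hjm
          · omega
          · have := hsort.2.1.1 j hjm
            omega

end MoveLength

end PathInstance

namespace PathInstance

open Strand

/-! ### One block crossing of the algorithm -/

section Placement

variable {L : Type*} (I : PathInstance L)

/-- The order on the edge `e`, read from the side `s`, consists of the lines `X`, which have been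
brought to the side `s`, of `m`, and of the lines `Y`, which have been brought to the other side. -/
structure Layout (s : Side) (e : ℕ) (order : List (Strand L)) (X m Y : List L) : Prop where
  eq : orient s order =
    (outer s :: X.map line) ++ m.map line ++ (outer (otherSide s) :: Y.map line).reverse
  nodup : (X ++ m ++ Y).Nodup
  mem : ∀ l, l ∈ X ++ m ++ Y ↔ I.OnEdge e l

variable {I}

theorem Layout.order_eq {s : Side} {e : ℕ} {order : List (Strand L)} {X m Y : List L}
    (h : I.Layout s e order X m Y) : order = frame (orient s (X ++ m ++ Y.reverse)) := by
  rw [← orient_orient s order, h.eq]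
  cases s <;> simp [orient, frame, outer, otherSide]

theorem Layout.nodup_orient {s : Side} {e : ℕ} {order : List (Strand L)} {X m Y : List L}
    (h : I.Layout s e order X m Y) : (orient s order).Nodup := by
  rw [PathInstance.nodup_orient, h.order_eq, nodup_frame, PathInstance.nodup_orient]
  refine (List.Perm.nodup_iff ?_).1 h.nodup
  exact (List.reverse_perm Y).symm.append_left _

theorem Layout.nodup_unframe {s : Side} {e : ℕ} {order : List (Strand L)} {X m Y : List L}
    (h : I.Layout s e order X m Y) : (unframe order).Nodup := by
  have := h.nodup_orient
  rw [PathInstance.nodup_orient, h.order_eq, nodup_frame] at this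
  rwa [h.order_eq, unframe_frame]

theorem Layout.mem_unframe {s : Side} {e : ℕ} {order : List (Strand L)} {X m Y : List L}
    (h : I.Layout s e order X m Y) {l : L} : l ∈ unframe order ↔ I.OnEdge e l := by
  rw [← h.mem, h.order_eq, unframe_frame, mem_orient]
  simp

theorem Layout.frame_unframe {s : Side} {e : ℕ} {order : List (Strand L)} {X m Y : List L}
    (h : I.Layout s e order X m Y) : frame (unframe order) = order := by
  rw [h.order_eq, unframe_frame]

theorem idxOf_last {α : Type*} [DecidableEq α] {P Q : List α} {a : α} (hn : (P ++ Q).Nodup)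
    (h : P.getLast? = some a) : (P ++ Q).idxOf a + 1 = P.length := by
  obtain ⟨P', rfl⟩ := List.getLast?_eq_some_iff.1 h
  have : a ∉ P' := fun h => by
    have := (List.nodup_append.1 (List.nodup_append.1 hn).1).2.2 a h a (by simp)
    exact this rfl
  rw [List.append_assoc, List.idxOf_append_of_notMem this]
  simp

/-- The lines that are moved together with `r` because they end directly inside of `r` may pass
the lines that `r` has to pass. -/
theorem not_mustNotCross_of_endsAt {s : Side} {e : ℕ} (he : e < I.numEdges)
    {X c rs : List L} {r : L} (hX : X ++ r :: rs = I.ends s (e + 1)) (hcX : ∀ l ∈ c, l ∉ X)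
    (hce : ∀ l ∈ c, I.OnEdge e l) {f : ℕ → Strand L} (h₀ : f 0 = line r)
    (hcf : ∀ k, ∀ l ∈ c, f k ≠ line l) {p : ℕ}
    (hgood : ∀ k, k + 1 < p → I.SidedGood s e (f k) (f (k + 1)))
    (hends : ∀ k < p, I.EndsAt s (e + 1) (f k)) :
    ∀ k < p, ∀ l ∈ c, ¬ I.MustNotCross s (line l) (f k) := by
  have hn := I.nodup_ends s (e + 1)
  intro k
  induction k with
  | zero =>
    intro hk l hl h
    rw [h₀] at h
    have hr : r ∈ I.ends s (e + 1) := by rw [← hX]; simp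
    have h₁ := sublist_ends_of_mustNotCross (hce l hl) hr h
    have h₂ : l ∈ I.ends s (e + 1) := pair_sublist_mem_left h₁
    rw [← hX] at hn h₁ h₂
    rcases List.mem_append.1 h₂ with h₂ | h₂
    · exact hcX l hl h₂
    · rcases List.mem_cons.1 h₂ with rfl | h₂
      · exact hcf 0 l hl h₀
      · refine pair_sublist_antisymm hn h₁ ?_
        rw [pair_sublist_append, pair_sublist_cons]
        simp [h₂]
  | succ k ih =>
    intro hk l hl h
    have hy := hends (k + 1) hk
    have hg := hgood k hk
    have hfk := hends k (by omega)
    obtain ⟨y, hy'⟩ : ∃ y, f (k + 1) = line y := by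
      cases hf : f (k + 1) with
      | line y => exact ⟨y, rfl⟩
      | top => rw [hf] at hy; exact hy.elim
      | bottom => rw [hf] at hy; exact hy.elim
    obtain ⟨x, hx'⟩ : ∃ y, f k = line y := by
      cases hf : f k with
      | line y => exact ⟨y, rfl⟩
      | top => rw [hf] at hfk; exact hfk.elim
      | bottom => rw [hf] at hfk; exact hfk.elim
    rw [hy'] at h hy hg
    replace hy : y ∈ I.ends s (e + 1) := hy
    have hn' : (outer s :: (I.ends s (e + 1)).map line).Nodup := by
      refine List.nodup_cons.2 ⟨?_, (List.nodup_map_iff line_injective).2 hn⟩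
      cases s <;> simp [outer]
    obtain ⟨z, hz⟩ := exists_consecutive_cons (x := outer s) (List.mem_map_of_mem (f := line) hy)
    -- By uniqueness `f k` is the predecessor of y in the list of ends. A line that has to stay
    -- outside of y therefore has to stay outside of `f k`, and so on back to r, outside of which
    -- only X ends.
    obtain rfl := (sidedGood_of_consecutive he hz).left_unique hg
    have h₁ := sublist_ends_of_mustNotCross (hce l hl) hy h
    have h₂ : [line l, line y].Sublist (outer s :: (I.ends s (e + 1)).map line) :=
      ((pair_sublist_map line_injective).2 h₁).trans (List.sublist_cons_self _ _)
    rcases hz.before_right hn' h₂ with h₃ | h₃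
    · exact hcf k l hl h₃.symm
    · refine ih (by omega) l hl ?_
      rw [hx'] at h₃ ⊢
      rw [pair_sublist_cons, pair_sublist_map line_injective] at h₃
      rcases h₃ with h₃ | h₃
      · exact mustNotCross_of_sublist_ends h₃
      · cases s <;> cases h₃.1

/-- What is known when the algorithm breaks a pair `(f (n - 1), f n)` that was not created by a
block crossing: `f` is the sequence of strands linked by good pairs, seen from the side `s`, and
`c` are the lines that are passed. -/
structure BreaksInitial (I : PathInstance L) (s : Side) (e : ℕ) (order : List (Strand L))
    (created : Finset (Strand L × Strand L)) (c : List L) (f : ℕ → Strand L) (n i p : ℕ) :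
    Prop where
  pos : 1 ≤ p
  le : p ≤ n
  le' : n ≤ i
  good : ∀ k < i, I.SidedGood s e (f k) (f (k + 1))
  consecutive : ∀ k < i, Consecutive (f k) (f (k + 1)) (orient s order)
  not_created : ∀ k, p ≤ k + 1 → k + 1 ≤ i → orientPair s (f k) (f (k + 1)) ∉ created
  ne : ∀ k, ∀ l ∈ c, f k ≠ line l
  before : ∀ k ≤ i, ∀ l ∈ c, [line l, f k].Sublist (orient s order)
  forbidden : ∃ l ∈ c, I.MustNotCross s (line l) (f i)
  allowed : ∀ k < i, ∀ l ∈ c, ¬ I.MustNotCross s (line l) (f k)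
  endsAt : I.EndsAt s (e + 1) (f (p - 1))
  endsOn : ∀ k, p ≤ k → k < n → ¬ I.EndsOn (otherSide s) (f k)
  endsOn_other : I.EndsOn (otherSide s) (f n) ∨ n = i

variable [DecidableEq L] [Fintype L]

/-- The effect of one block crossing of the algorithm. -/
theorem placeLine_spec {sel : ℕ → Side → List ℕ → ℕ}
    (hsel : ∀ (e : ℕ) (s : Side) (J : List ℕ), J ≠ [] → sel e s J ∈ J) {s : Side} {e : ℕ}
    (he : e < I.numEdges) {st : State L} {X m Y rs : List L} {r : L} {prev : Strand L}
    (hlay : I.Layout s e st.order X m Y) (hX : X ++ r :: rs = I.ends s (e + 1))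
    (hY : ∀ l ∈ m, ∀ y ∈ Y, I.MustNotCross s (line l) (line y))
    (hprev : (outer s :: X.map line).getLast? = some prev) (hr : r ∈ m) :
    (∃ t, m = r :: t ∧ I.placeLine sel s e prev (line r) st = st) ∨
    ∃ c t₁ t₂ : List L, c ≠ [] ∧ m = c ++ r :: (t₁ ++ t₂) ∧ ∃ st',
      I.placeLine sel s e prev (line r) st = st' ∧
      st'.order = orient s ((outer s :: X.map line) ++ (r :: t₁).map line ++ c.map line ++
        (t₂.map line ++ (outer (otherSide s) :: Y.map line).reverse)) ∧
      st'.created = st.created ∪ Finset.univ.filter (fun q =>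
        I.GoodPair e q.1 q.2 ∧ Consecutive q.1 q.2 st'.order ∧ ¬ Consecutive q.1 q.2 st.order) ∧
      st'.history = st.history ++ [st'.order] ∧
      (∀ x ∈ r :: t₁, ∀ l ∈ c, ¬ I.MustNotCross s (line l) (line x)) ∧
      ∃ (f : ℕ → Strand L) (n : ℕ), 0 < n ∧
        ((r :: t₁).map line).getLast? = some (f (n - 1)) ∧
        (t₂.map line ++ (outer (otherSide s) :: Y.map line).reverse).head? = some (f n) ∧
        (¬ I.SidedGood s e (f (n - 1)) (f n) ∨ orientPair s (f (n - 1)) (f n) ∈ st.created ∨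
          ∃ i p, I.BreaksInitial s e st.order st.created c f n i p) := by
  obtain ⟨c, t, rfl⟩ := List.append_of_mem hr
  set Z := (outer (otherSide s) :: Y.map line).reverse with hZ
  set P := (outer s :: X.map line) with hP
  have hw := hlay.eq
  have hnd := hlay.nodup_orient
  rw [hw] at hnd
  set T := line r :: (t.map line ++ Z) with hT
  have hw' : orient s st.order = P ++ (c.map line ++ T) := by
    rw [hw, hT, hP, hZ]; simp
  have hnd' : (P ++ (c.map line ++ T)).Nodup := by rw [← hw', hw]; exact hnd
  have hidx : (orient s st.order).idxOf prev + 1 = P.length := by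
    rw [hw']; exact idxOf_last hnd' hprev
  have hdrop : (orient s st.order).drop ((orient s st.order).idxOf prev + 1) = c.map line ++ T := by
    rw [hidx, hw']; exact List.drop_left
  have htake : (orient s st.order).take ((orient s st.order).idxOf prev + 1) = P := by
    rw [hidx, hw']; exact List.take_left
  have hcT := List.nodup_append.1 (List.nodup_append.1 hnd').2.1
  have hridx : (c.map line ++ T).idxOf (line r) = (c.map line).length := by
    have : line r ∉ c.map line := fun h => hcT.2.2 _ h (line r) (by simp [T]) rfl
    rw [List.idxOf_append_of_notMem this]
    simp [T]
  have hcr : (c.map line ++ T).take ((c.map line ++ T).idxOf (line r)) = c.map line := by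
    rw [hridx]; exact List.take_left
  have htl : (c.map line ++ T).drop ((c.map line ++ T).idxOf (line r)) = T := by
    rw [hridx]; exact List.drop_left
  have hplace : I.placeLine sel s e prev (line r) st = if c.map line = [] then st else
      let chain := linkedPrefix
        (fun x y => I.GoodPair e (orientPair s x y).1 (orientPair s x y).2) T
      let n := I.moveLength sel s e st.created (c.map line) chain
      let order := orient s (P ++ T.take n ++ c.map line ++ T.drop n)
      { order := order
        created := st.created ∪ Finset.univ.filter (fun q =>
          I.GoodPair e q.1 q.2 ∧ Consecutive q.1 q.2 order ∧ ¬ Consecutive q.1 q.2 st.order)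
        history := st.history ++ [order] } := by
    unfold placeLine
    simp only [hdrop, htake, hcr, htl]
  rcases List.eq_nil_or_concat c with hc | ⟨c', z, hc⟩
  · left
    subst hc
    exact ⟨t, rfl, by rw [hplace]; simp⟩
  right
  have hc : c ≠ [] := by rw [hc]; simp
  obtain ⟨l₀, hl₀⟩ := List.exists_mem_of_ne_nil c hc
  rw [if_neg (by simpa using hc)] at hplace
  dsimp only at hplace
  set chain := linkedPrefix
    (fun x y => I.GoodPair e (orientPair s x y).1 (orientPair s x y).2) T with hchain
  set n := I.moveLength sel s e st.created (c.map line) chain with hn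
  have hTne : T ≠ [] := by simp [T]
  have hlen : chain.length ≤ T.length := linkedPrefix_length_le _ T
  have hpos : 0 < chain.length := linkedPrefix_length_pos _ hTne
  have hget : ∀ k, k < chain.length → chain[k]? = T[k]? := linkedPrefix_getElem? _ T
  -- The default `line r` belongs to T, so `f k` is in T, and hence not among the crossed lines, for
  -- every k.
  set f : ℕ → Strand L := fun k => T[k]?.getD (line r) with hf
  have hTf : ∀ k, k < T.length → T[k]? = some (f k) := by
    intro k hk
    simp [hf, List.getElem?_eq_getElem hk]
  have hcf' : ∀ k, k < chain.length → chain[k]? = some (f k) := fun k hk =>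
    (hget k hk).trans (hTf k (by omega))
  have hfT : ∀ k, f k ∈ T := by
    intro k
    rcases Nat.lt_or_ge k T.length with hk | hk
    · exact List.mem_of_getElem? (hTf k hk)
    · have : f k = line r := by simp [hf, List.getElem?_eq_none hk]
      rw [this]; simp [T]
  have hne : ∀ k, ∀ l ∈ c, f k ≠ line l := by
    intro k l hl h
    exact hcT.2.2 (line l) (List.mem_map_of_mem hl) (f k) (hfT k) h.symm
  have h₀ : f 0 = line r := by simp [hf, T]
  have hgood : ∀ k, k + 1 < chain.length → I.SidedGood s e (f k) (f (k + 1)) := by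
    intro k hk
    exact linkedPrefix_rel _ T k hk _ (hTf k (by omega)) _ (hTf (k + 1) (by omega))
  have hconsec : ∀ k, k + 1 < T.length → Consecutive (f k) (f (k + 1)) (orient s st.order) := by
    intro k hk
    rw [hw', consecutive_append, consecutive_append]
    refine Or.inr (Or.inl (Or.inr (Or.inl ?_)))
    refine consecutive_iff.2 ⟨T.take k, T.drop (k + 1 + 1), ?_⟩
    have h₁ : f k = T[k] := by simp [hf, List.getElem?_eq_getElem (show k < T.length by omega)]
    have h₂ : f (k + 1) = T[k + 1] := by simp [hf, List.getElem?_eq_getElem hk]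
    rw [h₁, h₂, ← List.drop_eq_getElem_cons, ← List.drop_eq_getElem_cons, List.take_append_drop]
  set p := (chain.takeWhile (fun x => I.EndsAt s (e + 1) x)).length with hp
  have hpc : p ≤ chain.length := (List.takeWhile_prefix _).length_le
  have hends : ∀ k < p, I.EndsAt s (e + 1) (f k) := by
    intro k hk
    have h₁ : (chain.takeWhile (fun x => I.EndsAt s (e + 1) x))[k]? = some (f k) := by
      rw [← hcf' k (by omega)]
      obtain ⟨l, hl⟩ := List.takeWhile_prefix (l := chain) (fun x => decide (I.EndsAt s (e + 1) x))
      conv_rhs => rw [← hl]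
      rw [List.getElem?_append_left hk]
    have h₂ := List.mem_takeWhile_imp (List.mem_of_getElem? h₁)
    exact of_decide_eq_true h₂
  have hp1 : 1 ≤ p := by
    obtain ⟨x, ch, hch⟩ := List.exists_cons_of_length_pos hpos
    have hx : x = line r := by
      have := hcf' 0 hpos
      rw [hch, h₀] at this
      simpa using this
    have hr' : I.EndsAt s (e + 1) x := by
      rw [hx]
      change r ∈ I.ends s (e + 1)
      rw [← hX]; simp
    rw [hp, hch, List.takeWhile_cons, if_pos (decide_eq_true hr')]
    simp
  have hdis := List.nodup_append.1 (List.nodup_append.1 hlay.nodup).1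
  have hcX : ∀ l ∈ c, l ∉ X := fun l hl hlX =>
    hdis.2.2 l hlX l (List.mem_append_left _ hl) rfl
  have hce : ∀ l ∈ c, I.OnEdge e l := fun l hl => (hlay.mem l).1 (by simp [hl])
  have hallow : ∀ k < p, ∀ l ∈ c, ¬ I.MustNotCross s (line l) (f k) :=
    not_mustNotCross_of_endsAt he hX hcX hce h₀ hne
      (fun k hk => hgood k (by omega)) hends
  have hspec := moveLength_spec hsel s e st.created (c.map line) chain p hp (by
    intro k hk x hx
    rw [hcf' k (by omega), Option.mem_some_iff] at hx
    subst hx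
    rintro ⟨l, hl, h⟩
    obtain ⟨l', hl', rfl⟩ := List.mem_map.1 hl
    exact hallow k hk l' hl' h) n hn
  have hZforb : ∀ x ∈ Z, I.MustNotCross s (line l₀) x := by
    intro x hx
    rcases List.mem_cons.1 (List.mem_reverse.1 hx) with rfl | hx
    · exact mustNotCross_outer_other s _
    · obtain ⟨y, hy, rfl⟩ := List.mem_map.1 hx
      exact hY l₀ (List.mem_append_left _ hl₀) y hy
  have hZne : Z ≠ [] := by simp [Z]
  -- the moved strands may pass
  have hmove : 0 < n ∧ n ≤ chain.length ∧
      ∀ k < n, ∀ l ∈ c, ¬ I.MustNotCross s (line l) (f k) := by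
    rcases hspec with ⟨h₁, h₂⟩ | ⟨i, h₁, h₂, h₃, h₄, h₅, -⟩
    · refine ⟨by omega, h₁.le, fun k hk l hl h => ?_⟩
      exact h₂ (f k) (List.mem_of_getElem? (hcf' k (by omega))) ⟨line l, List.mem_map_of_mem hl, h⟩
    · refine ⟨by omega, by omega, fun k hk l hl h => ?_⟩
      exact h₃ k (by omega) (f k) (hcf' k (by omega)) ⟨line l, List.mem_map_of_mem hl, h⟩
  obtain ⟨hn0, hnc, hmove⟩ := hmove
  -- The strands of Z, placed on the other side or virtual there, must not pass l₀; so the moved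
  -- block stops before Z and consists of genuine lines.
  have hnt : n ≤ t.length + 1 := by
    by_contra hcon
    refine hmove (t.length + 1) (by omega) l₀ hl₀ (hZforb _ ?_)
    have h₁ := hTf (t.length + 1) (by omega)
    rw [hT, List.getElem?_cons_succ, List.getElem?_append_right (by simp)] at h₁
    exact List.mem_of_getElem? h₁
  obtain ⟨q, hq⟩ : ∃ q, n = q + 1 := ⟨n - 1, by omega⟩
  have htk : T.take n = (r :: t.take q).map line := by
    rw [hq, hT, List.take_succ_cons, List.take_append_of_le_length (by simp; omega)]
    simp
  have hdr : T.drop n = (t.drop q).map line ++ Z := by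
    rw [hq, hT, List.drop_succ_cons, List.drop_append_of_le_length (by simp; omega)]
    simp
  have hnT : n < T.length := by
    have : 0 < Z.length := List.length_pos_of_ne_nil hZne
    simp only [hT, List.length_cons, List.length_append, List.length_map]
    omega
  refine ⟨c, t.take q, t.drop q, hc, by simp, _, hplace, ?_, rfl, rfl, ?_, f, n, hn0, ?_, ?_, ?_⟩
  · dsimp only
    rw [htk, hdr]
  · intro x hx l hl
    have hx' : line x ∈ T.take n := by rw [htk]; exact List.mem_map_of_mem hx
    obtain ⟨k, hk⟩ := List.mem_iff_getElem?.1 hx'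
    have hkn : k < n := by
      by_contra hcon
      rw [List.getElem?_eq_none (by rw [List.length_take]; omega)] at hk
      cases hk
    rw [List.getElem?_take_of_lt hkn, hTf k (by omega)] at hk
    rw [← Option.some_injective _ hk]
    exact hmove k hkn l hl
  · rw [← htk, List.getLast?_eq_getElem?, List.length_take, min_eq_left hnT.le,
      List.getElem?_take_of_lt (by omega)]
    exact hTf _ (by omega)
  · rw [← hdr, List.head?_drop]
    exact hTf n hnT
  · rcases hspec with ⟨h₁, h₂⟩ | ⟨i, h₁, h₂, h₃, h₄, h₅, h₆⟩
    · left
      have := not_rel_linkedPrefix (fun x y => I.GoodPair e (orientPair s x y).1 (orientPair s x y).2)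
        T (n - 1) (by rw [← hchain]; omega) _ (hTf _ (by omega)) (f n) (by
          rw [show n - 1 + 1 = n by omega]; exact hTf n hnT)
      exact this
    · right
      rcases h₆ with ⟨x, hx, y, hy, hxy⟩ | ⟨h₆, h₇, h₈⟩
      · left
        rw [hcf' _ (by omega), Option.mem_some_iff] at hx hy
        rw [hx, hy]
        exact hxy
      · right
        refine ⟨i, p, hp1, h₄, h₅, fun k hk => hgood k (by omega),
          fun k hk => hconsec k (by omega), ?_, hne, ?_, ?_, ?_, hends _ (by omega), ?_, ?_⟩
        · intro k hk hk' h
          exact h₆ (k + 1) hk hk' ⟨_, hcf' k (by omega), _, hcf' _ (by omega), h⟩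
        · intro k hk l hl
          rw [hw', pair_sublist_append, pair_sublist_append]
          exact Or.inr (Or.inl (Or.inr (Or.inr ⟨List.mem_map_of_mem hl, hfT k⟩)))
        · obtain ⟨x, hx, l, hl, h⟩ := h₂
          rw [hcf' _ (by omega), Option.mem_some_iff] at hx
          obtain ⟨l', hl', rfl⟩ := List.mem_map.1 hl
          exact ⟨l', hl', hx ▸ h⟩
        · intro k hk l hl h
          exact h₃ k hk (f k) (hcf' k (by omega)) ⟨line l, List.mem_map_of_mem hl, h⟩
        · intro k hk hk' h
          exact h₇ k hk hk' ⟨f k, hcf' k (by omega), h⟩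
        · rcases h₈ with ⟨y, hy, h⟩ | h
          · left
            rw [hcf' _ (by omega), Option.mem_some_iff] at hy
            rw [hy]; exact h
          · exact Or.inr h

end Placement

end PathInstance

namespace PathInstance

open Strand

/-! ### An invariant for initial pairs -/

section OrderInvariant

variable {L : Type*} (I : PathInstance L)

/-- If a line is on the outer side of an initial good pair that it may not cross completely, then
it entered there, or it must not cross the pair at all. -/
structure InitialPairsKept (e : ℕ) (w : List (Strand L)) (created : Finset (Strand L × Strand L)) :
    Prop where
  from_above : ∀ x b, I.GoodPair e x (line b) → Consecutive x (line b) w →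
    (x, line b) ∉ created → ∀ l, [line l, line b].Sublist w → I.LeavesAbove l b →
    I.EntersAbove l b ∨ I.StrandLeavesAbove (line l) x
  from_below : ∀ a y, I.GoodPair e (line a) y → Consecutive (line a) y w →
    (line a, y) ∉ created → ∀ l, [line a, line l].Sublist w → I.LeavesAbove a l →
    I.EntersAbove a l ∨ I.StrandLeavesAbove y (line l)

variable {I}

/-- If l gets above b in this step, then, x and b being adjacent before and after, it also passes x.
Monotonicity of the step makes l leave above x, which is the second alternative. -/
theorem InitialPairsKept.step {e : ℕ} {w w' : List (Strand L)}
    {created created' : Finset (Strand L × Strand L)} (h : I.InitialPairsKept e w created)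
    (hw : w.Nodup) (hw' : w'.Nodup) (hmem : ∀ x, x ∈ w' → x ∈ w)
    (hmono : ∀ x y, [x, y].Sublist w → [y, x].Sublist w' → I.StrandLeavesAbove y x)
    (hcr : ∀ x y, I.GoodPair e x y → Consecutive x y w' → (x, y) ∉ created' →
      (x, y) ∉ created ∧ Consecutive x y w) : I.InitialPairsKept e w' created' := by
  constructor
  · intro x b hg hc hn l hl hlb
    obtain ⟨hn₁, hc₁⟩ := hcr _ _ hg hc hn
    have hne := pair_sublist_ne hw' hl
    rcases pair_sublist_total (hmem _ (pair_sublist_mem_left hl))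
      (hmem _ (pair_sublist_mem_right hl)) hne with h₁ | h₁
    · exact h.from_above x b hg hc₁ hn₁ l h₁ hlb
    · have h₂ := pair_sublist_trans hw hc₁.sublist h₁
      rcases hc.before_right hw' hl with h₃ | h₃
      · exact absurd h₃.symm (pair_sublist_ne hw h₂)
      · exact Or.inr (hmono _ _ h₂ h₃)
  · intro a y hg hc hn l hl hlb
    obtain ⟨hn₁, hc₁⟩ := hcr _ _ hg hc hn
    have hne := pair_sublist_ne hw' hl
    rcases pair_sublist_total (hmem _ (pair_sublist_mem_left hl))
      (hmem _ (pair_sublist_mem_right hl)) hne with h₁ | h₁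
    · exact h.from_below a y hg hc₁ hn₁ l h₁ hlb
    · have h₂ := pair_sublist_trans hw h₁ hc₁.sublist
      rcases hc.behind_left hw' hl with h₃ | h₃
      · exact absurd h₃ (pair_sublist_ne hw h₂)
      · exact Or.inr (hmono _ _ h₂ h₃)

/-- If one of the two lines that are compared starts here, their order is the order of entering.
Otherwise both pass, and then so does the other strand of the adjacent pair, as no passing line lies
outside of a starting one. -/
theorem initialPairsKept_start {e : ℕ} {m : List L} {created : Finset (Strand L × Strand L)}
    (hm : m.Nodup) (hmem : ∀ l ∈ m, I.PassesNode e l)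
    (h : ∀ a ∈ m, ∀ b ∈ m, ∀ l ∈ m, I.GoodPair e (line a) (line b) →
      Consecutive (line a) (line b) (frame (I.startOrder e m)) → (line a, line b) ∉ created →
      (([l, b].Sublist (I.startOrder e m) → I.LeavesAbove l b →
        I.EntersAbove l b ∨ I.LeavesAbove l a) ∧
      ([a, l].Sublist (I.startOrder e m) → I.LeavesAbove a l →
        I.EntersAbove a l ∨ I.LeavesAbove b l))) :
    I.InitialPairsKept e (frame (I.startOrder e m)) created := by
  have hn := I.nodup_startOrder hm hmem
  have hn' := nodup_frame.2 hn
  have hst : ∀ {x}, x ∈ I.startOrder e m → I.first x ≠ e → x ∈ m := fun h h' =>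
    (I.mem_startOrder.1 h).resolve_right h'
  have hblocks : frame (I.startOrder e m) = (top :: (I.starts .above e).map line) ++
      m.map line ++ (bottom :: (I.starts .below e).map line).reverse := by
    unfold startOrder; exact frame_blocks _ _ _
  constructor
  · intro x b hg hc hcr l hl hlb
    have hl' := pair_sublist_frame.1 hl
    by_cases hlb' : I.first l = e ∨ I.first b = e
    · exact Or.inl (I.entersAbove_of_sublist_startOrder hm hmem hl' hlb')
    push Not at hlb'
    have hlm := hst (pair_sublist_mem_left hl') hlb'.1
    have hbm := hst (pair_sublist_mem_right hl') hlb'.2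
    have hx : ∃ a ∈ m, x = line a := by
      have hxm := hc.mem_left
      rw [hblocks, List.mem_append, List.mem_append] at hxm
      rcases hxm with (hxm | hxm) | hxm
      · exfalso
        have hlx : [x, line l].Sublist (frame (I.startOrder e m)) := by
          rw [hblocks, List.append_assoc, pair_sublist_append]
          exact Or.inr (Or.inr ⟨hxm, List.mem_append_left _ (List.mem_map_of_mem hlm)⟩)
        rcases hc.before_right hn' hl with h₁ | h₁
        · exact pair_sublist_ne hn' hlx h₁.symm
        · exact pair_sublist_antisymm hn' hlx h₁
      · obtain ⟨a, ha, rfl⟩ := List.mem_map.1 hxm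
        exact ⟨a, ha, rfl⟩
      · exfalso
        refine pair_sublist_antisymm hn' hc.sublist ?_
        rw [hblocks, pair_sublist_append]
        exact Or.inr (Or.inr ⟨List.mem_append_right _ (List.mem_map_of_mem hbm), hxm⟩)
    obtain ⟨a, ham, rfl⟩ := hx
    exact (h a ham b hbm l hlm hg hc hcr).1 hl' hlb
  · intro a y hg hc hcr l hl hlb
    have hl' := pair_sublist_frame.1 hl
    by_cases hlb' : I.first a = e ∨ I.first l = e
    · exact Or.inl (I.entersAbove_of_sublist_startOrder hm hmem hl' hlb')
    push Not at hlb'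
    have ham := hst (pair_sublist_mem_left hl') hlb'.1
    have hlm := hst (pair_sublist_mem_right hl') hlb'.2
    have hy : ∃ b ∈ m, y = line b := by
      have hym := hc.mem_right
      rw [hblocks, List.mem_append, List.mem_append] at hym
      rcases hym with (hym | hym) | hym
      · exfalso
        refine pair_sublist_antisymm hn' hc.sublist ?_
        rw [hblocks, List.append_assoc, pair_sublist_append]
        exact Or.inr (Or.inr ⟨hym, List.mem_append_left _ (List.mem_map_of_mem ham)⟩)
      · obtain ⟨b, hb, rfl⟩ := List.mem_map.1 hym
        exact ⟨b, hb, rfl⟩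
      · exfalso
        have hly : [line l, y].Sublist (frame (I.startOrder e m)) := by
          rw [hblocks, pair_sublist_append]
          exact Or.inr (Or.inr ⟨List.mem_append_right _ (List.mem_map_of_mem hlm), hym⟩)
        rcases hc.behind_left hn' hl with h₁ | h₁
        · exact pair_sublist_ne hn' hly h₁
        · exact pair_sublist_antisymm hn' hly h₁
    obtain ⟨b, hbm, rfl⟩ := hy
    exact (h a ham b hbm l hlm hg hc hcr).2 hl' hlb

theorem pair_sublist_startOrder_iff {v : ℕ} {m : List L} (hm : m.Nodup)
    (hmem : ∀ l ∈ m, I.PassesNode v l) {x y : L} (hx : x ∈ m) (hy : y ∈ m) :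
    [x, y].Sublist (I.startOrder v m) ↔ [x, y].Sublist m := by
  refine ⟨fun h => ?_, fun h => h.trans (by simp [startOrder])⟩
  have hn := I.nodup_startOrder hm hmem
  refine (pair_sublist_total hx hy (pair_sublist_ne hn h)).resolve_right fun h' => ?_
  exact pair_sublist_antisymm hn h (h'.trans (by simp [startOrder]))

theorem InitialPairsKept.node {e : ℕ} (he : e + 1 < I.numEdges) {m : List L}
    {created created' : Finset (Strand L × Strand L)} (hm : m.Nodup)
    (hmem : ∀ l, l ∈ m ↔ I.PassesNode (e + 1) l)
    (h : I.InitialPairsKept e (frame (I.endOrder (e + 1) m)) created)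
    (hcr : ∀ a b a' b', (a, b) ∈ created → I.Continues (e + 1) a b a' b' → (a', b') ∈ created') :
    I.InitialPairsKept (e + 1) (frame (I.startOrder (e + 1) m)) created' := by
  refine initialPairsKept_start hm (fun l => (hmem l).1) ?_
  intro a ha b hb l hl hg hc hn
  have hcont : I.Continues (e + 1) (line a) (line b) (line a) (line b) :=
    Or.inl ⟨a, b, (hmem a).1 ha, (hmem b).1 hb, rfl, rfl, rfl, rfl⟩
  have hg' : I.GoodPair e (line a) (line b) := .continuing he hcont hg
  have hc' := (I.consecutive_iff_of_continues hm hmem hcont).2 hc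
  have hn' : (line a, line b) ∉ created := fun h => hn (hcr _ _ _ _ h hcont)
  have key : ∀ {x y}, x ∈ m → y ∈ m → [x, y].Sublist (I.startOrder (e + 1) m) →
      [line x, line y].Sublist (frame (I.endOrder (e + 1) m)) := by
    intro x y hx hy h
    rw [pair_sublist_startOrder_iff hm (fun l => (hmem l).1) hx hy] at h
    exact pair_sublist_frame.2 (h.trans (by simp [endOrder]))
  exact ⟨fun h₁ h₂ => h.from_above _ b hg' hc' hn' l (key hl hb h₁) h₂,
    fun h₁ h₂ => h.from_below a _ hg' hc' hn' l (key ha hl h₁) h₂⟩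

end OrderInvariant

/-! ### The algorithm as a sequence of single steps -/

section Run

variable {L : Type*} (I : PathInstance L)

/-- A configuration of the algorithm: the edge and the side that are being treated, the line
placed last (or the virtual line), the lines still to be placed on this side, and the state. -/
structure Config (L : Type*) where
  edge : ℕ
  side : Side
  prev : Strand L
  todo : List L
  st : State L

variable [Fintype L] [DecidableEq L]

/-- The state with which the edge `e + 1` is started. -/
def passNode (e : ℕ) (st : State L) : State L :=
  let w := frame (I.startOrder (e + 1)
    ((unframe st.order).filter (fun l => I.OnEdge (e + 1) l)))
  { order := w
    created := Finset.univ.filter (fun q => ∃ p ∈ st.created,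
      I.Continues (e + 1) p.1 p.2 q.1 q.2)
    history := [w] }

/-- The configuration in which the edge `e` is started. -/
def startConfig (sel : ℕ → Side → List ℕ → ℕ) (e : ℕ) : Config L :=
  ⟨e, .above, top, I.ends .above (e + 1), I.startState sel e⟩

/-- One step of the algorithm. -/
def next (sel : ℕ → Side → List ℕ → ℕ) : Config L → Config L
  | ⟨e, s, prev, r :: rs, st⟩ => ⟨e, s, line r, rs, I.placeLine sel s e prev (line r) st⟩
  | ⟨e, .above, _, [], st⟩ => ⟨e, .below, bottom, I.ends .below (e + 1), st⟩
  | ⟨e, .below, _, [], st⟩ => ⟨e + 1, .above, top, I.ends .above (e + 2), I.passNode e st⟩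

/-- The configuration after `n` steps. -/
def run (sel : ℕ → Side → List ℕ → ℕ) : ℕ → Config L
  | 0 => I.startConfig sel 0
  | n + 1 => I.next sel (run sel n)

/-- The configuration `c` leads to the result of the algorithm on its edge. -/
def LeadsToResult (sel : ℕ → Side → List ℕ → ℕ) (c : Config L) : Prop :=
  match c.side with
  | .above => I.placeLines sel .below c.edge bottom (I.ends .below (c.edge + 1))
      (I.placeLines sel .above c.edge c.prev c.todo c.st) =
        I.processEdge sel c.edge (I.startState sel c.edge)
  | .below => I.placeLines sel .below c.edge c.prev c.todo c.st =
      I.processEdge sel c.edge (I.startState sel c.edge)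

variable {I}

theorem LeadsToResult.next {sel : ℕ → Side → List ℕ → ℕ} {c : Config L}
    (h : I.LeadsToResult sel c) : I.LeadsToResult sel (I.next sel c) := by
  rcases c with ⟨e, s, prev, _ | ⟨r, rs⟩, st⟩
  · cases s
    · exact h
    · have h' : st = I.processEdge sel e (I.startState sel e) := h
      subst h'
      exact rfl
  · cases s
    · exact h
    · exact h

theorem leadsToResult_run (sel : ℕ → Side → List ℕ → ℕ) (n : ℕ) :
    I.LeadsToResult sel (I.run sel n) := by
  induction n with
  | zero => exact rfl
  | succ n ih => exact ih.next

theorem next_eq_startConfig {sel : ℕ → Side → List ℕ → ℕ} {e : ℕ} {prev : Strand L} {st : State L}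
    (h : I.LeadsToResult sel ⟨e, .below, prev, [], st⟩) :
    I.next sel ⟨e, .below, prev, [], st⟩ = I.startConfig sel (e + 1) := by
  have h' : st = I.processEdge sel e (I.startState sel e) := h
  subst h'
  rfl

theorem exists_run_todo_nil (sel : ℕ → Side → List ℕ → ℕ) : ∀ (rs : List L) (n e : ℕ) (s : Side)
    (prev : Strand L) (st : State L), I.run sel n = ⟨e, s, prev, rs, st⟩ →
    ∃ n' prev' st', I.run sel n' = ⟨e, s, prev', [], st'⟩
  | [], n, e, s, prev, st, h => ⟨n, prev, st, h⟩
  | r :: rs, n, e, s, prev, st, h => by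
    have h' : I.run sel (n + 1) = I.next sel ⟨e, s, prev, r :: rs, st⟩ := by rw [← h]; rfl
    exact exists_run_todo_nil sel rs (n + 1) e s _ _ h'

theorem exists_run_end (sel : ℕ → Side → List ℕ → ℕ) (e : ℕ)
    (h : ∃ n, I.run sel n = I.startConfig sel e) :
    ∃ n prev, I.run sel n =
      ⟨e, .below, prev, [], I.processEdge sel e (I.startState sel e)⟩ := by
  obtain ⟨n, hn⟩ := h
  obtain ⟨n, prev, st, hn⟩ := exists_run_todo_nil sel _ n e .above _ _ hn
  have h' : I.run sel (n + 1) = I.next sel ⟨e, .above, prev, [], st⟩ := by rw [← hn]; rfl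
  obtain ⟨n, prev, st, hn⟩ := exists_run_todo_nil sel _ (n + 1) e .below _ _ h'
  have h' := leadsToResult_run (I := I) sel n
  rw [hn] at h'
  have h'' : st = I.processEdge sel e (I.startState sel e) := h'
  exact ⟨n, prev, h'' ▸ hn⟩

theorem exists_run_start (sel : ℕ → Side → List ℕ → ℕ) (e : ℕ) :
    ∃ n, I.run sel n = I.startConfig sel e := by
  induction e with
  | zero => exact ⟨0, rfl⟩
  | succ e ih =>
    obtain ⟨n, prev, hn⟩ := exists_run_end sel e ih
    refine ⟨n + 1, ?_⟩
    change I.next sel (I.run sel n) = _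
    rw [hn]
    rfl

theorem edge_le_next (sel : ℕ → Side → List ℕ → ℕ) (c : Config L) :
    c.edge ≤ (I.next sel c).edge ∧ (I.next sel c).edge ≤ c.edge + 1 := by
  rcases c with ⟨e, s, prev, _ | ⟨r, rs⟩, st⟩
  · cases s <;> simp [next]
  · simp [next]

theorem edge_run_mono (sel : ℕ → Side → List ℕ → ℕ) {n n' : ℕ} (h : n ≤ n') :
    (I.run sel n).edge ≤ (I.run sel n').edge := by
  induction n', h using Nat.le_induction with
  | base => exact le_rfl
  | succ k _ ih => exact ih.trans (edge_le_next sel _).1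

/-- The edge index grows by at most one per step, so the run has passed the start of every edge up
to the current one. -/
theorem exists_run_start_le (sel : ℕ → Side → List ℕ → ℕ) (n : ℕ) :
    ∀ e ≤ (I.run sel n).edge, ∃ n' ≤ n, I.run sel n' = I.startConfig sel e := by
  induction n with
  | zero =>
    intro e he
    obtain rfl : e = 0 := Nat.le_zero.1 he
    exact ⟨0, le_rfl, rfl⟩
  | succ n ih =>
    intro e he
    rcases Nat.lt_or_ge (I.run sel n).edge e with hlt | hge
    · refine ⟨n + 1, le_rfl, ?_⟩
      have h := leadsToResult_run (I := I) sel n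
      change e ≤ (I.next sel (I.run sel n)).edge at he
      change I.next sel (I.run sel n) = _
      generalize I.run sel n = c at *
      rcases c with ⟨e', s, prev, _ | ⟨r, rs⟩, st⟩ <;> change e' < e at hlt
      · cases s
        · simp only [next] at he; omega
        · rw [next_eq_startConfig h] at he ⊢
          obtain rfl : e = e' + 1 := by simp only [startConfig] at he; omega
          rfl
      · simp only [next] at he; omega
    · obtain ⟨n', h, h'⟩ := ih e hge
      exact ⟨n', by omega, h'⟩

end Run

end PathInstance

namespace PathInstance

open Strand

/-! ### Soundness of the steps -/

section Sound

variable {L : Type*} (I : PathInstance L)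

/-- The lines that have been placed in a configuration. -/
structure Placed (c : Config L) (X m Y : List L) : Prop where
  layout : I.Layout c.side c.edge c.st.order X m Y
  todo_eq : X ++ c.todo = I.ends c.side (c.edge + 1)
  above : c.side = .above → Y = []
  below : c.side = .below → Y = I.ends .above (c.edge + 1)
  prev : (outer c.side :: X.map line).getLast? = some c.prev

variable {I}

theorem Layout.of_perm {s : Side} {e : ℕ} {order order' : List (Strand L)}
    {X m Y X' m' Y' : List L} (h : I.Layout s e order X m Y)
    (hp : (X' ++ m' ++ Y').Perm (X ++ m ++ Y))
    (heq : orient s order' =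
      (outer s :: X'.map line) ++ m'.map line ++ (outer (otherSide s) :: Y'.map line).reverse) :
    I.Layout s e order' X' m' Y' :=
  ⟨heq, hp.nodup_iff.2 h.nodup, fun l => hp.mem_iff.trans (h.mem l)⟩

theorem Layout.swap {e : ℕ} {order : List (Strand L)} {X m Y : List L}
    (h : I.Layout .above e order X m Y) : I.Layout .below e order Y m.reverse X := by
  have hp : (Y ++ m.reverse ++ X).Perm (X ++ m ++ Y) := by
    refine List.perm_append_comm.trans ?_
    rw [List.append_assoc]
    exact (List.perm_append_comm.trans ((List.reverse_perm m).append_right Y)).append_left X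
  refine ⟨?_, hp.nodup_iff.2 h.nodup, fun l => hp.mem_iff.trans (h.mem l)⟩
  have := h.eq
  change order = _ at this
  rw [this]
  simp [orient, otherSide]

theorem filter_onEdge_endOrder {v : ℕ} {m : List L} (h : ∀ l ∈ m, I.PassesNode v l) :
    (I.endOrder v m).filter (fun l => I.OnEdge v l) = m := by
  have key : ∀ w : List L, (∀ l ∈ w, I.last l = v) → w.filter (fun l => I.OnEdge v l) = [] := by
    intro w hw
    rw [List.filter_eq_nil_iff]
    intro l hl h
    have h₁ := (of_decide_eq_true h).2
    have h₂ := hw l hl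
    omega
  rw [endOrder, List.filter_append, List.filter_append, key _ (fun l => I.last_of_mem_ends),
    key _ (fun l hl => I.last_of_mem_ends (List.mem_reverse.1 hl)), List.nil_append,
    List.append_nil, List.filter_eq_self]
  intro l hl
  have := h l hl
  exact decide_eq_true ⟨this.1.le, this.2⟩

/-- With both sides treated, every line that ends at the node has its prescribed outer place, and
the remaining middle consists of the passing lines. -/
theorem Placed.final {c : Config L} {X m Y : List L} (h : I.Placed c X m Y)
    (hs : c.side = .below) (ht : c.todo = []) :
    ∃ m' : List L, c.st.order = frame (I.endOrder (c.edge + 1) m') ∧ m'.Nodup ∧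
      (∀ l, l ∈ m' ↔ I.PassesNode (c.edge + 1) l) ∧
      (unframe c.st.order).filter (fun l => I.OnEdge (c.edge + 1) l) = m' := by
  have hX := h.todo_eq
  have hY := h.below hs
  rw [ht, List.append_nil, hs] at hX
  have hl := h.layout
  rw [hs, hX, hY] at hl
  have hn := hl.nodup
  have hmem : ∀ l, l ∈ m ↔ I.PassesNode (c.edge + 1) l := by
    intro l
    constructor
    · intro hl'
      have he := (hl.mem l).1 (by simp [hl'])
      have hne : I.last l ≠ c.edge + 1 := by
        intro h'
        have := List.nodup_append.1 hn
        have h₁ := List.nodup_append.1 this.1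
        have h₂ := I.mem_ends_or l
        rw [h'] at h₂
        rcases h₂ with h₂ | h₂
        · exact this.2.2 l (List.mem_append_right _ hl') l h₂ rfl
        · exact h₁.2.2 l h₂ l hl' rfl
      obtain ⟨h₁, h₂⟩ := he
      exact ⟨by omega, by omega⟩
    · intro hp
      have := (hl.mem l).2 (onEdge_of_passesNode hp).1
      rw [List.mem_append, List.mem_append] at this
      rcases this with (h' | h') | h'
      · exact absurd (I.last_of_mem_ends h') hp.2.ne'
      · exact h'
      · exact absurd (I.last_of_mem_ends h') hp.2.ne'
  have hord : c.st.order = frame (I.endOrder (c.edge + 1) m.reverse) := by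
    rw [hl.order_eq]
    simp [orient, endOrder]
  -- On side `below` the layout is read from bottom to top.
  refine ⟨m.reverse, hord, ?_, ?_, ?_⟩
  · exact List.nodup_reverse.2 (List.nodup_append.1 (List.nodup_append.1 hn).1).2.1
  · simpa using hmem
  · rw [hord, unframe_frame, filter_onEdge_endOrder]
    simpa using fun l => (hmem l).1

theorem layout_start {e : ℕ} {m : List L} (hm : m.Nodup) (hmem : ∀ l, l ∈ m ↔ I.PassesNode e l) :
    I.Layout .above e (frame (I.startOrder e m)) [] (I.startOrder e m) [] := by
  refine ⟨by simp [orient, frame, outer, otherSide], ?_, ?_⟩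
  · simpa using I.nodup_startOrder hm fun l => (hmem l).1
  · intro l
    have := I.first_lt_last l
    simp only [List.nil_append, List.append_nil, mem_startOrder, hmem, PassesNode, OnEdge]
    omega

theorem blockMove_orient {s : Side} {A B C D : List L} (hB : B ≠ []) (hC : C ≠ []) :
    BlockMove (orient s (A ++ B ++ C ++ D)) (orient s (A ++ C ++ B ++ D)) := by
  cases s
  · exact ⟨A, B, C, D, hB, hC, rfl, rfl⟩
  · exact ⟨D.reverse, C.reverse, B.reverse, A.reverse, by simpa using hC, by simpa using hB,
      by simp [orient], by simp [orient]⟩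

theorem unframe_orient (s : Side) (w : List (Strand L)) :
    unframe (orient s w) = orient s (unframe w) := by
  cases s
  · rfl
  · exact List.filterMap_reverse

theorem pair_sublist_of_blocks {α : Type*} {P C T D : List α} (hn : (P ++ C ++ T ++ D).Nodup)
    {x y : α} (h : [x, y].Sublist (P ++ C ++ T ++ D)) (h' : [y, x].Sublist (P ++ T ++ C ++ D)) :
    x ∈ C ∧ y ∈ T := by
  have hn' : (P ++ T ++ C ++ D).Nodup := by
    refine (List.Perm.nodup_iff ?_).2 hn
    simp only [List.append_assoc]
    refine List.Perm.append_left _ ?_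
    rw [← List.append_assoc, ← List.append_assoc]
    exact List.perm_append_comm.append_right _
  by_contra hcon
  refine pair_sublist_antisymm hn' h' ?_
  simp only [pair_sublist_append, List.mem_append] at h ⊢
  tauto

variable [Fintype L] [DecidableEq L]

/-- What a block crossing of the algorithm does. -/
structure Move (I : PathInstance L) (c c' : Config L) (r : L) (C : List L) (f : ℕ → Strand L)
    (n : ℕ) : Prop where
  edge_eq : c'.edge = c.edge
  history_eq : c'.st.history = c.st.history ++ [c'.st.order]
  created_eq : c'.st.created = c.st.created ∪ Finset.univ.filter (fun q =>
    I.GoodPair c.edge q.1 q.2 ∧ Consecutive q.1 q.2 c'.st.order ∧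
      ¬ Consecutive q.1 q.2 c.st.order)
  nodup : c.st.order.Nodup
  nodup' : c'.st.order.Nodup
  mem : ∀ x, x ∈ c'.st.order → x ∈ c.st.order
  mono : ∀ x y, [x, y].Sublist c.st.order → [y, x].Sublist c'.st.order →
    I.StrandLeavesAbove y x
  blockMove : BlockMove (unframe c.st.order) (unframe c'.st.order)
  onEdge : ∀ l ∈ C, I.OnEdge c.edge l
  ends : I.ConsecutiveEnds (c.edge + 1) (orientPair c.side c.prev (line r)).1
    (orientPair c.side c.prev (line r)).2
  not_consecutive : ¬ Consecutive (orientPair c.side c.prev (line r)).1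
    (orientPair c.side c.prev (line r)).2 c.st.order
  broken : ∀ x y, I.GoodPair c.edge x y → Consecutive x y c.st.order →
    ¬ Consecutive x y c'.st.order → (x, y) = orientPair c.side (f (n - 1)) (f n)
  reason : 0 < n ∧ (¬ I.SidedGood c.side c.edge (f (n - 1)) (f n) ∨
    orientPair c.side (f (n - 1)) (f n) ∈ c.st.created ∨
    ∃ i p, I.BreaksInitial c.side c.edge c.st.order c.st.created C f n i p)

/-- A block move destroys adjacencies at three borders. The first has `prev` as its outer strand and
the second has r as its inner one; these two are good partners of each other and not yet adjacent,
so by uniqueness neither border carries a good pair. Only the border behind the moved block can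
break one. -/
theorem Placed.move {sel : ℕ → Side → List ℕ → ℕ}
    (hsel : ∀ (e : ℕ) (s : Side) (J : List ℕ), J ≠ [] → sel e s J ∈ J) {c : Config L}
    (he : c.edge < I.numEdges) {X m Y : List L} (h : I.Placed c X m Y) {r : L} {rs : List L}
    (ht : c.todo = r :: rs) :
    ∃ X' m', I.Placed (I.next sel c) X' m' Y ∧ ((I.next sel c).edge = c.edge ∧
      ((I.next sel c).st = c.st ∨ ∃ C f n, I.Move c (I.next sel c) r C f n)) := by
  obtain ⟨e, s, prev, todo, st⟩ := c
  dsimp only at ht he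
  subst ht
  obtain ⟨hlay, htodo, habove, hbelow, hprev⟩ := h
  dsimp only at hlay htodo habove hbelow hprev
  have hre : r ∈ I.ends s (e + 1) := by rw [← htodo]; simp
  have hYe : ∀ y ∈ Y, y ∈ I.ends (otherSide s) (e + 1) := by
    cases s
    · rw [habove rfl]; simp
    · rw [hbelow rfl]; exact fun y hy => hy
  have hdisj : ∀ l, l ∈ I.ends s (e + 1) → l ∈ I.ends (otherSide s) (e + 1) → False := by
    intro l h₁ h₂
    cases s
    · exact I.ends_disjoint h₁ h₂
    · exact I.ends_disjoint h₂ h₁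
  have hrX : r ∉ X := by
    intro h
    have := I.nodup_ends s (e + 1)
    rw [← htodo] at this
    exact (List.nodup_append.1 this).2.2 r h r (by simp) rfl
  have hrm : r ∈ m := by
    have := (hlay.mem r).2 (line_mem_frame_endOrder_onEdge (I.last_of_mem_ends hre))
    rw [List.mem_append, List.mem_append] at this
    rcases this with (h | h) | h
    · exact absurd h hrX
    · exact h
    · exact (hdisj r hre (hYe r h)).elim
  have hmY : ∀ l ∈ m, l ∉ Y := fun l hl hlY =>
    (List.nodup_append.1 hlay.nodup).2.2 l (List.mem_append_right _ hl) l hlY rfl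
  have hY : ∀ l ∈ m, ∀ y ∈ Y, I.MustNotCross s (line l) (line y) := by
    intro l hl y hy
    refine mustNotCross_of_mem_other ((hlay.mem l).1 (by simp [hl])) ?_ (hYe y hy)
    intro hl'
    cases s
    · rw [habove rfl] at hy; simp at hy
    · exact hmY l hl (by rw [hbelow rfl]; exact hl')
  have hprev' : (outer s :: (X ++ [r]).map line).getLast? = some (line r) := by
    rw [List.map_append, ← List.cons_append, List.getLast?_append_of_ne_nil _ (by simp)]
    rfl
  have htodo' : X ++ [r] ++ rs = I.ends s (e + 1) := by rw [← htodo]; simp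
  rcases placeLine_spec hsel he hlay htodo hY hprev hrm with ⟨t, rfl, hst⟩ |
    ⟨C, t₁, t₂, hC, rfl, st', hst, hord, hcr, hhist, hallow, f, n, hn, hfl, hfh, hreason⟩
  · refine ⟨X ++ [r], t, ⟨?_, htodo', habove, hbelow, hprev'⟩, rfl, Or.inl hst⟩
    have : (I.next sel ⟨e, s, prev, r :: rs, st⟩).st.order = st.order := by
      change (I.placeLine sel s e prev (line r) st).order = _
      rw [hst]
    rw [this]
    refine hlay.of_perm (by simp) ?_
    rw [hlay.eq]; simp
  · have hst' : (I.next sel ⟨e, s, prev, r :: rs, st⟩).st = st' := hst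
    have hord₀ : st.order = orient s ((outer s :: X.map line) ++ C.map line ++
        (r :: t₁).map line ++
        (t₂.map line ++ (outer (otherSide s) :: Y.map line).reverse)) := by
      rw [← orient_orient s st.order, hlay.eq]; simp
    have hnd := hlay.nodup_orient
    rw [hord₀, orient_orient] at hnd
    have hlay' : I.Layout s e st'.order (X ++ [r]) (t₁ ++ C ++ t₂) Y := by
      refine hlay.of_perm ?_ ?_
      · rw [List.perm_iff_count]
        intro a
        simp only [List.count_append, List.count_cons, List.count_nil]
        omega
      · rw [hord, orient_orient]; simp
    have hnd' := hlay'.nodup_orient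
    have hgood : I.SidedGood s e prev (line r) := by
      refine sidedGood_of_consecutive he ?_
      rw [← htodo, List.map_append, ← List.cons_append, consecutive_append]
      exact Or.inr (Or.inr ⟨hprev, rfl⟩)
    have hncons : ¬ Consecutive prev (line r) (orient s st.order) := by
      intro h
      rw [hord₀, orient_orient] at h
      have h₁ : ∃ z ∈ C, Consecutive prev (line z) ((outer s :: X.map line) ++ C.map line ++
        (r :: t₁).map line ++ (t₂.map line ++ (outer (otherSide s) :: Y.map line).reverse)) := by
        obtain ⟨z, C', hz⟩ := List.exists_cons_of_ne_nil hC
        refine ⟨z, by rw [hz]; simp, ?_⟩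
        rw [List.append_assoc, List.append_assoc, consecutive_append]
        exact Or.inr (Or.inr ⟨hprev, by rw [hz]; rfl⟩)
      obtain ⟨z, hz, h₁⟩ := h₁
      have h₂ := line_injective (h.right_unique hnd h₁)
      have h₃ := (List.nodup_append.1 (List.nodup_append.1 hlay.nodup).1).2.1
      exact (List.nodup_append.1 h₃).2.2 z hz r (by simp) h₂.symm
    refine ⟨X ++ [r], t₁ ++ C ++ t₂, ⟨?_, htodo', habove, hbelow, hprev'⟩, rfl,
      Or.inr ⟨C, f, n, rfl, ?_, ?_, nodup_orient.1 hlay.nodup_orient, ?_, ?_, ?_, ?_, ?_, ?_, ?_, ?_,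
      hn, hreason⟩⟩
    · rw [hst']; exact hlay'
    · rw [hst']; exact hhist
    · rw [hst']; exact hcr
    · rw [hst']; exact nodup_orient.1 hnd'
    · rw [hst', ← hlay'.frame_unframe, ← hlay.frame_unframe]
      intro x
      rw [mem_frame, mem_frame]
      simp only [hlay.mem_unframe, hlay'.mem_unframe]
      exact id
    · rw [hst']
      intro x y hxy hyx
      have key : ∀ x y, [x, y].Sublist (orient s st.order) →
          [y, x].Sublist (orient s st'.order) → I.MustNotCross s y x := by
        intro x y h h'
        have hne := pair_sublist_ne hlay.nodup_orient h
        rw [hord₀, orient_orient] at h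
        rw [hord, orient_orient] at h'
        obtain ⟨hx, hy⟩ := pair_sublist_of_blocks hnd h h'
        obtain ⟨a, ha, rfl⟩ := List.mem_map.1 hx
        obtain ⟨b, hb, rfl⟩ := List.mem_map.1 hy
        exact (mustNotCross_total hne).resolve_left (hallow b hb a ha)
      cases s
      · exact key x y hxy hyx
      · exact key y x (pair_sublist_reverse.2 hxy) (pair_sublist_reverse.2 hyx)
    · rw [hst', hord, hord₀]
      simp only [unframe_orient, unframe_append, unframe_map_line]
      exact blockMove_orient hC (by simp)
    · exact fun l hl => (hlay.mem l).1 (by simp [hl])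
    · refine consecutiveEnds_of_consecutive ?_
      rw [← htodo, List.map_append, ← List.cons_append, consecutive_append]
      exact Or.inr (Or.inr ⟨hprev, rfl⟩)
    · rwa [consecutive_orient] at hncons
    · rw [hst']
      intro x y hg hc hc'
      have key : ∀ x y, I.SidedGood s e x y → Consecutive x y (orient s st.order) →
          ¬ Consecutive x y (orient s st'.order) → x = f (n - 1) ∧ y = f n := by
        intro x y hg h h'
        rw [hord₀, orient_orient] at h
        rw [hord, orient_orient] at h'
        have h₀ := hnd
        rcases (consecutive_of_blocks h (by simpa using hC) (by simp)).resolve_left h' with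
          ⟨h₁, h₂⟩ | ⟨h₁, h₂⟩ | ⟨h₁, h₂⟩
        · rw [hprev, Option.some_inj] at h₁
          subst h₁
          obtain rfl := hg.right_unique hgood
          exact (hncons (by rw [hord₀, orient_orient]; exact h)).elim
        · have h₂ : line r = y := by simpa using h₂
          subst h₂
          obtain rfl := hg.left_unique hgood
          exact (hncons (by rw [hord₀, orient_orient]; exact h)).elim
        · rw [hfl] at h₁
          rw [hfh] at h₂
          exact ⟨(Option.some_injective _ h₁).symm, (Option.some_injective _ h₂).symm⟩
      cases s
      · obtain ⟨rfl, rfl⟩ := key x y hg hc hc'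
        rfl
      · obtain ⟨rfl, rfl⟩ := key y x hg (consecutive_reverse.2 hc)
          (fun h => hc' (consecutive_reverse.1 h))
        rfl

variable (I) in
/-- The invariant of the algorithm. -/
structure Sound (sel : ℕ → Side → List ℕ → ℕ) (c : Config L) : Prop where
  placed : ∃ X m Y, I.Placed c X m Y
  head : c.st.history.head? = some (I.startState sel c.edge).order
  last : c.st.history.getLast? = some c.st.order
  mem : ∀ w ∈ c.st.history, (unframe w).Nodup ∧ ∀ l, l ∈ unframe w ↔ I.OnEdge c.edge l
  chain : c.st.history.IsChain (fun w w' => BlockMove (unframe w) (unframe w') ∧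
    I.MonotoneStep (unframe w) (unframe w'))
  kept : I.InitialPairsKept c.edge c.st.order c.st.created

theorem sound_start {sel : ℕ → Side → List ℕ → ℕ} {e : ℕ} {m : List L} (hm : m.Nodup)
    (hmem : ∀ l, l ∈ m ↔ I.PassesNode e l)
    (hord : (I.startState sel e).order = frame (I.startOrder e m))
    (hhist : (I.startState sel e).history = [frame (I.startOrder e m)])
    (hkept : I.InitialPairsKept e (frame (I.startOrder e m)) (I.startState sel e).created) :
    I.Sound sel (I.startConfig sel e) := by
  have hlay := layout_start hm hmem
  refine ⟨⟨[], I.startOrder e m, [], ?_, rfl, fun _ => rfl, fun h => (by cases h), rfl⟩, ?_, ?_, ?_,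
    ?_, ?_⟩
  · change I.Layout _ _ (I.startState sel e).order _ _ _
    rw [hord]; exact hlay
  · change (I.startState sel e).history.head? = some (I.startState sel e).order
    rw [hord, hhist]; rfl
  · change (I.startState sel e).history.getLast? = some (I.startState sel e).order
    rw [hord, hhist]; rfl
  · change ∀ w ∈ (I.startState sel e).history, _
    rw [hhist]
    intro w hw
    rw [List.mem_singleton] at hw
    subst hw
    exact ⟨hlay.nodup_unframe, fun l => hlay.mem_unframe⟩
  · change (I.startState sel e).history.IsChain _
    rw [hhist]
    exact List.isChain_singleton _
  · change I.InitialPairsKept e (I.startState sel e).order _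
    rw [hord]; exact hkept

theorem Sound.next {sel : ℕ → Side → List ℕ → ℕ}
    (hsel : ∀ (e : ℕ) (s : Side) (J : List ℕ), J ≠ [] → sel e s J ∈ J) {c : Config L}
    (h : I.Sound sel c) (hres : I.LeadsToResult sel c)
    (he : (I.next sel c).edge < I.numEdges) : I.Sound sel (I.next sel c) := by
  have hec : c.edge < I.numEdges := (edge_le_next sel c).1.trans_lt he
  obtain ⟨X, m, Y, hp⟩ := h.placed
  rcases htodo : c.todo with _ | ⟨r, rs⟩
  · obtain ⟨e, s, prev, todo, st⟩ := c
    dsimp only at htodo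
    subst htodo
    cases s
    · refine ⟨⟨Y, m.reverse, X, hp.layout.swap, ?_, fun h => (by cases h), fun _ => ?_, ?_⟩,
        h.head, h.last, h.mem, h.chain, h.kept⟩
      · rw [hp.above rfl]; rfl
      · have := hp.todo_eq
        rwa [List.append_nil] at this
      · rw [hp.above rfl]; rfl
    · obtain ⟨m', hord, hm', hmem, hfil⟩ := hp.final rfl rfl
      dsimp only at hord hmem hfil
      have hstart : I.next sel ⟨e, .below, prev, [], st⟩ = I.startConfig sel (e + 1) :=
        next_eq_startConfig hres
      rw [hstart] at he ⊢
      have hst : I.processEdge sel e (I.startState sel e) = st := hres.symm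
      have hs : I.startState sel (e + 1) = I.passNode e st := by rw [← hst]; rfl
      have hw : (I.passNode e st).order = frame (I.startOrder (e + 1) m') := by
        rw [← hfil]; rfl
      refine sound_start hm' hmem (by rw [hs, hw]) (by rw [hs, ← hw]; rfl) ?_
      refine InitialPairsKept.node he (created := st.created) hm' hmem ?_ ?_
      · rw [← hord]; exact h.kept
      · intro a b a' b' hab hc
        rw [hs]
        exact Finset.mem_filter.2 ⟨Finset.mem_univ _, (a, b), hab, hc⟩
  · obtain ⟨X', m', hp', hedge, hst | ⟨C, f, n, hmove⟩⟩ := hp.move hsel hec htodo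
    · exact ⟨⟨X', m', Y, hp'⟩, by rw [hst, hedge]; exact h.head, by rw [hst]; exact h.last,
        by rw [hst, hedge]; exact h.mem, by rw [hst]; exact h.chain,
        by rw [hst, hedge]; exact h.kept⟩
    · have hf := hp.layout.frame_unframe
      have hf' := hp'.layout.frame_unframe
      refine ⟨⟨X', m', Y, hp'⟩, ?_, ?_, ?_, ?_, ?_⟩
      · rw [hmove.history_eq, hedge, List.head?_append, h.head]; rfl
      · rw [hmove.history_eq]; simp
      · rw [hmove.history_eq, hedge]
        intro w hw
        rcases List.mem_append.1 hw with hw | hw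
        · exact h.mem w hw
        · rw [List.mem_singleton] at hw
          subst hw
          refine ⟨hp'.layout.nodup_unframe, fun l => ?_⟩
          rw [← hedge]
          exact hp'.layout.mem_unframe
      · rw [hmove.history_eq, List.isChain_append]
        refine ⟨h.chain, List.isChain_singleton _, ?_⟩
        intro x hx y hy
        rw [h.last, Option.mem_some_iff] at hx
        rw [List.head?_cons, Option.mem_some_iff] at hy
        subst hx hy
        refine ⟨hmove.blockMove, fun a b hab hba => ?_⟩
        refine hmove.mono (line a) (line b) ?_ ?_
        · rw [← hf]; exact pair_sublist_frame.2 hab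
        · rw [← hf']; exact pair_sublist_frame.2 hba
      · rw [hedge]
        refine h.kept.step hmove.nodup hmove.nodup' hmove.mem hmove.mono ?_
        intro x y hg hc hn
        rw [hmove.created_eq, Finset.mem_union, Finset.mem_filter, not_or] at hn
        refine ⟨hn.1, ?_⟩
        by_contra hcon
        exact hn.2 ⟨Finset.mem_univ _, hg, hc, hcon⟩

theorem sound_run {sel : ℕ → Side → List ℕ → ℕ}
    (hsel : ∀ (e : ℕ) (s : Side) (J : List ℕ), J ≠ [] → sel e s J ∈ J) (n : ℕ)
    (he : (I.run sel n).edge < I.numEdges) : I.Sound sel (I.run sel n) := by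
  induction n with
  | zero =>
    refine sound_start List.nodup_nil (by simp [PassesNode]) rfl rfl ?_
    exact initialPairsKept_start List.nodup_nil (by simp) (by simp)
  | succ n ih =>
    exact (ih ((edge_run_mono sel n.le_succ).trans_lt he)).next hsel (leadsToResult_run sel n) he

end Sound

end PathInstance

namespace PathInstance

open Strand

/-! ### Initial pairs along the run -/

section Orientation

variable {L : Type*} {I : PathInstance L}

theorem Follows.exists_inherits {p q : ℕ × Strand L × Strand L} (h : I.Follows p q)
    (hpq : p.1 < q.1) : ∃ q', I.Follows p q' ∧ I.Inherits q' q := by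
  rcases Relation.ReflTransGen.cases_tail h with h | ⟨q', h₁, h₂⟩
  · rw [h] at hpq
    exact absurd hpq (lt_irrefl _)
  · exact ⟨q', h₁, h₂⟩

theorem sidedGood_orientPair {s : Side} {e : ℕ} {x y a b : Strand L} (h : I.GoodPair e a b)
    (hab : (a, b) = orientPair s x y) : I.SidedGood s e x y := by
  cases s
  · cases hab; exact h
  · cases hab; exact h

end Orientation

section Tracking

variable {L : Type*} (I : PathInstance L) [Fintype L] [DecidableEq L]

/-- The pair is adjacent in the configuration, without having been created by a block crossing. -/
def InitialPair (c : Config L) (p : ℕ × Strand L × Strand L) : Prop :=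
  p.1 = c.edge ∧ Consecutive p.2.1 p.2.2 c.st.order ∧ p.2 ∉ c.st.created

/-- In the configuration `c` the algorithm breaks the pair `w`, which was not created by a block
crossing. -/
def Breaks (c : Config L) (w : ℕ × Strand L × Strand L) : Prop :=
  ∃ C f n i p, I.BreaksInitial c.side c.edge c.st.order c.st.created C f n i p ∧
    (∀ l ∈ C, I.OnEdge c.edge l) ∧ w = (c.edge, orientPair c.side (f (n - 1)) (f n))

/-- The step from `c` to `c'` leads to the next edge. -/
structure EntersEdge (c c' : Config L) (m : List L) : Prop where
  edge_eq : c'.edge = c.edge + 1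
  nodup : m.Nodup
  mem : ∀ l, l ∈ m ↔ I.PassesNode (c.edge + 1) l
  order_eq : c.st.order = frame (I.endOrder (c.edge + 1) m)
  order_eq' : c'.st.order = frame (I.startOrder (c.edge + 1) m)
  created_eq : c'.st.created = Finset.univ.filter (fun q => ∃ p ∈ c.st.created,
    I.Continues (c.edge + 1) p.1 p.2 q.1 q.2)
  history_eq : c'.st.history.length = 1

/-- In the configuration `c` a block crossing is made to bring the line `r` to its place. -/
def MovesLine (sel : ℕ → Side → List ℕ → ℕ) (c : Config L) (r : L) : Prop :=
  (∃ rs, c.todo = r :: rs) ∧ ∃ C f n, I.Move c (I.next sel c) r C f n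

variable {I} {sel : ℕ → Side → List ℕ → ℕ}

/-- The case distinction for inductions along the run. A change of side and a line already in place
both fall under the middle case, in which edge and state stay the same. -/
theorem step_cases (hsel : ∀ (e : ℕ) (s : Side) (J : List ℕ), J ≠ [] → sel e s J ∈ J) (n : ℕ)
    (he : (I.run sel n).edge < I.numEdges) :
    (∃ m, I.EntersEdge (I.run sel n) (I.run sel (n + 1)) m ∧
      (I.run sel n).st = I.processEdge sel (I.run sel n).edge
        (I.startState sel (I.run sel n).edge)) ∨
    ((I.run sel (n + 1)).edge = (I.run sel n).edge ∧ (I.run sel (n + 1)).st = (I.run sel n).st) ∨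
    ∃ r, I.MovesLine sel (I.run sel n) r := by
  have hs := sound_run hsel n he
  have hl := leadsToResult_run (I := I) sel n
  change (∃ m, I.EntersEdge _ (I.next sel (I.run sel n)) m ∧ _) ∨
    ((I.next sel (I.run sel n)).edge = _ ∧ (I.next sel (I.run sel n)).st = _) ∨ _
  generalize I.run sel n = c at *
  obtain ⟨X, m, Y, hp⟩ := hs.placed
  rcases htodo : c.todo with _ | ⟨r, rs⟩
  · obtain ⟨e, s, prev, todo, st⟩ := c
    dsimp only at htodo
    subst htodo
    cases s
    · exact Or.inr (Or.inl ⟨rfl, rfl⟩)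
    · left
      obtain ⟨m', hord, hm', hmem, hfil⟩ := hp.final rfl rfl
      refine ⟨m', ⟨rfl, hm', hmem, hord, ?_, rfl, rfl⟩, hl⟩
      dsimp only at hfil
      change frame (I.startOrder (e + 1) (List.filter _ _)) = _
      rw [hfil]
  · obtain ⟨X', m', hp', hedge, hst | ⟨C, f, n, hmove⟩⟩ := hp.move hsel he htodo
    · exact Or.inr (Or.inl ⟨hedge, hst⟩)
    · exact Or.inr (Or.inr ⟨r, ⟨rs, htodo⟩, C, f, n, hmove⟩)

theorem Move.mem_created {c c' : Config L} {r : L} {C : List L} {f : ℕ → Strand L} {n : ℕ}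
    (h : I.Move c c' r C f n) {a b : Strand L} :
    (a, b) ∈ c'.st.created ↔ (a, b) ∈ c.st.created ∨ (I.GoodPair c.edge a b ∧
      Consecutive a b c'.st.order ∧ ¬ Consecutive a b c.st.order) := by
  rw [h.created_eq, Finset.mem_union, Finset.mem_filter]
  simp

/-- Adjacency and the record of creations both travel along inheritance; by left uniqueness no pair
other than p can put q into the record. -/
theorem EntersEdge.initialPair_iff {c c' : Config L} {m : List L} (h : I.EntersEdge c c' m)
    {p q : ℕ × Strand L × Strand L} (hpq : I.Inherits p q) (hq : q.1 = c'.edge) :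
    InitialPair c' q ↔ InitialPair c p := by
  obtain ⟨hpq₁, hpq₂⟩ := hpq
  rw [hq, h.edge_eq] at hpq₁ hpq₂
  have h₁ := I.consecutive_iff_of_continues h.nodup h.mem hpq₂
  rw [← h.order_eq, ← h.order_eq'] at h₁
  have h₂ : q.2 ∈ c'.st.created ↔ p.2 ∈ c.st.created := by
    rw [h.created_eq, Finset.mem_filter]
    constructor
    · rintro ⟨-, x, hx, hxq⟩
      have := I.continues_left_unique hxq hpq₂
      rwa [← Prod.ext this.1 this.2]
    · exact fun h => ⟨Finset.mem_univ _, _, h, hpq₂⟩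
  unfold InitialPair
  rw [h₁, h₂, hq]
  have : p.1 = c.edge := by omega
  tauto

/-- Backwards in time: a good pair that becomes adjacent is recorded as created, and the record is
carried through nodes. A pair that is initial now was therefore adjacent and initial ever since n.
-/
theorem InitialPair.of_follows
    (hsel : ∀ (e : ℕ) (s : Side) (J : List ℕ), J ≠ [] → sel e s J ∈ J) {n n' : ℕ} (hn : n ≤ n')
    {p q : ℕ × Strand L × Strand L} (h : InitialPair (I.run sel n') q) (hq : I.Good q)
    (hpq : I.Follows p q) (hp : p.1 = (I.run sel n).edge) : InitialPair (I.run sel n) p := by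
  induction n', hn using Nat.le_induction generalizing q with
  | base =>
    obtain rfl := hpq.eq (by rw [h.1, hp])
    exact h
  | succ k hk ih =>
    have hlt := GoodPair.lt I hq
    rw [h.1] at hlt
    have hlt' := (edge_le_next sel (I.run sel k)).1.trans_lt hlt
    rcases step_cases hsel k hlt' with ⟨m, hm, -⟩ | ⟨h₁, h₂⟩ | ⟨r, -, C, f, i, hm⟩
    · obtain ⟨q', h₁, h₂⟩ := hpq.exists_inherits (by
        rw [h.1, hp, hm.edge_eq]
        exact Nat.lt_succ_of_le (edge_run_mono sel hk))
      exact ih ((hm.initialPair_iff h₂ h.1).1 h) (h₂.good_left hq) h₁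
    · refine ih ?_ hq hpq
      rw [InitialPair, h₁, h₂] at h
      exact h
    · refine ih ?_ hq hpq
      obtain ⟨e, a, b⟩ := q
      obtain ⟨h₁, h₂, h₃⟩ := h
      change _ = (I.next sel (I.run sel k)).edge at h₁
      rw [hm.edge_eq] at h₁
      subst h₁
      change _ ∉ (I.next sel (I.run sel k)).st.created at h₃
      rw [hm.mem_created, not_or] at h₃
      refine ⟨rfl, ?_, h₃.1⟩
      by_contra hcon
      exact h₃.2 ⟨hq, h₂, hcon⟩

/-- Forwards in time: an initial pair passes nodes unharmed, and of the reasons for a break only the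
last one can concern a good pair that is not recorded as created. -/
theorem InitialPair.exists_breaks
    (hsel : ∀ (e : ℕ) (s : Side) (J : List ℕ), J ≠ [] → sel e s J ∈ J) {n n' : ℕ} (hn : n ≤ n')
    {p q : ℕ × Strand L × Strand L} (h : InitialPair (I.run sel n) p) (hq : I.Good q)
    (hpq : I.Follows p q) (hq' : q.1 = (I.run sel n').edge) :
    InitialPair (I.run sel n') q ∨ ∃ k, n ≤ k ∧ k < n' ∧ ∃ w, I.Breaks (I.run sel k) w ∧
      ¬ Consecutive w.2.1 w.2.2 (I.run sel (k + 1)).st.order ∧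
      (I.run sel (k + 1)).edge = (I.run sel k).edge ∧
      I.Follows p w ∧ I.Follows w q := by
  induction n', hn using Nat.le_induction generalizing q with
  | base =>
    obtain rfl := hpq.eq (by rw [h.1, hq'])
    exact Or.inl h
  | succ k hk ih =>
    have hlt := GoodPair.lt I hq
    rw [hq'] at hlt
    have hlt' := (edge_le_next sel (I.run sel k)).1.trans_lt hlt
    rcases step_cases hsel k hlt' with ⟨m, hm, -⟩ | ⟨h₁, h₂⟩ | ⟨r, -, C, f, i, hm⟩
    · obtain ⟨q', h₁, h₂⟩ := hpq.exists_inherits (by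
        rw [h.1, hq', hm.edge_eq]
        exact Nat.lt_succ_of_le (edge_run_mono sel hk))
      rcases ih (h₂.good_left hq) h₁ (by have := h₂.1; have := hm.edge_eq; omega) with
        h₃ | ⟨t, ht, ht', w, hw, hw₀, hw', hw₁, hw₂⟩
      · exact Or.inl ((hm.initialPair_iff h₂ hq').2 h₃)
      · exact Or.inr ⟨t, ht, by omega, w, hw, hw₀, hw', hw₁, hw₂.tail h₂⟩
    · rcases ih hq hpq (by rw [hq', h₁]) with h₃ | ⟨t, ht, ht', h₃⟩
      · left
        rw [InitialPair, h₁, h₂]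
        exact h₃
      · exact Or.inr ⟨t, ht, by omega, h₃⟩
    · have hedge : (I.run sel (k + 1)).edge = (I.run sel k).edge := hm.edge_eq
      rcases ih hq hpq (by rw [hq', hedge]) with h₃ | ⟨t, ht, ht', h₃⟩
      · obtain ⟨e, a, b⟩ := q
        obtain ⟨h₄, h₅, h₆⟩ := h₃
        dsimp only at h₄
        subst h₄
        by_cases hc : Consecutive a b (I.run sel (k + 1)).st.order
        · refine Or.inl ⟨hq', hc, ?_⟩
          intro h'
          rcases hm.mem_created.1 h' with h' | h'
          · exact h₆ h'
          · exact h'.2.2 h₅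
        · right
          have hb := hm.broken a b hq h₅ hc
          obtain ⟨hi, h' | h' | ⟨i', p', hbr⟩⟩ := hm.reason
          · exact (h' (sidedGood_orientPair hq hb)).elim
          · rw [← hb] at h'
            exact (h₆ h').elim
          · refine ⟨k, hk, k.lt_succ_self, _, ⟨C, f, i, i', p', hbr, hm.onEdge, rfl⟩, ?_, hedge, ?_⟩
            · rw [← hb]; exact hc
            · rw [← hb]; exact ⟨hpq, .refl⟩
      · exact Or.inr ⟨t, ht, by omega, h₃⟩

end Tracking

end PathInstance

/-! ### Forced breaks of initial pairs -/

namespace PathInstance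

open Strand

/-- Nothing fits between consecutive elements, so an x behind the first member of the chain is
behind each of them. -/
theorem sublist_of_consecutive_chain {α : Type*} {w : List α} (hw : w.Nodup) {f : ℕ → α} {x : α}
    (hx : ∀ k, f k ≠ x) {a i : ℕ} (hai : a ≤ i)
    (hc : ∀ k, a ≤ k → k < i → Consecutive (f k) (f (k + 1)) w) (h : [f a, x].Sublist w) :
    [f i, x].Sublist w := by
  induction i, hai using Nat.le_induction with
  | base => exact h
  | succ k hk ih =>
    exact ((hc k hk k.lt_succ_self).behind_left hw
      (ih fun j hj hjk => hc j hj (hjk.trans k.lt_succ_self))).resolve_left (hx _).symm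

section Breaking

variable {L : Type*} {I : PathInstance L}

/-- The line l may be passed by `f (i - 1)` but not by `f i`, so `InitialPairsKept` leaves only the
alternative that l entered outside of `f i`. The two then enter and leave in the same order, and a
solution without double crossings keeps that order; this is the condition imposed on m. For the same
reason l can come between good partners only if `f i` ends on the other side. A virtual `f i`
satisfies both claims trivially. -/
theorem BreaksInitial.exists_before {s : Side} {e : ℕ}
    {order : List (Strand L)} {created : Finset (Strand L × Strand L)} {C : List L}
    {f : ℕ → Strand L} {n i p : ℕ} (h : I.BreaksInitial s e order created C f n i p)
    (hk : I.InitialPairsKept e order created) (hC : ∀ l ∈ C, I.OnEdge e l) :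
    I.EndsOn (otherSide s) (f i) ∧ ∃ l ∈ C, (∀ m : List L, m.Nodup →
        (∀ x, x ∈ m ↔ I.PassesNode (e + 1) x) →
        (∀ x y : L, I.OnEdge e x → I.OnEdge e y → I.EntersAbove x y → I.LeavesAbove x y →
          [x, y].Sublist (I.endOrder (e + 1) m)) →
        [line l, f i].Sublist (orient s (frame (I.endOrder (e + 1) m)))) := by
  obtain ⟨l, hl, hf⟩ := h.forbidden
  have hpos : 1 ≤ i := h.pos.trans (h.le.trans h.le')
  have hlast : i - 1 + 1 = i := by omega
  have hg := h.good (i - 1) (by omega)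
  have hc := h.consecutive (i - 1) (by omega)
  have hn := h.not_created (i - 1) (by have := h.le; have := h.le'; omega) (by omega)
  have hal := h.allowed (i - 1) (by omega) l hl
  have hbef := h.before i le_rfl l hl
  have hne := h.ne (i - 1) l hl
  have hle := hC l hl
  have hmem : ∀ m : List L, (∀ x, x ∈ m ↔ I.PassesNode (e + 1) x) →
      line l ∈ frame (I.endOrder (e + 1) m) := by
    intro m hm
    rw [line_mem_frame, mem_endOrder, hm, PassesNode]
    obtain ⟨h₁, h₂⟩ := hle
    omega
  rw [hlast] at hg hc hn
  have hmnc : I.MustNotCross s (f (i - 1)) (line l) := (mustNotCross_total hne).resolve_right hal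
  cases s
  · cases hz : f i with
    | top => exact absurd hz (GoodPair.ne_top hg)
    | bottom =>
      exact ⟨rfl, l, hl, fun m hm hm' _ => sublist_frame_bottom (hmem m hm') (by simp)⟩
    | line z =>
      rw [hz] at hg hc hn hf hbef
      have henter := (hk.from_above _ _ hg hc hn l hbef hf).resolve_right hal
      have hze := GoodPair.onEdge hg (Or.inr rfl)
      exact ⟨GoodPair.endsOn_below_of_between hg rfl hle hmnc hne hf henter, l, hl,
        fun m hm hm' hS => pair_sublist_frame.2 (hS l z hle hze henter hf)⟩
  · cases hz : f i with
    | bottom => exact absurd hz (GoodPair.ne_bottom hg)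
    | top =>
      exact ⟨rfl, l, hl, fun m hm hm' _ =>
        pair_sublist_reverse.2 (top_sublist_frame (hmem m hm') (by simp))⟩
    | line z =>
      rw [hz] at hg hc hn hf hbef
      have henter := (hk.from_below _ _ hg (consecutive_reverse.1 hc) hn l
        (pair_sublist_reverse.1 hbef) hf).resolve_right hal
      have hze := GoodPair.onEdge hg (Or.inl rfl)
      exact ⟨GoodPair.endsOn_above_of_between hg rfl hle hmnc hne.symm hf henter, l, hl,
        fun m hm hm' hS => pair_sublist_reverse.2 (pair_sublist_frame.2
          (hS z l hze hle henter hf))⟩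

/-- The line `f (p - 1)` ends at this node on side s and is allowed to pass l, so it leaves outside
of l in every order that is consistent at the node. -/
theorem BreaksInitial.sublist_endOrder {s : Side} {e : ℕ}
    {order : List (Strand L)} {created : Finset (Strand L × Strand L)} {C : List L}
    {f : ℕ → Strand L} {n i p : ℕ} (h : I.BreaksInitial s e order created C f n i p)
    (hC : ∀ l ∈ C, I.OnEdge e l) {l : L} (hl : l ∈ C) {m : List L}
    (hm : ∀ x, x ∈ m ↔ I.PassesNode (e + 1) x) :
    [f (p - 1), line l].Sublist (orient s (frame (I.endOrder (e + 1) m))) := by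
  have hends := h.endsAt
  have h₁ := h.pos
  have h₂ := h.le
  have h₃ := h.le'
  have hal := h.allowed (p - 1) (by omega) l hl
  have hne := h.ne (p - 1) l hl
  have hmnc : I.MustNotCross s (f (p - 1)) (line l) := (mustNotCross_total hne).resolve_right hal
  have hle := hC l hl
  have hmem : l ∈ I.endOrder (e + 1) m := by
    rw [mem_endOrder, hm, PassesNode]
    obtain ⟨h₁, h₂⟩ := hle
    omega
  cases hz : f (p - 1) with
  | top => rw [hz] at hends; exact hends.elim
  | bottom => rw [hz] at hends; exact hends.elim
  | line z =>
    rw [hz] at hends hmnc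
    have hlast := I.last_of_mem_ends hends
    have hzm : z ∈ I.endOrder (e + 1) m := (I.mem_endOrder).2 (Or.inr hlast)
    cases s
    · exact pair_sublist_frame.2 (I.sublist_endOrder_of_leavesAbove (fun x => (hm x).1) hzm hmem
        (Or.inl hlast) hmnc)
    · exact pair_sublist_reverse.2 (pair_sublist_frame.2
        (I.sublist_endOrder_of_leavesAbove (fun x => (hm x).1) hmem hzm (Or.inr hlast) hmnc))

/-- The pairs of the chain that the algorithm breaks cannot all remain adjacent. -/
theorem BreaksInitial.exists_not_adjacentAtEnd [DecidableEq L] {s : Side} {e : ℕ}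
    (he : e < I.numEdges)
    {order : List (Strand L)} {created : Finset (Strand L × Strand L)} {C : List L}
    {f : ℕ → Strand L} {n i p : ℕ} (h : I.BreaksInitial s e order created C f n i p)
    (hk : I.InitialPairsKept e order created) (hC : ∀ l ∈ C, I.OnEdge e l)
    {S : LineOrders L} (hS : I.MonotoneFeasible S) :
    ∃ k, p - 1 ≤ k ∧ k < i ∧ ¬ AdjacentAtEnd S (e, orientPair s (f k) (f (k + 1))) := by
  by_contra hcon
  push Not at hcon
  obtain ⟨-, l, hl, hl'⟩ := h.exists_before hk hC
  obtain ⟨m, hlast, hm, hm', -⟩ := hS.1.exists_getLast he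
  have h₁ := hl' m hm hm' fun x y hx hy h₁ h₂ =>
    hS.never_cross h₁ h₂ hx hy (List.mem_of_getLast? hlast)
  have h₂ := h.sublist_endOrder hC hl hm'
  have hn : (orient s (frame (I.endOrder (e + 1) m))).Nodup :=
    nodup_orient.2 (nodup_frame.2 (I.nodup_endOrder hm fun x => (hm' x).1))
  have h₃ := h.pos
  have h₄ := h.le
  have h₅ := h.le'
  -- If all pairs were adjacent, l, which lies behind `f (p - 1)`, would also lie behind `f i`,
  -- contrary to `h₁`.
  refine pair_sublist_antisymm hn h₁ (sublist_of_consecutive_chain hn (fun k => h.ne k l hl)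
    (a := p - 1) (by omega) (fun k hk hki => ?_) h₂)
  exact consecutive_orient.2 (hcon k hk hki _ hlast)

/-- The strands from `p - 1` to `n - 1` end on side s. From n on they end on the other side, since a
good pair never returns to the first one; hence the break is exactly at the change of side. -/
theorem BreaksInitial.exists_chain {s : Side} {e : ℕ}
    {order : List (Strand L)} {created : Finset (Strand L × Strand L)} {C : List L}
    {f : ℕ → Strand L} {n i p : ℕ} (h : I.BreaksInitial s e order created C f n i p)
    (hk : I.InitialPairsKept e order created) (hC : ∀ l ∈ C, I.OnEdge e l) :
    ∃ g i' j, I.Chain e g i' j ∧ orientPair s (f (n - 1)) (f n) = (g (j - 1), g j) ∧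
      ∀ q : Strand L × Strand L, (∃ k, p - 1 ≤ k ∧ k < i ∧ q = orientPair s (f k) (f (k + 1))) ↔
        ∃ k < i', q = (g k, g (k + 1)) := by
  obtain ⟨hi, -⟩ := h.exists_before hk hC
  have h₁ := h.pos
  have h₂ := h.le
  have h₃ := h.le'
  have hother : ∀ k, n ≤ k → k ≤ i → I.EndsOn (otherSide s) (f k) := by
    intro k hnk
    induction k, hnk using Nat.le_induction with
    | base =>
      intro _
      rcases h.endsOn_other with h₄ | h₄
      · exact h₄
      · rw [h₄]; exact hi
    | succ k hk ih =>
      intro hki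
      exact (h.good k (by omega)).endsOn_other (ih (by omega))
  have hsame : ∀ k, p - 1 ≤ k → k < n → I.EndsOn s (f k) := by
    intro k hpk hkn
    rcases Nat.lt_or_ge k p with hlt | hge
    · obtain rfl : k = p - 1 := by omega
      exact endsOn_of_endsAt h.endsAt
    · exact endsOn_of_not_endsOn_other (h.endsOn k hge hkn)
  cases s
  · refine ⟨fun k => f (p - 1 + k), i - (p - 1), n - (p - 1),
      ⟨fun k hk => h.good (p - 1 + k) (by omega), by omega, by omega,
        fun k hk => hsame _ (by omega) (by omega), fun k hk hk' => hother _ (by omega) (by omega)⟩,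
      ?_, fun q => ⟨?_, ?_⟩⟩
    · have e₁ : p - 1 + (n - (p - 1) - 1) = n - 1 := by omega
      have e₂ : p - 1 + (n - (p - 1)) = n := by omega
      simp only [e₁, e₂]
      rfl
    · rintro ⟨k, hk, hki, rfl⟩
      refine ⟨k - (p - 1), by omega, ?_⟩
      have e₁ : p - 1 + (k - (p - 1)) = k := by omega
      have e₂ : p - 1 + (k - (p - 1) + 1) = k + 1 := by omega
      simp only [e₁, e₂]
      rfl
    · rintro ⟨k, hk, rfl⟩
      exact ⟨p - 1 + k, by omega, by omega, rfl⟩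
  -- Seen from below the sequence runs upwards. It is reversed, and its first `i - n + 1` strands,
  -- from `f i` to `f n`, become the ones ending above.
  · refine ⟨fun k => f (i - k), i - (p - 1), i - n + 1,
      ⟨fun k hk => ?_, by omega, by omega, fun k hk => hother _ (by omega) (by omega),
        fun k hk hk' => hsame _ (by omega) (by omega)⟩, ?_, fun q => ⟨?_, ?_⟩⟩
    · have := h.good (i - (k + 1)) (by omega)
      rwa [show i - (k + 1) + 1 = i - k by omega] at this
    · have e₁ : i - (i - n + 1 - 1) = n := by omega
      have e₂ : i - (i - n + 1) = n - 1 := by omega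
      simp only [e₁, e₂]
      rfl
    · rintro ⟨k, hk, hki, rfl⟩
      refine ⟨i - (k + 1), by omega, ?_⟩
      have e₁ : i - (i - (k + 1)) = k + 1 := by omega
      have e₂ : i - (i - (k + 1) + 1) = k := by omega
      simp only [e₁, e₂]
      rfl
    · rintro ⟨k, hk, rfl⟩
      refine ⟨i - (k + 1), by omega, by omega, ?_⟩
      have e₁ : i - (k + 1) + 1 = i - k := by omega
      simp only [e₁]
      rfl

end Breaking

section BreakingPairs

variable {L : Type*} {I : PathInstance L} [Fintype L] [DecidableEq L]

/-- Where the algorithm breaks a pair that was not created by a block crossing, there is a chain of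
such pairs that cannot all remain adjacent in a solution. -/
theorem Breaks.exists_chain {sel : ℕ → Side → List ℕ → ℕ} {c : Config L} (hc : I.Sound sel c)
    (he : c.edge < I.numEdges) {w : ℕ × Strand L × Strand L} (h : I.Breaks c w) :
    ∃ g i j, I.Chain c.edge g i j ∧ w = (c.edge, g (j - 1), g j) ∧
      (∀ k < i, InitialPair c (c.edge, g k, g (k + 1))) ∧
      ∀ S, I.MonotoneFeasible S → ∃ k < i, ¬ AdjacentAtEnd S (c.edge, g k, g (k + 1)) := by
  obtain ⟨C, f, n, i, p, h, hC, rfl⟩ := h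
  obtain ⟨g, i', j, hg, hw, hpairs⟩ := h.exists_chain hc.kept hC
  refine ⟨g, i', j, hg, by rw [hw], fun k hk => ?_, fun S hS => ?_⟩
  · obtain ⟨k', hk₁, hk₂, hk₃⟩ := (hpairs _).2 ⟨k, hk, rfl⟩
    have h₁ := consecutive_orient.1 (h.consecutive k' hk₂)
    have h₂ := h.not_created k' (by omega) (by omega)
    rw [← hk₃] at h₁ h₂
    exact ⟨rfl, h₁, h₂⟩
  · obtain ⟨k', hk₁, hk₂, hk₃⟩ := h.exists_not_adjacentAtEnd he hc.kept hC hS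
    obtain ⟨k, hk, hk'⟩ := (hpairs _).1 ⟨k', hk₁, hk₂, rfl⟩
    rw [hk'] at hk₃
    exact ⟨k, hk, hk₃⟩

end BreakingPairs

end PathInstance

namespace PathInstance

open Strand

theorem crosses_comm {α : Type*} {a b : α} {π ρ : List α} :
    Crosses a b π ρ ↔ Crosses b a π ρ := or_comm

/-! ### Monotone moves never cross two lines twice -/

section Crossings

variable {L : Type*} {I : PathInstance L} [DecidableEq L]

theorem numCrossings_comm (S : LineOrders L) (a b : L) :
    I.numCrossings S a b = I.numCrossings S b a := by
  unfold numCrossings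
  simp only [crosses_comm (a := a) (b := b)]

/-- A sequence of monotone steps removes the inversion of two lines at most once, and never
creates it. -/
theorem countP_crosses_add_le {E : L → Prop} {a b : L} (hab : a ≠ b) (h : I.LeavesAbove a b) :
    ∀ {w : List (List L)} {π ρ : List L}, (∀ π ∈ w, π.Nodup ∧ ∀ l, l ∈ π ↔ E l) →
      w.IsChain I.MonotoneStep → w.head? = some π → w.getLast? = some ρ →
      (w.zip w.tail).countP (fun p => Crosses a b p.1 p.2) +
        (if [b, a].Sublist ρ then 1 else 0) ≤ (if [b, a].Sublist π then 1 else 0)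
  | [], _, _, _, _, hπ, _ => by simp at hπ
  | [x], _, _, _, _, hπ, hρ => by
    simp at hπ hρ
    subst hπ hρ
    simp
  | x :: y :: w, π, ρ, hw, hc, hπ, hρ => by
    simp at hπ
    subst hπ
    rw [List.isChain_cons_cons] at hc
    rw [List.getLast?_cons_cons] at hρ
    have ih := countP_crosses_add_le hab h (fun π hπ => hw π (List.mem_cons_of_mem _ hπ)) hc.2 rfl hρ
    have hx := hw x (by simp)
    have hy := hw y (by simp)
    have hno : [a, b].Sublist x → ¬ [b, a].Sublist y := fun h₁ h₂ =>
      I.leavesAbove_antisymm h (hc.1 a b h₁ h₂)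
    have hstep : (if Crosses a b x y then 1 else 0) + (if [b, a].Sublist y then 1 else 0) ≤
        (if [b, a].Sublist x then 1 else 0) := by
      by_cases h₁ : [b, a].Sublist y
      · have h₂ : [b, a].Sublist x := by
          refine (pair_sublist_total ?_ ?_ hab).resolve_left fun h₂ => hno h₂ h₁
          · rw [hx.2, ← hy.2]; exact pair_sublist_mem_right h₁
          · rw [hx.2, ← hy.2]; exact pair_sublist_mem_left h₁
        have h₃ : ¬ Crosses a b x y := by
          rintro (⟨h₃, h₄⟩ | ⟨h₃, h₄⟩)
          · exact hno h₃ h₄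
          · exact pair_sublist_antisymm hy.1 h₁ h₄
        simp [h₁, h₂, h₃]
      · by_cases h₂ : [b, a].Sublist x
        · simp only [h₁, h₂, if_true, if_false]
          split_ifs <;> simp
        · have h₃ : ¬ Crosses a b x y := by
            rintro (⟨-, h₃⟩ | ⟨h₃, -⟩)
            · exact h₁ h₃
            · exact h₂ h₃
          simp [h₁, h₂, h₃]
    simp only [List.tail_cons, List.zip_cons_cons, List.countP_cons, decide_eq_true_eq] at ih ⊢
    omega

theorem countP_crosses_eq_zero {E : L → Prop} {a b : L} (hab : ¬ (E a ∧ E b))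
    {w : List (List L)} (hw : ∀ π ∈ w, ∀ l, l ∈ π ↔ E l) :
    (w.zip w.tail).countP (fun p => Crosses a b p.1 p.2) = 0 := by
  rw [List.countP_eq_zero]
  rintro ⟨π, ρ⟩ hp h
  have hπ := hw π (List.of_mem_zip hp).1
  rcases of_decide_eq_true h with ⟨h, -⟩ | ⟨h, -⟩
  · exact hab ⟨(hπ a).1 (pair_sublist_mem_left h), (hπ b).1 (pair_sublist_mem_right h)⟩
  · exact hab ⟨(hπ a).1 (pair_sublist_mem_right h), (hπ b).1 (pair_sublist_mem_left h)⟩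

/-- Along the edges a and b have crossed at most once, and not at all as long as they are inverted:
a monotone step can only remove the inversion, and passing a node does not change it. -/
theorem Feasible.numCrossings_le_one {S : LineOrders L} (hS : I.Feasible S)
    (hmono : I.AllMovesMonotone S) {a b : L} (hab : a ≠ b) (h : I.LeavesAbove a b) :
    I.numCrossings S a b ≤ 1 := by
  have key : ∀ n, n ≤ I.numEdges → (∑ e ∈ Finset.range n,
      ((S e).zip (S e).tail).countP (fun p => Crosses a b p.1 p.2)) ≤ 1 ∧
      ∀ π ∈ (S n).head?, n < I.numEdges → [b, a].Sublist π → (∑ e ∈ Finset.range n,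
      ((S e).zip (S e).tail).countP (fun p => Crosses a b p.1 p.2)) = 0 := by
    intro n
    induction n with
    | zero => simp
    | succ n ih =>
      intro hn
      obtain ⟨ih₁, ih₂⟩ := ih (by omega)
      obtain ⟨m, hhead, -⟩ := hS.exists_head hn
      obtain ⟨m', hlast, hm, hm', hnext⟩ := hS.exists_getLast hn
      have hw := (hS.1 n hn).2.1
      have hle := countP_crosses_add_le hab h hw (hmono n hn) hhead hlast
      have ih₂ := ih₂ _ hhead hn
      rw [Finset.sum_range_succ]
      have hsum : (∑ e ∈ Finset.range n, ((S e).zip (S e).tail).countP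
          (fun p => Crosses a b p.1 p.2)) + ((S n).zip (S n).tail).countP
          (fun p => Crosses a b p.1 p.2) +
            (if [b, a].Sublist (I.endOrder (n + 1) m') then 1 else 0) ≤ 1 := by
        by_cases h₁ : [b, a].Sublist (I.startOrder n m)
        · rw [ih₂ h₁]
          simp only [h₁, if_true] at hle
          omega
        · simp only [h₁, if_false] at hle
          omega
      refine ⟨by omega, fun π hπ hn' hba => ?_⟩
      rw [hnext hn', Option.mem_some_iff] at hπ
      subst hπ
      have hon : I.OnEdge (n + 1) a ∧ I.OnEdge (n + 1) b := by
        have h₁ := I.mem_startOrder.1 (pair_sublist_mem_left hba)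
        have h₂ := I.mem_startOrder.1 (pair_sublist_mem_right hba)
        have := I.first_lt_last a
        have := I.first_lt_last b
        rw [hm', PassesNode] at h₁ h₂
        unfold OnEdge
        omega
      -- If the lines do not share the edge n, they meet for the first time on `n + 1`, so nothing
      -- has been counted yet.
      by_cases hprev : I.OnEdge n a ∧ I.OnEdge n b
      · have ha : a ∈ m' := (hm' a).2 ⟨Nat.lt_succ_of_le hprev.1.1, hon.1.2⟩
        have hb : b ∈ m' := (hm' b).2 ⟨Nat.lt_succ_of_le hprev.2.1, hon.2.2⟩
        have h₁ : [b, a].Sublist (I.endOrder (n + 1) m') :=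
          ((pair_sublist_startOrder_iff hm (fun l => (hm' l).1) hb ha).1 hba).trans
            (by simp [endOrder])
        simp only [h₁, if_true] at hsum
        omega
      · rw [← Finset.sum_range_succ, Finset.sum_eq_zero]
        intro e he
        rw [Finset.mem_range] at he
        refine countP_crosses_eq_zero (E := I.OnEdge e) ?_ fun π hπ => ((hS.1 e (by omega)).2.1 π hπ).2
        obtain ⟨⟨h₁, h₂⟩, h₃, h₄⟩ := hon
        unfold OnEdge at hprev ⊢
        omega
  exact (key _ le_rfl).1

theorem Feasible.monotoneFeasible {S : LineOrders L} (hS : I.Feasible S)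
    (hmono : I.AllMovesMonotone S) : I.MonotoneFeasible S := by
  refine ⟨hS, fun a b hab => ?_⟩
  rcases I.leavesAbove_total hab with h | h
  · exact hS.numCrossings_le_one hmono hab h
  · rw [numCrossings_comm]
    exact hS.numCrossings_le_one hmono hab.symm h

end Crossings

/-! ### Feasibility and monotonicity of the output -/

section Result

variable {L : Type*} {I : PathInstance L} [Fintype L] [DecidableEq L]
  {sel : ℕ → Side → List ℕ → ℕ}

theorem exists_sound_result (hsel : ∀ (e : ℕ) (s : Side) (J : List ℕ), J ≠ [] → sel e s J ∈ J)
    {e : ℕ} (he : e < I.numEdges) : ∃ c : Config L, c.edge = e ∧ c.side = .below ∧ c.todo = [] ∧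
      c.st = I.processEdge sel e (I.startState sel e) ∧ I.Sound sel c := by
  obtain ⟨n, prev, hn⟩ := exists_run_end sel e (exists_run_start (I := I) sel e)
  have := sound_run hsel n (by rw [hn]; exact he)
  rw [hn] at this
  exact ⟨_, rfl, rfl, rfl, rfl, this⟩

theorem exists_startState_order
    (hsel : ∀ (e : ℕ) (s : Side) (J : List ℕ), J ≠ [] → sel e s J ∈ J) {e : ℕ}
    (he : e < I.numEdges) : ∃ m : List L, (∀ l, l ∈ m ↔ I.PassesNode e l) ∧
      (I.startState sel e).order = frame (I.startOrder e m) := by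
  cases e with
  | zero => exact ⟨[], by simp [PassesNode], rfl⟩
  | succ e =>
    obtain ⟨c, rfl, hs, ht, hst, hc⟩ := exists_sound_result hsel (e.lt_succ_self.trans he)
    obtain ⟨X, m, Y, hp⟩ := hc.placed
    obtain ⟨m', -, -, hmem, hfil⟩ := hp.final hs ht
    refine ⟨m', hmem, ?_⟩
    rw [← hfil, hst]
    rfl

theorem feasible_algorithm
    (hsel : ∀ (e : ℕ) (s : Side) (J : List ℕ), J ≠ [] → sel e s J ∈ J) :
    I.Feasible (I.algorithm sel) := by
  have hhead : ∀ e < I.numEdges, (I.algorithm sel e).head? =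
      some (unframe (I.startState sel e).order) := by
    intro e he
    obtain ⟨c, rfl, -, -, hst, hc⟩ := exists_sound_result hsel he
    rw [algorithm, ← hst, List.head?_map, hc.head]
    rfl
  have hlast : ∀ e < I.numEdges, ∀ π ∈ (I.algorithm sel e).getLast?, ∃ m : List L,
      (∀ l, l ∈ m ↔ I.PassesNode (e + 1) l) ∧ π = I.endOrder (e + 1) m ∧
        (I.startState sel (e + 1)).order = frame (I.startOrder (e + 1) m) := by
    intro e he π hπ
    obtain ⟨c, rfl, hs, ht, hst, hc⟩ := exists_sound_result hsel he
    rw [algorithm, ← hst, List.getLast?_map, hc.last] at hπ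
    obtain ⟨X, m, Y, hp⟩ := hc.placed
    obtain ⟨m', hord, -, hmem, hfil⟩ := hp.final hs ht
    refine ⟨m', hmem, ?_, ?_⟩
    · rw [← Option.mem_some_iff.1 hπ, hord, unframe_frame]
    · rw [← hfil, hst]
      rfl
  refine ⟨fun e he => ?_, fun e he π hπ => ?_, fun π hπ h₀ => ?_, fun e he π hπ ρ hρ => ?_⟩
  · obtain ⟨c, rfl, -, -, hst, hc⟩ := exists_sound_result hsel he
    refine ⟨fun h => ?_, ?_, ?_⟩
    · have := hhead c.edge he
      rw [h] at this
      cases this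
    · rw [algorithm, ← hst]
      intro π hπ
      obtain ⟨w, hw, rfl⟩ := List.mem_map.1 hπ
      exact hc.mem w hw
    · rw [algorithm, ← hst, List.isChain_map]
      exact hc.chain.imp fun _ _ h => h.1
  · obtain ⟨m, hm, rfl, -⟩ := hlast e he π hπ
    rw [filter_onEdge_endOrder fun l => (hm l).1]
  · rw [hhead 0 h₀, Option.mem_some_iff] at hπ
    rw [← hπ]
    exact unframe_frame _
  · obtain ⟨m, hm, rfl, hst⟩ := hlast e (by omega) π hπ
    rw [hhead (e + 1) he, Option.mem_some_iff, hst, unframe_frame] at hρ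
    rw [filter_onEdge_endOrder fun l => (hm l).1, hρ]

theorem allMovesMonotone_algorithm
    (hsel : ∀ (e : ℕ) (s : Side) (J : List ℕ), J ≠ [] → sel e s J ∈ J) :
    I.AllMovesMonotone (I.algorithm sel) := by
  intro e he
  obtain ⟨c, rfl, -, -, hst, hc⟩ := exists_sound_result hsel he
  rw [algorithm, ← hst, List.isChain_map]
  exact hc.chain.imp fun _ _ h => h.2

end Result

end PathInstance

namespace PathInstance

open Strand

/-! ### The charging scheme -/

section Finality

variable {L : Type*} {I : PathInstance L}

theorem Chain.ne_of_ne {e : ℕ} {g : ℕ → Strand L} {i j k : ℕ} (h : I.Chain e g i j) (hk : k < i)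
    (hkj : k + 1 ≠ j) : (g k, g (k + 1)) ≠ (g (j - 1), g j) := by
  intro heq
  have hpos := h.pos
  have hle := h.le
  rcases Nat.lt_or_ge (k + 1) j with hlt | hge
  · have h₁ : g (k + 1) = g j := congrArg Prod.snd heq
    exact endsOn_disjoint (h₁ ▸ h.above (k + 1) hlt) (h.below j le_rfl hle)
  · have h₁ : g k = g (j - 1) := congrArg Prod.fst heq
    exact endsOn_disjoint (h.above (j - 1) (by omega)) (h₁ ▸ h.below k (by omega) hk.le)

theorem Follows.eq_of_consecutiveEnds {d q : ℕ × Strand L × Strand L} (h : I.Follows d q)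
    (hd : I.ConsecutiveEnds (d.1 + 1) d.2.1 d.2.2) : d = q := by
  rcases Relation.ReflTransGen.cases_head h with h | ⟨q', ⟨h₁, h₂⟩, -⟩
  · exact h
  · rw [h₁] at h₂
    exact (I.not_continues_of_consecutiveEnds hd h₂).elim

/-- Pairs identified with t lie on one path, and a pair that ends at a node has no continuation, so
there is only one such end. -/
theorem Follows.final_unique {t d d' : ℕ × Strand L × Strand L} (h : I.Follows t d)
    (h' : I.Follows t d') (hd : I.ConsecutiveEnds (d.1 + 1) d.2.1 d.2.2)
    (hd' : I.ConsecutiveEnds (d'.1 + 1) d'.2.1 d'.2.2) : d = d' := by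
  rcases le_total d.1 d'.1 with hle | hle
  · exact (h.total_right h' hle).eq_of_consecutiveEnds hd
  · exact ((h'.total_right h hle).eq_of_consecutiveEnds hd').symm

theorem Follows.exists_first : ∀ (e : ℕ) (d : ℕ × Strand L × Strand L), d.1 = e →
    ∃ p, I.Follows p d ∧ ∀ p', ¬ I.Inherits p' p
  | 0, d, h => ⟨d, .refl, fun p' hp' => by have := hp'.1; omega⟩
  | e + 1, d, h => by
    by_cases hd : ∃ p', I.Inherits p' d
    · obtain ⟨p', hp'⟩ := hd
      obtain ⟨p, hp, hp₁⟩ := Follows.exists_first e p' (by have := hp'.1; omega)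
      exact ⟨p, hp.tail hp', hp₁⟩
    · exact ⟨d, .refl, fun p' hp' => hd ⟨p', hp'⟩⟩

end Finality

section Charging

variable {L : Type*} {I : PathInstance L} [Fintype L] [DecidableEq L]
  {sel : ℕ → Side → List ℕ → ℕ}

/-- The pair that a configuration with next line `r` is about to bring together. -/
def intendedPair (c : Config L) (r : L) : ℕ × Strand L × Strand L :=
  (c.edge, orientPair c.side c.prev (line r))

theorem suffix_todo_run {n n' : ℕ} (hn : n ≤ n') (he : (I.run sel n').edge = (I.run sel n).edge) :
    ((I.run sel n').side = (I.run sel n).side ∧ (I.run sel n').todo <:+ (I.run sel n).todo) ∨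
    ((I.run sel n).side = .above ∧ (I.run sel n').side = .below) := by
  induction n', hn using Nat.le_induction with
  | base => exact Or.inl ⟨rfl, List.suffix_rfl⟩
  | succ k hk ih =>
    have h₁ := edge_run_mono (I := I) sel hk
    have h₂ := (edge_le_next (I := I) sel (I.run sel k)).1
    change (I.next sel (I.run sel k)).edge = _ at he
    have ih := ih (by omega)
    change ((I.next sel (I.run sel k)).side = _ ∧ (I.next sel (I.run sel k)).todo <:+ _) ∨
      (_ ∧ (I.next sel (I.run sel k)).side = _)
    generalize I.run sel k = c at *
    rcases c with ⟨e, s, prev, _ | ⟨r, rs⟩, st⟩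
    · cases s
      · right
        rcases ih with ⟨h, -⟩ | ⟨-, h⟩
        · exact ⟨h.symm, rfl⟩
        · cases h
      · change e + 1 = _ at he
        dsimp only at h₁
        omega
    · rcases ih with ⟨h, h'⟩ | h
      · exact Or.inl ⟨h, (List.suffix_cons r rs).trans h'⟩
      · exact Or.inr h

/-- On a given edge and side the inner line of the pair determines the step, because each line is
placed once. Steps on different sides cannot agree, since some line would end both above and below.
-/
theorem intendedPair_injective
    (hsel : ∀ (e : ℕ) (s : Side) (J : List ℕ), J ≠ [] → sel e s J ∈ J) {n n' : ℕ} {r r' : L}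
    (hr : ∃ rs, (I.run sel n).todo = r :: rs) (hr' : ∃ rs, (I.run sel n').todo = r' :: rs)
    (he : (I.run sel n).edge < I.numEdges)
    (h : intendedPair (I.run sel n) r = intendedPair (I.run sel n') r') : n = n' := by
  have key : ∀ {n n' : ℕ} {r r' : L}, (∃ rs, (I.run sel n).todo = r :: rs) →
      (∃ rs, (I.run sel n').todo = r' :: rs) → (I.run sel n).edge < I.numEdges →
      intendedPair (I.run sel n) r = intendedPair (I.run sel n') r' → ¬ n < n' := by
    rintro n n' r r' ⟨rs, hrs⟩ ⟨rs', hrs'⟩ he h hlt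
    have hedge : (I.run sel n').edge = (I.run sel n).edge := (congrArg Prod.fst h).symm
    have hpair : orientPair _ _ _ = orientPair _ _ _ := congrArg Prod.snd h
    have hedge' : (I.run sel (n + 1)).edge = (I.run sel n).edge := by
      have h₁ := edge_run_mono (I := I) sel (show n + 1 ≤ n' from hlt)
      have h₂ := edge_run_mono (I := I) sel (show n ≤ n + 1 from n.le_succ)
      omega
    obtain ⟨X, m, Y, hp⟩ := (sound_run hsel n he).placed
    obtain ⟨X', m', Y', hp'⟩ := (sound_run hsel n' (hedge ▸ he)).placed
    have hX := hp.todo_eq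
    have hX' := hp'.todo_eq
    rw [hrs] at hX
    rw [hrs'] at hX'
    have hsuf := suffix_todo_run (Nat.succ_le_of_lt hlt) (hedge.trans hedge'.symm)
    have hnext : (I.run sel (n + 1)).side = (I.run sel n).side ∧
        (I.run sel (n + 1)).todo = rs := by
      change (I.next sel (I.run sel n)).side = _ ∧ (I.next sel (I.run sel n)).todo = _
      generalize I.run sel n = c at hrs
      obtain ⟨e, s, prev, todo, st⟩ := c
      dsimp only at hrs
      subst hrs
      exact ⟨rfl, rfl⟩
    rw [hnext.1, hnext.2, hrs'] at hsuf
    rcases hsuf with ⟨hs, hsuf⟩ | ⟨hs, hs'⟩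
    · have hrr : r = r' := by
        rw [hs] at hpair
        cases hside : (I.run sel n).side <;> rw [hside] at hpair
        · exact line_injective (congrArg Prod.snd hpair)
        · exact line_injective (congrArg Prod.fst hpair)
      subst hrr
      have hn := I.nodup_ends (I.run sel n).side ((I.run sel n).edge + 1)
      rw [← hX] at hn
      exact (List.nodup_cons.1 (List.nodup_append.1 hn).2.1).1 (hsuf.subset (by simp))
    · rw [hs, hs'] at hpair
      have h₁ : (I.run sel n).prev = line r' := congrArg Prod.fst hpair
      have h₂ := List.mem_of_getLast? hp.prev
      rw [h₁, hs, line_mem_outer_cons] at h₂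
      have h₃ : r' ∈ I.ends .above ((I.run sel n).edge + 1) := by
        rw [← hs, ← hX]
        exact List.mem_append_left _ h₂
      have h₄ : r' ∈ I.ends .below ((I.run sel n').edge + 1) := by
        rw [← hs', ← hX']
        simp
      exact I.ends_disjoint h₃ h₄
  have he' : (I.run sel n').edge < I.numEdges := by
    rw [show (I.run sel n').edge = (I.run sel n).edge from (congrArg Prod.fst h).symm]
    exact he
  exact le_antisymm (not_lt.1 (key hr' hr he' h.symm)) (not_lt.1 (key hr hr' he h))

/-- In step `m` the algorithm breaks a chain of initial pairs where it changes the side; `k` is the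
position of another pair of the chain. -/
structure ChainBroken (I : PathInstance L) (sel : ℕ → Side → List ℕ → ℕ) (m : ℕ)
    (g : ℕ → Strand L) (i j k : ℕ) : Prop where
  chain : I.Chain (I.run sel m).edge g i j
  initial : ∀ k < i, InitialPair (I.run sel m) ((I.run sel m).edge, g k, g (k + 1))
  broken : ¬ Consecutive (g (j - 1)) (g j) (I.run sel (m + 1)).st.order
  edge_eq : (I.run sel (m + 1)).edge = (I.run sel m).edge
  lt : k < i
  ne : k + 1 ≠ j

/-- With the pair at k, the pair broken in step m would reappear in the later chain
(`Chain.exists_follows`). It would be initial there, hence adjacent right after step m, in which it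
was broken. -/
theorem ChainBroken.false_of_follows
    (hsel : ∀ (e : ℕ) (s : Side) (J : List ℕ), J ≠ [] → sel e s J ∈ J)
    {m m' : ℕ} {g g' : ℕ → Strand L} {i j k i' j' k' : ℕ} (h : I.ChainBroken sel m g i j k)
    (h' : I.Chain (I.run sel m').edge g' i' j')
    (hinit : ∀ k < i', InitialPair (I.run sel m') ((I.run sel m').edge, g' k, g' (k + 1)))
    (hm : m < m') (hk : k' < i')
    (hf : I.Follows ((I.run sel m).edge, g k, g (k + 1))
      ((I.run sel m').edge, g' k', g' (k' + 1))) : False := by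
  obtain ⟨k₂, hk₂, hf₂⟩ := h.chain.exists_follows h' hf.le h.lt h.ne hk hf
  have := (hinit k₂ hk₂).of_follows hsel (n := m + 1) hm (h'.good k₂ hk₂) hf₂ h.edge_eq.symm
  exact h.broken this.2.1

/-- A step that stays on its edge separates at most one good pair, namely the one at the break. -/
theorem eq_of_initialPair_of_not_consecutive
    (hsel : ∀ (e : ℕ) (s : Side) (J : List ℕ), J ≠ [] → sel e s J ∈ J) {m : ℕ}
    {p q : ℕ × Strand L × Strand L} (hp : InitialPair (I.run sel m) p)
    (hq : InitialPair (I.run sel m) q) (hpg : I.Good p) (hqg : I.Good q)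
    (he : (I.run sel (m + 1)).edge = (I.run sel m).edge)
    (hpc : ¬ Consecutive p.2.1 p.2.2 (I.run sel (m + 1)).st.order)
    (hqc : ¬ Consecutive q.2.1 q.2.2 (I.run sel (m + 1)).st.order) : p = q := by
  have hlt := GoodPair.lt I hpg
  rw [hp.1] at hlt
  rcases step_cases hsel m hlt with ⟨_, hm, -⟩ | ⟨-, h⟩ | ⟨r, -, C, f, n, hm⟩
  · have := hm.edge_eq
    omega
  · rw [h] at hpc
    exact absurd hp.2.1 hpc
  · have hpg' : I.GoodPair _ _ _ := hpg
    have hqg' : I.GoodPair _ _ _ := hqg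
    rw [hp.1] at hpg'
    rw [hq.1] at hqg'
    have h₁ := hm.broken _ _ hpg' hp.2.1 hpc
    have h₂ := hm.broken _ _ hqg' hq.2.1 hqc
    exact Prod.ext (hp.1.trans hq.1.symm) (h₁.trans h₂.symm)

variable (I) in
/-- The creation `t` pays for the block crossing made in step `n` to bring the pair `d` together:
either `t` belongs to `d`, or it belongs to a pair from whose chain the initial pair belonging to
`d` was broken. -/
def Charged (sel : ℕ → Side → List ℕ → ℕ) (n : ℕ) (d t : ℕ × Strand L × Strand L) : Prop :=
  I.Follows t d ∨ ∃ m < n, ∃ g i j k, I.ChainBroken sel m g i j k ∧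
    I.Follows ((I.run sel m).edge, g (j - 1), g j) d ∧
    I.Follows ((I.run sel m).edge, g k, g (k + 1)) t

/-- Adjacency at birth does not depend on the solution, and a pair that continues no earlier pair
cannot be in the record of creations. -/
theorem consecutive_start {e : ℕ}
    (hsel : ∀ (e : ℕ) (s : Side) (J : List ℕ), J ≠ [] → sel e s J ∈ J) {S : LineOrders L}
    (hS : I.MonotoneFeasible S) {a b : Strand L} (he : e < I.numEdges)
    (hinit : ∀ p, ¬ I.Inherits p (e, a, b)) (h : AdjacentAtStart S (e, a, b)) :
    InitialPair (I.startConfig sel e) (e, a, b) := by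
  obtain ⟨m, hm, hord⟩ := exists_startState_order hsel he
  refine ⟨rfl, ?_, ?_⟩
  · change Consecutive a b (I.startState sel e).order
    rw [hord]
    exact hS.consecutive_of_initial he hinit h hm
  · change (a, b) ∉ (I.startState sel e).created
    cases e with
    | zero => exact Finset.notMem_empty _
    | succ e =>
      intro h
      obtain ⟨p, -, hp⟩ := (Finset.mem_filter.1 h).2
      exact hinit (e, p) ⟨rfl, hp⟩

/-- Either S creates the pair itself, or the pair is adjacent in S all the time and the algorithm
broke it earlier within a chain that S cannot keep together either. -/
theorem MovesLine.exists_charged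
    (hsel : ∀ (e : ℕ) (s : Side) (J : List ℕ), J ≠ [] → sel e s J ∈ J) {S : LineOrders L}
    (hS : I.MonotoneFeasible S) {n : ℕ} (he : (I.run sel n).edge < I.numEdges) {r : L}
    (h : I.MovesLine sel (I.run sel n) r) :
    ∃ t ∈ I.creations S, I.Charged sel n (intendedPair (I.run sel n) r) t := by
  obtain ⟨-, C, f, i, hmove⟩ := h
  set d := intendedPair (I.run sel n) r with hd
  by_cases hcr : ∃ t ∈ I.creations S, I.Follows t d
  · obtain ⟨t, ht, htd⟩ := hcr
    exact ⟨t, ht, Or.inl htd⟩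
  push Not at hcr
  have hdg : I.Good d := .ending he hmove.ends
  -- The leftmost pair identified with d, where its adjacency comes into existence.
  obtain ⟨⟨e, a, b⟩, hp, hp'⟩ := Follows.exists_first (I := I) _ d rfl
  have hadj : ∀ {q}, I.Follows q d → AdjacentAtEnd S q ∧ AdjacentAtStart S q := fun h =>
    hS.1.adjacent_of_not_created he hmove.ends hcr h
  have hep : e < I.numEdges := hp.le.trans_lt he
  obtain ⟨n₁, hn₁, hrun⟩ := exists_run_start_le (I := I) sel n e hp.le
  have hinit : InitialPair (I.run sel n₁) (e, a, b) := by
    rw [hrun]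
    exact consecutive_start hsel hS hep hp' (hadj hp).2
  rcases hinit.exists_breaks hsel hn₁ hdg hp rfl with h | ⟨m, -, hm, w, hw, hw₀, hw₁, -, hwd⟩
  · exact (hmove.not_consecutive h.2.1).elim
  · have hem : (I.run sel m).edge < I.numEdges := (edge_run_mono sel hm.le).trans_lt he
    obtain ⟨g, i, j, hchain, rfl, hinits, hbreak⟩ := hw.exists_chain (sound_run hsel m hem) hem
    obtain ⟨k, hk, hnadj⟩ := hbreak S hS
    -- The broken pair leads to d and is adjacent in S, so the pair that S separates is another one
    -- of the chain.
    have hkj : k + 1 ≠ j := by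
      rintro rfl
      exact hnadj (hadj hwd).1
    obtain ⟨t, ht, htf⟩ := hS.1.exists_creation (hchain.good k hk) hnadj
    exact ⟨t, ht, Or.inr ⟨m, hm, g, i, j, k, ⟨hchain, hinits, hw₀, hw₁, hk, hkj⟩, hwd, htf⟩⟩

/-- The pair that is brought together in step n is not adjacent at that time. If it continued the
pair at k, which is initial in step m, that initial pair would have been broken in between. -/
theorem ChainBroken.not_follows_intendedPair
    (hsel : ∀ (e : ℕ) (s : Side) (J : List ℕ), J ≠ [] → sel e s J ∈ J) {n m : ℕ} {r : L}
    (he : (I.run sel n).edge < I.numEdges) (h : I.MovesLine sel (I.run sel n) r)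
    {g : ℕ → Strand L} {i j k : ℕ} (hb : I.ChainBroken sel m g i j k)
    (hf : I.Follows ((I.run sel m).edge, g k, g (k + 1)) (intendedPair (I.run sel n) r)) :
    False := by
  obtain ⟨-, C, f, i', hmove⟩ := h
  have hdg : I.Good (intendedPair (I.run sel n) r) := .ending he hmove.ends
  have hκ := hb.initial k hb.lt
  rcases le_total n m with hnm | hmn
  · have heq := hf.eq (edge_run_mono sel hnm)
    have := InitialPair.of_follows hsel hnm (heq ▸ hκ) hdg .refl rfl
    exact hmove.not_consecutive this.2.1
  · rcases hκ.exists_breaks hsel hmn hdg hf rfl with h | ⟨m', hmm', hm', w, hw, hw₀, hw₁, hκw, hwd⟩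
    · exact hmove.not_consecutive h.2.1
    · have hem : (I.run sel m').edge < I.numEdges := (edge_run_mono sel hm'.le).trans_lt he
      obtain ⟨g', i₂, j', hchain, rfl, hinits, -⟩ := hw.exists_chain (sound_run hsel m' hem) hem
      have hpos := hchain.pos
      have hle := hchain.le
      have hj : j' - 1 + 1 = j' := by omega
      -- Step m itself breaks only the pair at the change of side. A later break would need a chain
      -- that contains a continuation of the pair at k.
      rcases hmm'.eq_or_lt with rfl | hlt
      · have heq := hκw.eq le_rfl
        rw [← heq] at hw₀
        have hpos' := hb.chain.pos
        have hle' := hb.chain.le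
        have hj' : j - 1 + 1 = j := by omega
        have hinit' := hb.initial (j - 1) (by omega)
        have hgood' := hb.chain.good (j - 1) (by omega)
        rw [hj'] at hinit' hgood'
        have := eq_of_initialPair_of_not_consecutive hsel hκ hinit' (hb.chain.good k hb.lt) hgood'
          hw₁ hw₀ hb.broken
        exact hb.chain.ne_of_ne hb.lt hb.ne (congrArg Prod.snd this)
      · exact hb.false_of_follows hsel hchain hinits hlt (k' := j' - 1) (by omega)
          (by rw [hj]; exact hκw)

/-- Two direct charges lead to the same final pair. A direct and an indirect one are excluded by
`ChainBroken.not_follows_intendedPair`, two indirect ones from different steps by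
`ChainBroken.false_of_follows`. From the same step, the two broken pairs coincide and lead to the
same final pair. -/
theorem Charged.unique
    (hsel : ∀ (e : ℕ) (s : Side) (J : List ℕ), J ≠ [] → sel e s J ∈ J) {n n' : ℕ} {r r' : L}
    (he : (I.run sel n).edge < I.numEdges) (he' : (I.run sel n').edge < I.numEdges)
    (h : I.MovesLine sel (I.run sel n) r) (h' : I.MovesLine sel (I.run sel n') r')
    {t : ℕ × Strand L × Strand L} (ht : I.Charged sel n (intendedPair (I.run sel n) r) t)
    (ht' : I.Charged sel n' (intendedPair (I.run sel n') r') t) : n = n' := by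
  have hfin : ∀ {q}, I.Follows q (intendedPair (I.run sel n) r) →
      I.Follows q (intendedPair (I.run sel n') r') → n = n' := by
    intro q hq hq'
    obtain ⟨htodo, C, f, i, hmove⟩ := h
    obtain ⟨htodo', C', f', i', hmove'⟩ := h'
    exact intendedPair_injective hsel htodo htodo' he
      (hq.final_unique hq' hmove.ends hmove'.ends)
  rcases ht with ht | ⟨m, hm, g, i, j, k, hb, hbd, hbt⟩
  · rcases ht' with ht' | ⟨m', hm', g', i', j', k', hb', hbd', hbt'⟩
    · exact hfin ht ht'
    · exact (hb'.not_follows_intendedPair hsel he h (hbt'.trans ht)).elim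
  · rcases ht' with ht' | ⟨m', hm', g', i', j', k', hb', hbd', hbt'⟩
    · exact (hb.not_follows_intendedPair hsel he' h' (hbt.trans ht')).elim
    · rcases lt_trichotomy m m' with hlt | rfl | hlt
      · exact (hb.false_of_follows hsel hb'.chain hb'.initial hlt hb'.lt
          (hbt.total_left hbt' (edge_run_mono sel hlt.le))).elim
      · have hpos := hb.chain.pos
        have hle := hb.chain.le
        have hpos' := hb'.chain.pos
        have hle' := hb'.chain.le
        have hi := hb.initial (j - 1) (by omega)
        have hg := hb.chain.good (j - 1) (by omega)
        have hi' := hb'.initial (j' - 1) (by omega)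
        have hg' := hb'.chain.good (j' - 1) (by omega)
        rw [show j - 1 + 1 = j by omega] at hi hg
        rw [show j' - 1 + 1 = j' by omega] at hi' hg'
        have := eq_of_initialPair_of_not_consecutive hsel hi hi' hg hg' hb.edge_eq hb.broken
          hb'.broken
        rw [← this] at hbd'
        exact hfin hbd hbd'
      · exact (hb'.false_of_follows hsel hb.chain hb.initial hlt hb.lt
          (hbt'.total_left hbt (edge_run_mono sel hlt.le))).elim

end Charging

/-! ### Comparison with an arbitrary solution -/

section Counting

variable {L : Type*} {I : PathInstance L} [Fintype L] [DecidableEq L]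
  {sel : ℕ → Side → List ℕ → ℕ}

open Classical in
variable (I) in
/-- The steps before `n` in which the algorithm makes a block crossing. -/
noncomputable def movesBefore (sel : ℕ → Side → List ℕ → ℕ) (n : ℕ) : Finset ℕ :=
  (Finset.range n).filter fun k => ∃ r, I.MovesLine sel (I.run sel k) r

theorem mem_movesBefore {n k : ℕ} :
    k ∈ I.movesBefore sel n ↔ k < n ∧ ∃ r, I.MovesLine sel (I.run sel k) r := by
  simp [movesBefore]

/-- A history starts with one order and grows only by block crossings; the summand 1 is the initial
order of the current edge. -/
theorem sum_add_length_le
    (hsel : ∀ (e : ℕ) (s : Side) (J : List ℕ), J ≠ [] → sel e s J ∈ J) {T : ℕ}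
    (hT : ∀ k < T, (I.run sel k).edge < I.numEdges) : ∀ n ≤ T,
    (∑ e ∈ Finset.range (I.run sel n).edge, ((I.algorithm sel e).length - 1)) +
      (I.run sel n).st.history.length ≤ (I.movesBefore sel n).card + 1 := by
  intro n
  induction n with
  | zero => exact fun _ => le_rfl
  | succ n ih =>
    intro hn
    have ih := ih (by omega)
    have hsub : I.movesBefore sel n ⊆ I.movesBefore sel (n + 1) :=
      fun k hk => by
        rw [mem_movesBefore] at hk ⊢
        exact ⟨hk.1.trans n.lt_succ_self, hk.2⟩
    have hcard := Finset.card_le_card hsub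
    rcases step_cases hsel n (hT n (by omega)) with ⟨m, hm, hst⟩ | ⟨h₁, h₂⟩ | ⟨r, hr⟩
    · rw [hm.edge_eq, Finset.sum_range_succ, hm.history_eq]
      have : (I.algorithm sel (I.run sel n).edge).length =
          (I.run sel n).st.history.length := by
        rw [algorithm, List.length_map, ← hst]
      have hs := (sound_run hsel n (hT n (by omega))).last
      have hpos : (I.run sel n).st.history.length ≠ 0 := by
        intro h
        rw [List.length_eq_zero_iff.1 h] at hs
        cases hs
      omega
    · rw [h₁, h₂]
      omega
    · have hlt : I.movesBefore sel n ⊂ I.movesBefore sel (n + 1) := by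
        refine Finset.ssubset_iff_subset_ne.2 ⟨hsub, fun h => ?_⟩
        have hmem : n ∈ I.movesBefore sel (n + 1) :=
          mem_movesBefore.2 ⟨n.lt_succ_self, r, hr⟩
        rw [← h] at hmem
        exact absurd (mem_movesBefore.1 hmem).1 (lt_irrefl _)
      have hcard := Finset.card_lt_card hlt
      obtain ⟨-, C, f, i, hmove⟩ := hr
      change (∑ e ∈ Finset.range (I.next sel (I.run sel n)).edge, _) +
        (I.next sel (I.run sel n)).st.history.length ≤ _
      rw [hmove.edge_eq, hmove.history_eq, List.length_append]
      simp only [List.length_singleton]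
      omega

/-- Proved directly, because the count is evaluated when the run reaches the index `numEdges`, to
which `sound_run` does not apply. -/
theorem history_ne_nil (sel : ℕ → Side → List ℕ → ℕ) (n : ℕ) : (I.run sel n).st.history ≠ [] := by
  induction n with
  | zero => exact List.cons_ne_nil _ _
  | succ n ih =>
    change (I.next sel (I.run sel n)).st.history ≠ []
    generalize I.run sel n = c at *
    rcases c with ⟨e, s, prev, _ | ⟨r, rs⟩, st⟩
    · cases s
      · exact ih
      · exact List.cons_ne_nil _ _
    · change (I.placeLine sel s e prev (line r) st).history ≠ []
      unfold placeLine
      extract_lets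
      split_ifs
      · exact ih
      · exact List.append_ne_nil_of_right_ne_nil _ (List.cons_ne_nil _ _)

theorem numBlockCrossings_algorithm_le
    (hsel : ∀ (e : ℕ) (s : Side) (J : List ℕ), J ≠ [] → sel e s J ∈ J) {S : LineOrders L}
    (hS : I.MonotoneFeasible S) :
    I.numBlockCrossings (I.algorithm sel) ≤ 3 * I.numBlockCrossings S := by
  classical
  have hex : ∃ n, (I.run sel n).edge = I.numEdges := by
    obtain ⟨n, hn⟩ := exists_run_start (I := I) sel I.numEdges
    exact ⟨n, by rw [hn]; rfl⟩
  have hT : ∀ k < Nat.find hex, (I.run sel k).edge < I.numEdges := fun k hk =>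
    lt_of_le_of_ne ((edge_run_mono sel hk.le).trans (Nat.find_spec hex).le) (Nat.find_min hex hk)
  refine le_trans ?_ (card_creations_le hS.1)
  -- Each crossing is charged to some creation and each creation is charged at most once, so no
  -- choice of an injection is needed.
  refine le_trans ?_ (Finset.card_le_card_of_forall_subsingleton
    (s := I.movesBefore sel (Nat.find hex)) (fun n t => ∃ r, I.MovesLine sel (I.run sel n) r ∧
      I.Charged sel n (intendedPair (I.run sel n) r) t) ?_ ?_)
  · have h := sum_add_length_le hsel hT _ le_rfl
    have hpos := List.length_pos_iff.2 (history_ne_nil (I := I) sel (Nat.find hex))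
    rw [Nat.find_spec hex] at h
    unfold numBlockCrossings
    omega
  · intro n hn
    obtain ⟨hn, r, hr⟩ := mem_movesBefore.1 hn
    obtain ⟨t, ht, htc⟩ := hr.exists_charged hsel hS (hT n hn)
    exact ⟨t, ht, r, hr, htc⟩
  · rintro t - n ⟨hn, r, hr, hc⟩ n' ⟨hn', r', hr', hc'⟩
    exact Charged.unique hsel (hT n (mem_movesBefore.1 hn).1)
      (hT n' (mem_movesBefore.1 hn').1) hr hr' hc hc'

end Counting

end PathInstance

theorem mainTheorem5 {L : Type*} [Fintype L] [DecidableEq L] (I : PathInstance L)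
    (sel : ℕ → Side → List ℕ → ℕ)
    (hsel : ∀ (e : ℕ) (s : Side) (J : List ℕ), J ≠ [] → sel e s J ∈ J) :
    I.Feasible (I.algorithm sel) ∧
    I.AllMovesMonotone (I.algorithm sel) ∧
    I.MonotoneFeasible (I.algorithm sel) ∧
    ∃ opt : ℕ,
      IsLeast {n | ∃ S : LineOrders L, I.MonotoneFeasible S ∧ I.numBlockCrossings S = n} opt ∧
      I.numBlockCrossings (I.algorithm sel) ≤ 3 * opt := by
  have hf := PathInstance.feasible_algorithm (I := I) hsel
  have hm := PathInstance.allMovesMonotone_algorithm (I := I) hsel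
  have hmf := hf.monotoneFeasible hm
  -- The output of the algorithm is itself a monotone solution, so the minimum is taken over a
  -- nonempty set.
  have hopt := Nat.sInf_mem
    (s := {n | ∃ S : LineOrders L, I.MonotoneFeasible S ∧ I.numBlockCrossings S = n})
    ⟨_, _, hmf, rfl⟩
  refine ⟨hf, hm, hmf, _, ⟨hopt, fun _ h => Nat.sInf_le h⟩, ?_⟩
  obtain ⟨S, hS, hS'⟩ := hopt
  rw [← hS']
  exact PathInstance.numBlockCrossings_algorithm_le hsel hS
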